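/- Throughout, $p$ is a prime. A \emph{$p$-local finite group} is a triple $(S,\mathcal F,\mathcal L)$ where $S$ is a finite $p$-group, $\mathcal F$ is a saturated fusion system over $S$, and $\mathcal L$ is a centric linking system associated to $\mathcal F$ (with distinguished monomorphisms $\delta_P\colon P\to \mathrm{Aut}_{\mathcal L}(P)$). For a small category $\mathcal C$ and a functor $M$ from $\mathcal C$ to modules over a commutative ring, $H^n(\mathcal C,M)=\lim^n_{\mathcal C}M$ denotes the $n$-th higher limit, and $\widetilde H^*(\mathcal C,M)$ denotes the part of $H^*(\mathcal C,M)$ in positive degrees. For a group $G$, $\mathcal B(G)$ is the category with one object and endomorphism monoid $G$, and $H^*(G,-)=H^*(\mathcal B(G),-)$. Let $\iota\colon\mathcal B(S)\to\mathcal L$ be the functor given by $\delta_S\colon S\to\mathrm{Aut}_{\mathcal L}(S)$. A functor $M$ on $\mathcal L$ is \emph{locally constant} if it sends every morphism to an isomorphism. (1) For every prime $p$ there exist a $p$-local finite group $(S,\mathcal F,\mathcal L)$ and a locally constant functor $M\colon\mathcal L\to\mathbb Z_{(p)}\text{-Mod}$ such that $\widetilde H^*(\mathcal L,M)\neq 0$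 but $\widetilde H^*(S,\iota^*M)=0$. (2) Let $(S,\mathcal F,\mathcal L)$ be a $p$-local finite group with $S\ne 1$, and fix a compatible set of inclusions $\iota_P^Q\in\mathrm{Mor}_{\mathcal L}(P,Q)$ for $\mathcal F$-centric $P\le Q$ (lifts of the inclusions with $\iota_Q^R\circ\iota_P^Q=\iota_P^R$ and $\iota_S^S=\mathrm{Id}$); write $\iota_P=\iota_P^S$. Let $\Gamma=\pi_1(|\mathcal L|,S)$, that is, the automorphism group of $S$ in the groupoid completion of $\mathcal L$, and let $J\colon\mathcal L\to\mathcal B(\Gamma)$ be the functor that sends $f\colon P\to Q$ to the class of $\iota_Q\circ f\circ\iota_P^{-1}$. Let $\widetilde{|\mathcal L|}$ be the universal cover of $|\mathcal L|$, that is, the nerve of the category with object set $\mathrm{Ob}(\mathcal L)\times\Gamma$ whose morphisms $(P,a)\to(Q,b)$ are the $f\in\mathrm{Mor}_{\mathcal L}(P,Q)$ with $b=J(f)a$. Assume that the functor $J\circ\iota\colon\mathcal B(S)\to\mathcal B(\Gamma)$ is faithful and that $\widetilde{|\mathcal L|}$ is not mod $p$ acyclic. Let $M$ be the group ring $\mathbb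 F_p[\Gamma]$, regarded as a functor on $\mathcal L$ via $J$ and left multiplication by $\Gamma$. Then $\widetilde H^*(S,\iota^*M)=0$, but $\widetilde H^*(\mathcal L,M)\ne 0$. -/

import Mathlib

open CategoryTheory Limits

noncomputable section

/-! ### Fusion systems -/

/-- A fusion system over a group `S`: a category whose objects are the subgroups of `S`, whose
morphism sets lie between `Hom_S(P, Q)` and the injective homomorphisms, and in which every
morphism is an isomorphism of the category followed by an inclusion. -/
structure FusionSystem (S : Type) [Group S] where
  /-- The set of morphisms from `P` to `Q`. -/
  Hom : ∀ P Q : Subgroup S, Set (P →* Q)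
  id_mem : ∀ P, MonoidHom.id P ∈ Hom P P
  comp_mem : ∀ {P Q R : Subgroup S} {φ : P →* Q} {ψ : Q →* R},
    φ ∈ Hom P Q → ψ ∈ Hom Q R → ψ.comp φ ∈ Hom P R
  conj_mem : ∀ {P Q : Subgroup S} (φ : P →* Q) (g : S),
    (∀ x : P, (φ x : S) = g * x * g⁻¹) → φ ∈ Hom P Q
  injective : ∀ {P Q : Subgroup S} {φ : P →* Q}, φ ∈ Hom P Q → Function.Injective φ
  factor : ∀ {P Q : Subgroup S} {φ : P →* Q}, φ ∈ Hom P Q →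
    ∃ (R : Subgroup S) (h : R ≤ Q) (e : P ≃* R),
      e.toMonoidHom ∈ Hom P R ∧ e.symm.toMonoidHom ∈ Hom R P ∧
      φ = (Subgroup.inclusion h).comp e.toMonoidHom

/-- `Aut_S(P)`: the automorphisms of `P` induced by conjugation by elements of `N_S(P)`. -/
def autS {S : Type} [Group S] (P : Subgroup S) : Subgroup (MulAut P) :=
  P.normalizerMonoidHom.range

namespace FusionSystem

variable {S : Type} [Group S] (F : FusionSystem S)

/-- The group isomorphism `e` is an isomorphism of the category `F`. -/
def IsIsoIn {P Q : Subgroup S} (e : P ≃* Q) : Prop :=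
  e.toMonoidHom ∈ F.Hom P Q ∧ e.symm.toMonoidHom ∈ F.Hom Q P

/-- `F`-conjugacy of subgroups. -/
def IsConj (P Q : Subgroup S) : Prop := ∃ e : P ≃* Q, F.IsIsoIn e

def FullyCentralized (P : Subgroup S) : Prop :=
  ∀ P' : Subgroup S, F.IsConj P P' →
    Nat.card (Subgroup.centralizer (P' : Set S)) ≤ Nat.card (Subgroup.centralizer (P : Set S))

def FullyNormalized (P : Subgroup S) : Prop :=
  ∀ P' : Subgroup S, F.IsConj P P' →
    Nat.card (Subgroup.normalizer (P' : Set S)) ≤ Nat.card (Subgroup.normalizer (P : Set S))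

/-- `P` is `F`-centric: `C_S(P') = Z(P')` for every `P'` that is `F`-conjugate to `P`. -/
def IsCentric (P : Subgroup S) : Prop :=
  ∀ P' : Subgroup S, F.IsConj P P' →
    Subgroup.centralizer (P' : Set S) = (Subgroup.center P').map P'.subtype

/-- The automorphism group `Aut_F(P)`. -/
def aut (P : Subgroup S) : Subgroup (MulAut P) where
  carrier := {e | F.IsIsoIn e}
  mul_mem' {_ _} ha hb := ⟨F.comp_mem hb.1 ha.1, F.comp_mem ha.2 hb.2⟩
  one_mem' := ⟨F.id_mem P, F.id_mem P⟩
  inv_mem' {_} ha := ⟨ha.2, ha.1⟩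

/-- `N_φ = {g ∈ N_S(P) | φ c_g φ⁻¹ ∈ Aut_S(P')}` for an isomorphism `φ : P → P'`. -/
def extensionSubgroup {P P' : Subgroup S} (φ : P ≃* P') : Subgroup S :=
  (((autS P').comap (MulAut.congr φ).toMonoidHom).comap P.normalizerMonoidHom).map
    (Subgroup.normalizer (P : Set S)).subtype

/-- Saturation. In the second condition a morphism `P → S` of `F` is given by the isomorphism
`φ` onto its image `P'`, and `S` as an object of `F` is `⊤`. -/
structure IsSaturated (p : ℕ) : Prop where
  fullyNormalized : ∀ P : Subgroup S, F.FullyNormalized P →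
    F.FullyCentralized P ∧
      ∃ T : Sylow p (F.aut P), (T : Subgroup (F.aut P)) = (autS P).subgroupOf (F.aut P)
  extend : ∀ (P P' : Subgroup S) (φ : P ≃* P'), F.IsIsoIn φ → F.FullyCentralized P' →
    ∃ ψ ∈ F.Hom (extensionSubgroup φ) ⊤,
      ∀ (x : extensionSubgroup φ) (hx : (x : S) ∈ P), (ψ x : S) = φ ⟨x, hx⟩

/-- The `F`-centric subgroups of `S`. -/
def CentricSubgroup : Type := {P : Subgroup S // F.IsCentric P}

theorem isCentric_top [Finite S] : F.IsCentric ⊤ := by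
  rintro P' ⟨e, -⟩
  have h : P' = ⊤ := by
    apply Subgroup.eq_top_of_card_eq
    rw [← Nat.card_congr e.toEquiv, Nat.card_congr Subgroup.topEquiv.toEquiv]
  subst h
  ext x
  simp only [Subgroup.mem_centralizer_iff, Subgroup.mem_map, Subgroup.mem_center_iff]
  constructor
  · intro hx
    exact ⟨⟨x, trivial⟩, fun g => Subtype.ext (hx g g.2), rfl⟩
  · rintro ⟨y, hy, rfl⟩ g hg
    exact congrArg Subtype.val (hy ⟨g, hg⟩)

end FusionSystem

/-! ### Centric linking systems and `p`-local finite groups -/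

/-- A centric linking system associated to `F`: a category on the `F`-centric subgroups, with a
functor `π` to `F` that is the identity on objects, and distinguished monomorphisms
`δ P : P → Aut(P)`. Composition is written in diagrammatic order, so `f ∘ δ P x` is
`(δ P x).hom ≫ f`. -/
structure CentricLinkingSystem {S : Type} [Group S] (F : FusionSystem S) where
  [category : Category.{0} F.CentricSubgroup]
  π : ∀ {P Q : F.CentricSubgroup}, (P ⟶ Q) → (P.1 →* Q.1)
  π_mem : ∀ {P Q : F.CentricSubgroup} (f : P ⟶ Q), π f ∈ F.Hom P.1 Q.1
  π_id : ∀ P : F.CentricSubgroup, π (𝟙 P) = MonoidHom.id P.1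
  π_comp : ∀ {P Q R : F.CentricSubgroup} (f : P ⟶ Q) (g : Q ⟶ R), π (f ≫ g) = (π g).comp (π f)
  δ : ∀ P : F.CentricSubgroup, P.1 →* Aut P
  δ_injective : ∀ P, Function.Injective (δ P)
  /-- (A), surjectivity of `π` on morphism sets. -/
  π_surjective : ∀ {P Q : F.CentricSubgroup}, ∀ φ ∈ F.Hom P.1 Q.1, ∃ f : P ⟶ Q, π f = φ
  /-- (A), freeness of the action of `Z(P)`. -/
  free : ∀ {P Q : F.CentricSubgroup} (f : P ⟶ Q), ∀ z ∈ Subgroup.center P.1,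
    (δ P z).hom ≫ f = f → z = 1
  /-- (A), the fibres of `π` are the orbits of `Z(P)`. -/
  π_eq_iff : ∀ {P Q : F.CentricSubgroup} (f g : P ⟶ Q),
    π f = π g ↔ ∃ z ∈ Subgroup.center P.1, g = (δ P z).hom ≫ f
  /-- (B) -/
  π_δ : ∀ (P : F.CentricSubgroup) (x y : P.1), π (δ P x).hom y = x * y * x⁻¹
  /-- (C) -/
  δ_comp : ∀ {P Q : F.CentricSubgroup} (f : P ⟶ Q) (x : P.1),
    (δ P x).hom ≫ f = f ≫ (δ Q (π f x)).hom

/-- A `p`-local finite group `(S, F, L)`. -/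
structure PLocalFiniteGroup (p : ℕ) (S : Type) [Group S] where
  finite : Finite S
  isPGroup : IsPGroup p S
  F : FusionSystem S
  saturated : F.IsSaturated p
  L : CentricLinkingSystem F

namespace PLocalFiniteGroup

variable {p : ℕ} {S : Type} [Group S] (G : PLocalFiniteGroup p S)

/-- The objects of the linking system `L`, with the category structure of `L`. -/
def Link : Type := G.F.CentricSubgroup

instance : Category.{0} G.Link := G.L.category

/-- The object `S` of `L`. -/
def top : G.Link := ⟨⊤, haveI := G.finite; G.F.isCentric_top⟩

/-- The distinguished monomorphism `δ_S : S → Aut_L(S)`. -/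
def δTop : S →* Aut G.top :=
  (show G.top.1 →* Aut G.top from G.L.δ G.top).comp Subgroup.topEquiv.symm.toMonoidHom

/-- The functor `ι : B(S) → L` given by `δ_S : S → Aut_L(S)`. -/
def ι : SingleObj S ⥤ G.Link where
  obj _ := G.top
  map s := (G.δTop s).hom
  map_id _ := congrArg Iso.hom (map_one G.δTop)
  map_comp s t := congrArg Iso.hom (map_mul G.δTop t s)

/-- A compatible set of inclusions for `L`. -/
structure Inclusions where
  incl : ∀ {P Q : G.Link}, P.1 ≤ Q.1 → (P ⟶ Q)
  incl_top : incl (le_refl G.top.1) = 𝟙 G.top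
  π_incl : ∀ {P Q : G.Link} (h : P.1 ≤ Q.1), G.L.π (incl h) = Subgroup.inclusion h
  incl_comp : ∀ {P Q R : G.Link} (h : P.1 ≤ Q.1) (h' : Q.1 ≤ R.1),
    incl h ≫ incl h' = incl (h.trans h')

/-- The fundamental group `Γ = π₁(|L|, S)`: the automorphism group of `S` in the groupoid
completion of `L`. -/
abbrev Γ : Type := Aut ((FreeGroupoid.of G.Link).obj G.top)

variable {G}

namespace Inclusions

variable (I : G.Inclusions)

/-- The class in the groupoid completion of the chosen inclusion of `P` in `S`. -/
def toTop (P : G.Link) : (FreeGroupoid.of G.Link).obj P ≅ (FreeGroupoid.of G.Link).obj G.top :=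
  asIso ((FreeGroupoid.of G.Link).map (I.incl (P := P) (Q := G.top) le_top))

/-- The functor `J : L → B(Γ)` that sends `f : P → Q` to the class of `ι_Q ∘ f ∘ ι_P⁻¹`. -/
def J : G.Link ⥤ SingleObj G.Γ where
  obj _ := SingleObj.star _
  map {P Q} f := ((I.toTop P).symm ≪≫ asIso ((FreeGroupoid.of G.Link).map f) ≪≫ I.toTop Q : G.Γ)
  map_id P := by
    change ((I.toTop P).symm ≪≫ asIso ((FreeGroupoid.of G.Link).map (𝟙 P)) ≪≫ I.toTop P : G.Γ) =
      Iso.refl _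
    apply Iso.ext
    simp
  map_comp {P Q R} f g := by
    change ((I.toTop P).symm ≪≫ asIso ((FreeGroupoid.of G.Link).map (f ≫ g)) ≪≫ I.toTop R : G.Γ) =
      ((I.toTop P).symm ≪≫ asIso ((FreeGroupoid.of G.Link).map f) ≪≫ I.toTop Q) ≪≫
        ((I.toTop Q).symm ≪≫ asIso ((FreeGroupoid.of G.Link).map g) ≪≫ I.toTop R)
    apply Iso.ext
    simp

/-- The universal cover of `L`: the category with object set `Ob(L) × Γ` in which a morphism
`(P, a) → (Q, b)` is a morphism `f : P → Q` of `L` with `b = J(f) a`. The realization of its nerve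
is the universal covering space of `|L|`. -/
abbrev UniversalCover : Type := (I.J ⋙ actionAsFunctor G.Γ G.Γ).Elements

end Inclusions

end PLocalFiniteGroup

/-! ### Coefficient systems and cohomology -/

/-- A coefficient system is locally constant if it sends all morphisms to isomorphisms. -/
def IsLocallyConstantSystem {C : Type} [Category.{0} C] {R : Type} [CommRing R]
    (M : C ⥤ ModuleCat.{0} R) : Prop :=
  ∀ ⦃X Y : C⦄ (f : X ⟶ Y), IsIso (M.map f)

/-- `Hⁿ(C, M)`: the `n`-th higher limit of `M`, that is, the `n`-th right derived functor of
`lim_C = Hom(R_C, -)` on the category of functors from `C` to `R`-modules, where `R_C` is the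
constant functor. -/
def FunctorCohomology {C : Type} [Category.{0} C] {R : Type} [CommRing R]
    (M : C ⥤ ModuleCat.{0} R) (n : ℕ) : Type 1 :=
  letI := HasExt.standard (C ⥤ ModuleCat.{0} R)
  Abelian.Ext.{1} ((Functor.const C).obj (ModuleCat.of R R)) M n

instance {C : Type} [Category.{0} C] {R : Type} [CommRing R]
    (M : C ⥤ ModuleCat.{0} R) (n : ℕ) : AddCommGroup (FunctorCohomology M n) :=
  letI := HasExt.standard (C ⥤ ModuleCat.{0} R)
  inferInstanceAs (AddCommGroup (Abelian.Ext.{1} _ _ _))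

/-- The reduced cohomology `H̃*(C, M)`, i.e. the cohomology in positive degrees, vanishes. -/
def ReducedCohomologyVanishes {C : Type} [Category.{0} C] {R : Type} [CommRing R]
    (M : C ⥤ ModuleCat.{0} R) : Prop :=
  ∀ n : ℕ, 0 < n → ∀ x : FunctorCohomology M n, x = 0

/-- The group ring `R[Γ]` as a functor on `B(Γ)`, by left multiplication. -/
def groupRingModule (R : Type) [CommRing R] (Γ : Type) [Group Γ] :
    SingleObj Γ ⥤ ModuleCat.{0} R where
  obj _ := ModuleCat.of R (MonoidAlgebra R Γ)
  map g := ModuleCat.ofHom (LinearMap.mulLeft R (MonoidAlgebra.of R Γ g))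
  map_id _ := by
    rw [SingleObj.id_as_one, map_one, LinearMap.mulLeft_one]
    rfl
  map_comp g h := by
    rw [SingleObj.comp_as_mul, map_mul, LinearMap.mulLeft_mul]
    rfl

/-- A simplicial set is mod `p` acyclic if the map to a point induces an isomorphism on homology
with coefficients in `𝔽_p`. -/
def IsModPAcyclic (p : ℕ) (X : SSet.{0}) : Prop :=
  ∀ n : ℕ, IsIso (SSet.homologyMap (terminal.from X) (ModuleCat.of (ZMod p) (ZMod p)) n)

instance isPrime_span_intCast (p : ℕ) [hp : Fact p.Prime] :
    (Ideal.span {(p : ℤ)}).IsPrime :=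
  (Ideal.span_singleton_prime (Int.natCast_ne_zero.2 hp.out.ne_zero)).2
    (Nat.prime_iff_prime_int.1 hp.out)

/-- The ring `ℤ_(p)`. -/
abbrev ZLocal (p : ℕ) [Fact p.Prime] : Type := Localization.AtPrime (Ideal.span {(p : ℤ)})

end

/-! Higher limits are computed by a bar resolution of the constant functor by free functors
(`resolution`), so vanishing in degree n + 1 says that every bar cocycle is a coboundary. Both
halves of the theorem rest on a form of Shapiro's lemma (`Covering.cochains_of_cocyclesSplit`): for
a functor from a category to B(Γ), bar cochains with values in the functions on Γ are simplicial
cochains of the covering category. They also rest on Higman's criterion: a representation over which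
some endomorphism has relative trace one is injective as soon as its underlying module is.

Part (2). The restriction of F_p[Γ] to S is free because S → Γ is injective, hence it is injective
and has no higher cohomology. On L, the universal cover is governed by the module of all functions Γ
→ F_p rather than by F_p[Γ], and the two differ when Γ is infinite. The bridge is the class of
representations of Γ whose restriction to S satisfies Higman's criterion. It contains both modules,
and it is closed under taking the kernel of the augmentation from the free module on the underlying
space (`HasTraceOne.syzygy`). Its members have uniformly bounded injective dimension as functors on
L (`hasInjectiveDimensionLT`): N_S(P) has index prime to p in Aut_L(P) for fully normalized P, so
the criterion passes from S to all automorphism groups of L; each functor then embeds in an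
injective envelope built from families over outgoing morphisms, and the quotient again satisfies the
criterion and vanishes on one more layer of large subgroups. If the cohomology with coefficients in
F_p[Γ] vanished, then so would that of every free module, because L is finite, and descending
induction along the syzygy sequences would kill the cohomology of the functions on Γ. The universal
cover, which is connected, would then be mod p acyclic.

Part (1). Take K = PGL₃(F_p), S the unitriangular matrices, and M the functions from K to a nonzero
injective module. Every centric subgroup of S contains its full centralizer in K, so the transporter
category is a centric linking system. Restricted to S, M is injective. On L, its cohomology is that
of a category modelling the poset of K-conjugates of centric subgroups. A function supported on the
single pair A < S, with A a unipotent radical, is a 1-cocycle there. It is not a coboundary: the six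
conjugates of S under the Weyl group form the apartment hexagon of the Tits building, and going
around it meets that pair exactly once (`not_reducedCohomologyVanishes_funSystem`). -/

noncomputable section

/-! ### The bar resolution of the constant functor -/

/-- Exactness of a short complex of functors to modules can be checked on elements. -/
lemma exact_of_forall_exists {C : Type} [Category.{0} C] {R : Type} [CommRing R]
    (S : ShortComplex (C ⥤ ModuleCat.{0} R))
    (h : ∀ y (x : S.X₂.obj y), (S.g.app y).hom x = 0 → ∃ w, (S.f.app y).hom w = x) : S.Exact := by
  rw [S.exact_iff_isZero_homology]
  refine Functor.isZero _ fun y => ?_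
  refine IsZero.of_iso ?_ (S.mapHomologyIso ((evaluation C (ModuleCat.{0} R)).obj y)).symm
  rw [← ShortComplex.exact_iff_isZero_homology, ShortComplex.moduleCat_exact_iff]
  exact h y

namespace BarResolution

open Opposite

variable {C : Type} [Category.{0} C]

/-- The composable arrows obtained by reindexing along a monotone map. -/
abbrev reindex {m n : ℕ} (θ : Fin (m + 1) →o Fin (n + 1)) (σ : ComposableArrows C n) :
    ComposableArrows C m :=
  σ.whiskerLeft θ.monotone.functor

/-- An `n`-simplex of the nerve with a morphism from its last vertex to `y`. -/
structure Coned (C : Type) [Category.{0} C] (n : ℕ) (y : C) where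
  arrows : ComposableArrows C n
  hom : arrows.obj (Fin.last n) ⟶ y

namespace Coned

/-- Reindexing of a simplex over `y`. -/
def reindex {m n : ℕ} (θ : Fin (m + 1) →o Fin (n + 1)) {y : C} (s : Coned C n y) :
    Coned C m y :=
  ⟨BarResolution.reindex θ s.arrows, s.arrows.map (homOfLE (Fin.le_last (θ (Fin.last m)))) ≫ s.hom⟩

/-- Composition of a simplex over `y` with a morphism `y ⟶ z`. -/
def push {n : ℕ} {y z : C} (f : y ⟶ z) (s : Coned C n y) : Coned C n z := ⟨s.arrows, s.hom ≫ f⟩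

lemma push_id {n : ℕ} {y : C} (s : Coned C n y) : s.push (𝟙 y) = s := by
  simp [push]

lemma push_comp {n : ℕ} {y z w : C} (f : y ⟶ z) (g : z ⟶ w) (s : Coned C n y) :
    s.push (f ≫ g) = (s.push f).push g := by
  simp [push]

lemma reindex_push {m n : ℕ} (θ : Fin (m + 1) →o Fin (n + 1)) {y z : C} (f : y ⟶ z)
    (s : Coned C n y) : (s.push f).reindex θ = (s.reindex θ).push f :=
  congrArg (Coned.mk _) (Category.assoc _ _ _).symm

lemma reindex_id {n : ℕ} {y : C} (s : Coned C n y) : s.reindex OrderHom.id = s := by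
  obtain ⟨σ, u⟩ := s
  simp only [reindex]
  congr 1
  change σ.map (𝟙 _) ≫ u = u
  simp

lemma reindex_comp {l m n : ℕ} (θ : Fin (m + 1) →o Fin (n + 1)) (η : Fin (l + 1) →o Fin (m + 1))
    {y : C} (s : Coned C n y) : s.reindex (θ.comp η) = (s.reindex θ).reindex η := by
  obtain ⟨σ, u⟩ := s
  have h := σ.map_comp (homOfLE (θ.monotone (Fin.le_last (η (Fin.last l)))))
    (homOfLE (Fin.le_last (θ (Fin.last m))))
  exact congrArg (Coned.mk _) ((congrArg (· ≫ u) h).trans (Category.assoc _ _ _))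

end Coned

variable (C) (R : Type) [CommRing R]

variable {C} in
/-- The map of free modules induced by a map of bases. -/
def freeMap {X Y : Type} (f : X → Y) : ModuleCat.of R (X →₀ R) ⟶ ModuleCat.of R (Y →₀ R) :=
  ModuleCat.ofHom (Finsupp.lmapDomain R R f)

lemma freeMap_single {X Y : Type} (f : X → Y) (x : X) (r : R) :
    (freeMap R f).hom (Finsupp.single x r) = Finsupp.single (f x) r :=
  Finsupp.mapDomain_single

lemma freeMap_id {X : Type} (f : X → X) (hf : ∀ x, f x = x) : freeMap R f = 𝟙 _ := by
  obtain rfl : f = id := funext hf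
  exact ModuleCat.hom_ext (Finsupp.lmapDomain_id R R)

lemma freeMap_comp {X Y Z : Type} (f : X → Y) (g : Y → Z) (h : X → Z)
    (w : ∀ x, h x = g (f x)) : freeMap R h = freeMap R f ≫ freeMap R g := by
  obtain rfl : h = g ∘ f := funext w
  exact ModuleCat.hom_ext (Finsupp.lmapDomain_comp R R f g)

/-- The free functor on the simplices of dimension `n` over a variable object. -/
def term (n : ℕ) : C ⥤ ModuleCat.{0} R where
  obj y := ModuleCat.of R (Coned C n y →₀ R)
  map f := freeMap R (Coned.push f)
  map_id _ := freeMap_id R _ Coned.push_id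
  map_comp f g := freeMap_comp R _ _ _ (Coned.push_comp f g)

variable {C} in
/-- The natural transformation given by reindexing. -/
def termMap {m n : ℕ} (θ : Fin (m + 1) →o Fin (n + 1)) : term C R n ⟶ term C R m where
  app _ := freeMap R (Coned.reindex θ)
  naturality _ _ f :=
    ((freeMap_comp R (Coned.push f) (Coned.reindex θ) _ (fun _ => rfl)).symm.trans
      (freeMap_comp R _ _ _ (fun s => Coned.reindex_push θ f s)))

/-- The bar construction as a simplicial functor. -/
def simplicial : SimplicialObject (C ⥤ ModuleCat.{0} R) where
  obj Δ := term C R Δ.unop.len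
  map θ := termMap R θ.unop.toOrderHom
  map_id _ := NatTrans.ext (funext fun _ => freeMap_id R _ Coned.reindex_id)
  map_comp _ _ := NatTrans.ext (funext fun _ => freeMap_comp R _ _ _ (Coned.reindex_comp _ _))

/-- The differential of the bar complex. -/
def differential (n : ℕ) : term C R (n + 1) ⟶ term C R n :=
  ∑ i : Fin (n + 2), ((-1 : ℤ) ^ (i : ℕ)) • termMap R (Fin.succAboveOrderEmb i).toOrderHom

lemma differential_comp (n : ℕ) : differential C R (n + 1) ≫ differential C R n = 0 :=
  AlgebraicTopology.AlternatingFaceMapComplex.d_squared (simplicial C R) n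

/-- The bar complex. -/
def complex : ChainComplex (C ⥤ ModuleCat.{0} R) ℕ :=
  ChainComplex.of (term C R) (differential C R) (differential_comp C R)

lemma complex_d (n : ℕ) : (complex C R).d (n + 1) n = differential C R n :=
  ChainComplex.of_d _ _ _

variable {C R}

/-- The restriction of simplices to the face opposite to the vertex `i`. -/
abbrev face {n : ℕ} (i : Fin (n + 2)) (σ : ComposableArrows C (n + 1)) : ComposableArrows C n :=
  reindex (Fin.succAboveOrderEmb i).toOrderHom σ

/-- The morphism from the last vertex of a face of `σ` to the last vertex of `σ`. -/
abbrev faceHom {n : ℕ} (i : Fin (n + 2)) (σ : ComposableArrows C (n + 1)) :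
    (face i σ).obj (Fin.last n) ⟶ σ.obj (Fin.last (n + 1)) :=
  σ.map (homOfLE (Fin.le_last ((Fin.succAboveOrderEmb i).toOrderHom (Fin.last n))))

/-! ### Bar cochains and projectivity of the free functors -/

section Cochains

variable (M : C ⥤ ModuleCat.{0} R)

/-- Bar cochains with values in `M`. -/
abbrev Cochain (n : ℕ) : Type := ∀ σ : ComposableArrows C n, M.obj (σ.obj (Fin.last n))

/-- The coboundary of a bar cochain. -/
def coboundary {n : ℕ} (z : Cochain M n) : Cochain M (n + 1) := fun σ =>
  ∑ i : Fin (n + 2), ((-1 : ℤ) ^ (i : ℕ)) • (M.map (faceHom i σ)).hom (z (face i σ))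

variable {M}

/-- A basis element of a term of the bar complex. -/
def gen {n : ℕ} {y : C} (s : Coned C n y) : (term C R n).obj y := (Finsupp.single s 1 : Coned C n y →₀ R)

lemma term_hom_ext {n : ℕ} {y : C} {V : Type*} [AddCommGroup V] [Module R V]
    {f g : (term C R n).obj y →ₗ[R] V} (h : ∀ s, f (gen s) = g (gen s)) : f = g := by
  refine Finsupp.lhom_ext (M := R) (φ := f) (ψ := g) fun s r => ?_
  have e : (Finsupp.single s r : Coned C n y →₀ R) = r • (Finsupp.single s 1) := by simp
  rw [e]
  exact (f.map_smul r (gen s)).trans ((congrArg _ (h s)).trans (g.map_smul r (gen s)).symm)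

lemma term_map_gen {n : ℕ} {y y' : C} (f : y ⟶ y') (s : Coned C n y) :
    ((term C R n).map f).hom (gen s) = gen (s.push f) :=
  freeMap_single R _ _ _

lemma termMap_gen {m n : ℕ} (θ : Fin (m + 1) →o Fin (n + 1)) {y : C} (s : Coned C n y) :
    ((termMap R θ).app y).hom (gen s) = gen (s.reindex θ) :=
  freeMap_single R _ _ _

lemma differential_gen {n : ℕ} {y : C} (s : Coned C (n + 1) y) :
    ((differential C R n).app y).hom (gen s) =
      ∑ i : Fin (n + 2), ((-1 : ℤ) ^ (i : ℕ)) •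
        gen (s.reindex (Fin.succAboveOrderEmb i).toOrderHom) := by
  rw [differential, NatTrans.app_sum, ModuleCat.hom_sum, LinearMap.sum_apply]
  refine Finset.sum_congr rfl fun i _ => ?_
  rw [NatTrans.app_zsmul, ModuleCat.hom_zsmul, LinearMap.smul_apply, termMap_gen]

/-- The linear map on a term of the bar complex with given values on the basis. -/
def termLift {n : ℕ} {y : C} {V : Type} [AddCommGroup V] [Module R V] (f : Coned C n y → V) :
    (term C R n).obj y →ₗ[R] V :=
  Finsupp.lift V R (Coned C n y) f

lemma termLift_gen {n : ℕ} {y : C} {V : Type} [AddCommGroup V] [Module R V] (f : Coned C n y → V)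
    (s : Coned C n y) : termLift (R := R) f (gen s) = f s := by
  change Finsupp.lift V R (Coned C n y) f (Finsupp.single s 1) = _
  simp

/-- The natural transformation on a term of the bar complex that corresponds to a cochain. -/
def desc {n : ℕ} (z : Cochain M n) : term C R n ⟶ M where
  app y := ModuleCat.ofHom (termLift fun s => (M.map s.hom).hom (z s.arrows))
  naturality y y' f := by
    apply ModuleCat.hom_ext
    apply term_hom_ext
    intro s
    change termLift _ (((term C R n).map f).hom (gen s)) = (M.map f).hom (termLift _ (gen s))
    rw [term_map_gen, termLift_gen, termLift_gen]
    simp only [Coned.push, Functor.map_comp, ModuleCat.hom_comp]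
    rfl

lemma desc_gen {n : ℕ} (z : Cochain M n) {y : C} (s : Coned C n y) :
    ((desc z).app y).hom (gen s) = (M.map s.hom).hom (z s.arrows) :=
  termLift_gen _ _

/-- The cochain of a natural transformation on a term of the bar complex. -/
def cochainOf {n : ℕ} (f : term C R n ⟶ M) : Cochain M n := fun σ =>
  (f.app _).hom (gen ⟨σ, 𝟙 _⟩)

lemma cochainOf_desc {n : ℕ} (z : Cochain M n) : cochainOf (desc z) = z := by
  funext σ
  rw [cochainOf, desc_gen]
  simp

lemma app_gen {n : ℕ} (f : term C R n ⟶ M) {y : C} (s : Coned C n y) :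
    (f.app y).hom (gen s) = (M.map s.hom).hom (cochainOf f s.arrows) := by
  have h := congrArg (fun φ => φ.hom (gen (⟨s.arrows, 𝟙 _⟩ : Coned C n _))) (f.naturality s.hom)
  simp only [ModuleCat.hom_comp, LinearMap.comp_apply, term_map_gen] at h
  rw [cochainOf, ← h]
  simp [Coned.push]

lemma desc_cochainOf {n : ℕ} (f : term C R n ⟶ M) : desc (cochainOf f) = f := by
  apply NatTrans.ext
  funext y
  apply ModuleCat.hom_ext
  apply term_hom_ext
  intro s
  rw [desc_gen, app_gen]

lemma desc_comp {M' : C ⥤ ModuleCat.{0} R} {n : ℕ} (z : Cochain M n) (φ : M ⟶ M') :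
    desc z ≫ φ = desc (fun σ => (φ.app _).hom (z σ)) := by
  rw [← desc_cochainOf (desc z ≫ φ)]
  congr 1
  funext σ
  change (φ.app _).hom (cochainOf (desc z) σ) = _
  rw [cochainOf_desc]

-- By Yoneda, a map out of a term is a free choice of one element per simplex (`desc` and
-- `cochainOf` are inverse to each other), so lifting along an epimorphism is a choice of preimages.
variable (C R) in
instance projective_term (n : ℕ) : Projective (term C R n) where
  factors {E X} f e _ := by
    have h : ∀ y, Function.Surjective (e.app y).hom := fun y =>
      (ModuleCat.epi_iff_surjective _).1 inferInstance
    choose w hw using h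
    refine ⟨desc fun σ => w _ (cochainOf f σ), ?_⟩
    rw [desc_comp]
    conv_rhs => rw [← desc_cochainOf f]
    congr 1
    funext σ
    exact hw _ _

lemma differential_comp_desc {n : ℕ} (z : Cochain M n) :
    differential C R n ≫ desc z = desc (coboundary M z) := by
  rw [← desc_cochainOf (differential C R n ≫ desc z)]
  congr 1
  funext σ
  change ((desc z).app _).hom (((differential C R n).app _).hom _) = _
  rw [differential_gen, map_sum, coboundary]
  refine Finset.sum_congr rfl fun i _ => ?_
  rw [map_zsmul, desc_gen]
  exact congrArg (fun φ => ((-1 : ℤ) ^ (i : ℕ)) • (M.map φ).hom (z (face i σ))) (Category.comp_id _)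

lemma desc_injective {n : ℕ} : Function.Injective (desc : Cochain M n → (term C R n ⟶ M)) :=
  Function.LeftInverse.injective cochainOf_desc

end Cochains

/-! ### Exactness of the bar complex -/

section Exactness

namespace Coned

variable {n : ℕ} {y : C} (s : Coned C n y)

/-- The vertices of a simplex over `y`, followed by `y`. -/
def vertex : WithTop (Fin (n + 1)) → C
  | some i => s.arrows.obj i
  | none => y

/-- The morphisms between the vertices of a simplex over `y`. -/
def edge : ∀ a b : WithTop (Fin (n + 1)), a ≤ b → (s.vertex a ⟶ s.vertex b)
  | some _, some _, h => s.arrows.map (homOfLE (WithTop.coe_le_coe.1 h))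
  | some i, none, _ => s.arrows.map (homOfLE (Fin.le_last i)) ≫ s.hom
  | none, none, _ => 𝟙 y
  | none, some j, h => absurd h (WithTop.not_top_le_coe j)

/-- A simplex over `y`, extended by `y`, as a functor. -/
def extend : WithTop (Fin (n + 1)) ⥤ C where
  obj := s.vertex
  map f := s.edge _ _ (leOfHom f)
  map_id a := by
    cases a with
    | top => rfl
    | coe i => exact s.arrows.map_id i
  map_comp {a b c} f g := by
    have hf := leOfHom f
    have hg := leOfHom g
    cases a with
    | top =>
      cases b with
      | coe j => exact absurd hf (WithTop.not_top_le_coe j)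
      | top =>
        cases c with
        | coe j => exact absurd hg (WithTop.not_top_le_coe j)
        | top => exact (Category.comp_id _).symm
    | coe i =>
      cases b with
      | top =>
        cases c with
        | coe j => exact absurd hg (WithTop.not_top_le_coe j)
        | top => exact (Category.comp_id _).symm
      | coe j =>
        cases c with
        | coe k => exact s.arrows.map_comp (homOfLE _) (homOfLE _)
        | top =>
          exact (congrArg (· ≫ s.hom) (s.arrows.map_comp (homOfLE (WithTop.coe_le_coe.1 hf))
            (homOfLE (Fin.le_last j)))).trans (Category.assoc _ _ _)

/-- The simplex over `y` obtained by reindexing a simplex over `y` extended by `y`. -/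
def pull {m : ℕ} (B : Fin (m + 1) →o WithTop (Fin (n + 1))) : Coned C m y :=
  ⟨B.monotone.functor ⋙ s.extend, s.edge (B (Fin.last m)) ⊤ le_top⟩

/-- Faces and the appending of `y` both become instances of `pull`, so the simplicial identities
below reduce to equalities of monotone maps. -/
lemma reindex_pull {l m : ℕ} (B : Fin (m + 1) →o WithTop (Fin (n + 1)))
    (θ : Fin (l + 1) →o Fin (m + 1)) : (s.pull B).reindex θ = s.pull (B.comp θ) := by
  have h := s.extend.map_comp (homOfLE (B.monotone (Fin.le_last (θ (Fin.last l)))))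
    (homOfLE (le_top : B (Fin.last m) ≤ ⊤))
  exact congrArg (Coned.mk _) h.symm

lemma pull_coe {B : Fin (n + 1) →o WithTop (Fin (n + 1))} (hB : ∀ i, B i = i) : s.pull B = s := by
  obtain rfl : B = ⟨fun i => (i : WithTop (Fin (n + 1))), WithTop.coe_mono⟩ :=
    OrderHom.ext _ _ (funext hB)
  obtain ⟨σ, u⟩ := s
  refine congrArg (Coned.mk σ) ?_
  change σ.map (𝟙 _) ≫ u = u
  simp

/-- The inclusion of the vertices among the vertices and a top element. -/
def coeHom (n : ℕ) : Fin (n + 1) →o WithTop (Fin (n + 1)) := ⟨fun i => i, WithTop.coe_mono⟩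

/-- The monotone map that adds a top element at the end. -/
def addTop {n : ℕ} {A : Type} [PartialOrder A] (B : Fin (n + 1) →o WithTop A) :
    Fin (n + 2) →o WithTop A where
  toFun i := if h : i.val < n + 1 then B ⟨i.val, h⟩ else ⊤
  monotone' i j hij := by
    by_cases h : j.val < n + 1
    · have h' : i.val < n + 1 := lt_of_le_of_lt hij h
      simp only [h, h', dif_pos]
      exact B.monotone hij
    · simp [h]

/-- Appending `y` to a simplex over `y`. -/
def append : Coned C (n + 1) y := s.pull (addTop (coeHom n))

/-- The extension of a monotone map to the top element. -/
def extendTop {m : ℕ} {A : Type} [PartialOrder A] (B : Fin (m + 1) →o WithTop A) :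
    WithTop (Fin (m + 1)) →o WithTop A where
  toFun
    | some i => B i
    | none => ⊤
  monotone' a b h := by
    cases b with
    | top => exact le_top
    | coe j =>
      cases a with
      | top => exact absurd h (WithTop.not_top_le_coe j)
      | coe i => exact B.monotone (WithTop.coe_le_coe.1 h)

lemma extend_pull {m : ℕ} (B : Fin (m + 1) →o WithTop (Fin (n + 1))) :
    (s.pull B).extend = (extendTop B).monotone.functor ⋙ s.extend := by
  refine Functor.hext (fun a => ?_) (fun a b h => ?_)
  · cases a <;> rfl
  · have h' := leOfHom h
    cases b with
    | top =>
      cases a with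
      | top => rfl
      | coe i => exact heq_of_eq (s.extend.map_comp (homOfLE (B.monotone (Fin.le_last i)))
          (homOfLE (le_top : B (Fin.last m) ≤ ⊤))).symm
    | coe j =>
      cases a with
      | top => exact absurd h' (WithTop.not_top_le_coe j)
      | coe i => rfl

/-- The simplex over the image of the top element that is given by a functor. -/
def ofFunctor {m : ℕ} {A : Type} [PartialOrder A] (E : WithTop A ⥤ C)
    (B : Fin (m + 1) →o WithTop A) : Coned C m (E.obj ⊤) :=
  ⟨B.monotone.functor ⋙ E, E.map (homOfLE le_top)⟩

lemma append_pull {m : ℕ} (B : Fin (m + 1) →o WithTop (Fin (n + 1))) :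
    (s.pull B).append = s.pull (addTop B) := by
  -- The type of `ofFunctor E B` depends on `E.obj ⊤`, so replacing the functor gives only a
  -- heterogeneous equality. Both sides are in fact simplices over `y`.
  have h : HEq (ofFunctor (s.pull B).extend
      (addTop (coeHom m)))
    (ofFunctor ((extendTop B).monotone.functor ⋙ s.extend)
      (addTop (coeHom m))) := by
    rw [extend_pull]
  refine (eq_of_heq h).trans ?_
  change s.pull ((extendTop B).comp _) = _
  congr 1
  ext i : 2
  by_cases hi : i.val < m + 1
  · refine (congrArg (extendTop B) (dif_pos hi)).trans ?_
    exact (dif_pos (t := fun h => B ⟨i.val, h⟩) (e := fun _ => ⊤) hi).symm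
  · refine (congrArg (extendTop B) (dif_neg hi)).trans ?_
    exact (dif_neg (t := fun h => B ⟨i.val, h⟩) (e := fun _ => ⊤) hi).symm

lemma reindex_append_castSucc (s : Coned C (n + 1) y) (i : Fin (n + 2)) :
    s.append.reindex (Fin.succAboveOrderEmb i.castSucc).toOrderHom =
      (s.reindex (Fin.succAboveOrderEmb i).toOrderHom).append := by
  have h : s.reindex (Fin.succAboveOrderEmb i).toOrderHom = s.pull
      ((coeHom (n + 1)).comp
        (Fin.succAboveOrderEmb i).toOrderHom) := by
    rw [← reindex_pull, pull_coe]
    exact fun i => rfl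
  rw [h, append_pull, append, reindex_pull]
  congr 1
  ext j : 2
  refine Fin.lastCases ?_ (fun j => ?_) j
  · simp [addTop, coeHom]
  · have h₁ : (i.succAbove j).val < n + 1 + 1 := (i.succAbove j).2
    have h₂ : j.val < n + 1 := j.2
    simp [addTop, coeHom, Fin.castSucc_succAbove_castSucc, Nat.le_of_lt_succ h₁, Nat.le_of_lt_succ h₂]

lemma reindex_append_last :
    s.append.reindex (Fin.succAboveOrderEmb (Fin.last (n + 1))).toOrderHom = s := by
  rw [append, reindex_pull]
  apply pull_coe
  intro i
  simp [addTop, coeHom, Nat.le_of_lt_succ i.2]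

end Coned

variable (R) in
/-- The contracting homotopy of the bar complex. -/
def homotopy (n : ℕ) (y : C) : (term C R n).obj y →ₗ[R] (term C R (n + 1)).obj y :=
  termLift fun s => gen s.append

lemma homotopy_gen {n : ℕ} {y : C} (s : Coned C n y) : homotopy R n y (gen s) = gen s.append :=
  termLift_gen _ _

/-- All faces of an appended simplex but the last are the appended faces of the simplex; the last
one, of index n + 2, removes `y` again and produces the signed identity term. -/
lemma differential_homotopy {n : ℕ} {y : C} (x : (term C R (n + 1)).obj y) :
    ((differential C R (n + 1)).app y).hom (homotopy R (n + 1) y x) =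
      homotopy R n y (((differential C R n).app y).hom x) + (-1 : ℤ) ^ (n + 2) • x := by
  have h : ((differential C R (n + 1)).app y).hom ∘ₗ homotopy R (n + 1) y =
      homotopy R n y ∘ₗ ((differential C R n).app y).hom + (-1 : ℤ) ^ (n + 2) • LinearMap.id := by
    apply term_hom_ext
    intro s
    rw [LinearMap.comp_apply, homotopy_gen, differential_gen, Fin.sum_univ_castSucc,
      LinearMap.add_apply, LinearMap.comp_apply, differential_gen, map_sum]
    congr 1
    · refine Finset.sum_congr rfl fun i _ => ?_
      rw [map_zsmul, homotopy_gen, Coned.reindex_append_castSucc]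
      rfl
    · rw [Coned.reindex_append_last]
      rfl
  exact LinearMap.congr_fun h x

variable (C R) in
/-- The augmentation of the bar complex. -/
def augmentation : term C R 0 ⟶ (Functor.const C).obj (ModuleCat.of R R) :=
  desc (M := (Functor.const C).obj (ModuleCat.of R R)) fun _ => (1 : R)

lemma augmentation_gen {y : C} (s : Coned C 0 y) :
    ((augmentation C R).app y).hom (gen s) = (1 : R) := desc_gen _ _

lemma differential_augmentation : differential C R 0 ≫ augmentation C R = 0 := by
  rw [augmentation, differential_comp_desc]
  apply NatTrans.ext
  funext y
  apply ModuleCat.hom_ext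
  apply term_hom_ext
  intro s
  rw [desc_gen]
  simp [coboundary, Fin.sum_univ_two]

/-- The trivial simplex over `y`. -/
def Coned.self (y : C) : Coned C 0 y := ⟨ComposableArrows.mk₀ y, 𝟙 y⟩

lemma Coned.reindex_append_zero {y : C} (s : Coned C 0 y) :
    s.append.reindex (Fin.succAboveOrderEmb 0).toOrderHom = Coned.self y := by
  rw [Coned.append, Coned.reindex_pull]
  have e : (Coned.addTop (Coned.coeHom 0)).comp
      (Fin.succAboveOrderEmb (0 : Fin 2)).toOrderHom = ⟨fun _ => ⊤, monotone_const⟩ := by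
    ext i : 2
    fin_cases i
    simp [Coned.addTop]
  rw [e]
  rfl

/-- Appending `y` to a vertex gives an edge whose face 0 is the trivial simplex at `y` and whose
face 1 is the original vertex. -/
lemma differential_homotopy_zero {y : C} (x : (term C R 0).obj y) :
    ((differential C R 0).app y).hom (homotopy R 0 y x) =
      (((augmentation C R).app y).hom x : R) • gen (Coned.self y) - x := by
  have h : ((differential C R 0).app y).hom ∘ₗ homotopy R 0 y =
      LinearMap.toSpanSingleton R _ (gen (Coned.self y)) ∘ₗ ((augmentation C R).app y).hom
        - LinearMap.id := by
    apply term_hom_ext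
    intro s
    rw [LinearMap.comp_apply, homotopy_gen, differential_gen, Fin.sum_univ_two,
      LinearMap.sub_apply, LinearMap.comp_apply, augmentation_gen, Coned.reindex_append_zero]
    have e := s.reindex_append_last
    change s.append.reindex (Fin.succAboveOrderEmb 1).toOrderHom = s at e
    rw [e]
    simp [sub_eq_add_neg]
  exact LinearMap.congr_fun h x

lemma exact_differential (n : ℕ) :
    (ShortComplex.mk _ _ (differential_comp C R n)).Exact := by
  refine exact_of_forall_exists _ fun y x hx => ?_
  refine ⟨(-1 : ℤ) ^ (n + 2) • homotopy R (n + 1) y x, ?_⟩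
  change ((differential C R (n + 1)).app y).hom _ = x
  change ((differential C R n).app y).hom x = 0 at hx
  rw [map_zsmul, differential_homotopy, hx, map_zero, zero_add, smul_smul, ← pow_add,
    Even.neg_one_pow ⟨n + 2, rfl⟩, one_smul]

lemma exact_augmentation :
    (ShortComplex.mk _ _ (differential_augmentation (C := C) (R := R))).Exact := by
  refine exact_of_forall_exists _ fun y x hx => ?_
  refine ⟨- homotopy R 0 y x, ?_⟩
  change ((differential C R 0).app y).hom _ = x
  change ((augmentation C R).app y).hom x = 0 at hx
  rw [map_neg, differential_homotopy_zero, hx]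
  simp

instance epi_augmentation : Epi (augmentation C R) := by
  rw [NatTrans.epi_iff_epi_app]
  intro y
  rw [ModuleCat.epi_iff_surjective]
  intro r
  refine ⟨(r : R) • gen (Coned.self y), ?_⟩
  rw [map_smul, augmentation_gen]
  exact mul_one (M := R) r

variable (C R) in
/-- The bar resolution of the constant functor. -/
def resolution : ProjectiveResolution ((Functor.const C).obj (ModuleCat.of R R)) where
  complex := complex C R
  projective n := projective_term C R n
  π := (ChainComplex.toSingle₀Equiv _ _).symm ⟨augmentation C R, by
    rw [complex_d]; exact differential_augmentation⟩
  quasiIso := ⟨fun n => by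
    cases n with
    | zero =>
      rw [ChainComplex.quasiIsoAt₀_iff, ShortComplex.quasiIso_iff_of_zeros']
      · refine (ShortComplex.exact_and_epi_g_iff_of_iso ?_).2
          ⟨exact_augmentation (C := C) (R := R), epi_augmentation⟩
        exact ShortComplex.isoMk (Iso.refl _) (Iso.refl _) (Iso.refl _)
          ((Category.id_comp _).trans ((complex_d C R 0).symm.trans (Category.comp_id _).symm))
          ((Category.id_comp _).trans (Category.comp_id _).symm)
      all_goals rfl
    | succ n =>
      rw [quasiIsoAt_iff_exactAt']
      · rw [HomologicalComplex.exactAt_iff' _ (n + 2) (n + 1) n (by simp) (by simp)]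
        refine ShortComplex.exact_of_iso ?_ (exact_differential (C := C) (R := R) n)
        exact ShortComplex.isoMk (Iso.refl _) (Iso.refl _) (Iso.refl _)
          ((Category.id_comp _).trans ((complex_d C R (n + 1)).trans (Category.comp_id _).symm))
          ((Category.id_comp _).trans ((complex_d C R n).trans (Category.comp_id _).symm))
      · apply ChainComplex.exactAt_succ_single_obj⟩

end Exactness

/-- Every bar cocycle of degree `n + 1` is a coboundary. -/
def CocyclesSplit (M : C ⥤ ModuleCat.{0} R) (n : ℕ) : Prop :=
  ∀ z : Cochain M (n + 1), coboundary M z = 0 → ∃ w : Cochain M n, coboundary M w = z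

lemma desc_eq_zero_iff {M : C ⥤ ModuleCat.{0} R} {n : ℕ} (z : Cochain M n) :
    desc z = 0 ↔ z = 0 := by
  constructor
  · intro h
    rw [← cochainOf_desc z, h]
    rfl
  · rintro rfl
    rw [← desc_cochainOf (0 : term C R n ⟶ M)]
    rfl

lemma functorCohomology_eq_zero_iff_differential (M : C ⥤ ModuleCat.{0} R) (n : ℕ) :
    (∀ x : FunctorCohomology M (n + 1), x = 0) ↔
      ∀ f : term C R (n + 1) ⟶ M, differential C R (n + 1) ≫ f = 0 →
        ∃ g : term C R n ⟶ M, differential C R n ≫ g = f := by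
  let _ := HasExt.standard (C ⥤ ModuleCat.{0} R)
  constructor
  · intro h f hf
    have hf' : (resolution C R).complex.d (n + 2) (n + 1) ≫ f = 0 :=
      (congrArg (· ≫ f) (complex_d C R (n + 1))).trans hf
    have h₁ := h ((resolution C R).extMk f (n + 2) rfl hf')
    obtain ⟨g, hg⟩ := ((resolution C R).extMk_eq_zero_iff f (n + 2) rfl hf' n rfl).1 h₁
    exact ⟨g, (congrArg (· ≫ g) (complex_d C R n)).symm.trans hg⟩
  · intro h x
    obtain ⟨f, hf, rfl⟩ := (resolution C R).extMk_surjective x (n + 2) rfl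
    refine ((resolution C R).extMk_eq_zero_iff f (n + 2) rfl hf n rfl).2 ?_
    obtain ⟨g, hg⟩ := h f ((congrArg (· ≫ f) (complex_d C R (n + 1))).symm.trans hf)
    exact ⟨g, (congrArg (· ≫ g) (complex_d C R n)).trans hg⟩

/-- Higher limits are computed by bar cochains. -/
theorem functorCohomology_eq_zero_iff (M : C ⥤ ModuleCat.{0} R) (n : ℕ) :
    (∀ x : FunctorCohomology M (n + 1), x = 0) ↔ CocyclesSplit M n := by
  rw [functorCohomology_eq_zero_iff_differential]
  constructor
  · intro h z hz
    obtain ⟨g, hg⟩ := h (desc z) (by rw [differential_comp_desc, hz, desc_eq_zero_iff])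
    refine ⟨cochainOf g, desc_injective ?_⟩
    rw [← differential_comp_desc, desc_cochainOf, hg]
  · intro h f hf
    obtain ⟨w, hw⟩ := h (cochainOf f)
      (by rw [← desc_eq_zero_iff, ← differential_comp_desc, desc_cochainOf, hf])
    exact ⟨desc w, by rw [differential_comp_desc, hw, desc_cochainOf]⟩

theorem reducedCohomologyVanishes_iff (M : C ⥤ ModuleCat.{0} R) :
    ReducedCohomologyVanishes M ↔ ∀ n, CocyclesSplit M n := by
  simp only [← functorCohomology_eq_zero_iff]
  constructor
  · exact fun h n => h (n + 1) n.succ_pos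
  · intro h n hn
    obtain ⟨m, rfl⟩ : ∃ m, n = m + 1 := ⟨n - 1, by omega⟩
    exact h m

end BarResolution

/-! ### Coinduced functors and Higman's criterion -/

namespace Higman

variable {C : Type} [Category.{0} C] {R : Type} [CommRing R]

/-! ### Coinduced functors -/

section Coinduced

variable (V : C → ModuleCat.{0} R)

/-- The functor coinduced from a family of modules indexed by the objects. -/
def coinduced : C ⥤ ModuleCat.{0} R where
  obj Y := ModuleCat.of R (∀ P : C, (Y ⟶ P) → V P)
  map {Y Z} f := ModuleCat.ofHom
    { toFun := fun φ P h => φ P (f ≫ h)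
      map_add' := fun _ _ => rfl
      map_smul' := fun _ _ => rfl }
  map_id Y := by
    apply ModuleCat.hom_ext
    apply LinearMap.ext
    intro φ
    funext P h
    exact congrArg (φ P) (Category.id_comp h)
  map_comp f g := by
    apply ModuleCat.hom_ext
    apply LinearMap.ext
    intro φ
    funext P h
    exact congrArg (φ P) (Category.assoc f g h)

variable {V}

/-- The natural transformation to a coinduced functor given by its components at identities. -/
def toCoinduced {X : C ⥤ ModuleCat.{0} R} (g : ∀ P, X.obj P ⟶ V P) : X ⟶ coinduced V where
  app Y := ModuleCat.ofHom
    { toFun := fun x P h => (g P).hom ((X.map h).hom x)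
      map_add' := fun x y => by
        funext P h
        simp
      map_smul' := fun r x => by
        funext P h
        simp }
  naturality Y Z f := by
    apply ModuleCat.hom_ext
    apply LinearMap.ext
    intro x
    funext P h
    change (g P).hom ((X.map h).hom ((X.map f).hom x)) = (g P).hom ((X.map (f ≫ h)).hom x)
    rw [X.map_comp]
    rfl

/-- The component of a natural transformation to a coinduced functor. -/
def component {X : C ⥤ ModuleCat.{0} R} (g : X ⟶ coinduced V) (P : C) : X.obj P ⟶ V P :=
  ModuleCat.ofHom
    { toFun := fun x => (show ∀ Q : C, (P ⟶ Q) → V Q from (g.app P).hom x) P (𝟙 P)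
      map_add' := fun x y => by
        rw [map_add]
        rfl
      map_smul' := fun r x => by
        rw [map_smul]
        rfl }

lemma toCoinduced_component {X : C ⥤ ModuleCat.{0} R} (g : X ⟶ coinduced V) :
    toCoinduced (component g) = g := by
  apply NatTrans.ext
  funext Y
  apply ModuleCat.hom_ext
  apply LinearMap.ext
  intro x
  funext P h
  have e := congrArg (fun φ => (show ∀ Q : C, (P ⟶ Q) → V Q from φ.hom x) P (𝟙 P)) (g.naturality h)
  refine e.trans ?_
  change (show ∀ Q : C, (Y ⟶ Q) → V Q from (g.app Y).hom x) P (h ≫ 𝟙 P) = _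
  rw [Category.comp_id]

/-- Coinduction is right adjoint to evaluation at all objects, so the extension problem is solved in
each `V P` separately. -/
instance injective_coinduced [∀ P, Injective (V P)] : Injective (coinduced V) where
  factors {X Y} g f _ := by
    refine ⟨toCoinduced fun P => Injective.factorThru (component g P) (f.app P), ?_⟩
    refine Eq.trans ?_ (toCoinduced_component g)
    apply NatTrans.ext
    funext Z
    apply ModuleCat.hom_ext
    apply LinearMap.ext
    intro x
    funext P h
    change (Injective.factorThru (component g P) (f.app P)).hom ((Y.map h).hom ((f.app Z).hom x)) =
      (component g P).hom ((X.map h).hom x)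
    have e := congrArg (fun φ => φ.hom x) (f.naturality h)
    change (f.app P).hom ((X.map h).hom x) = (Y.map h).hom ((f.app Z).hom x) at e
    rw [← e]
    exact congrArg (fun φ => φ.hom ((X.map h).hom x))
      (Injective.comp_factorThru (component g P) (f.app P))

end Coinduced

/-! ### The envelope and Higman's criterion -/

section Criterion

variable (M : C ⥤ ModuleCat.{0} R)

/-- The functor of families indexed by all morphisms to an object that are equivariant under
isomorphisms of the target. -/
def envelopeSubmodule (Y : C) : Submodule R (∀ P : C, (Y ⟶ P) → M.obj P) where
  carrier := {φ | ∀ ⦃P Q : C⦄ (e : P ≅ Q) (f : Y ⟶ P), φ Q (f ≫ e.hom) = (M.map e.hom).hom (φ P f)}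
  add_mem' {φ ψ} hφ hψ P Q e f := by
    simp only [Pi.add_apply, hφ e f, hψ e f, map_add]
  zero_mem' P Q e f := by simp
  smul_mem' r φ hφ P Q e f := by
    simp only [Pi.smul_apply, hφ e f, map_smul]

/-- The equivariant families as a functor. -/
def envelope : C ⥤ ModuleCat.{0} R where
  obj Y := ModuleCat.of R (envelopeSubmodule M Y)
  map {Y Z} f := ModuleCat.ofHom
    { toFun := fun φ => ⟨fun P h => φ.1 P (f ≫ h), fun P Q e h => by
        rw [← φ.2 e (f ≫ h), Category.assoc]⟩
      map_add' := fun _ _ => rfl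
      map_smul' := fun _ _ => rfl }
  map_id Y := by
    apply ModuleCat.hom_ext
    apply LinearMap.ext
    intro φ
    apply Subtype.ext
    funext P h
    exact congrArg (φ.1 P) (Category.id_comp h)
  map_comp f g := by
    apply ModuleCat.hom_ext
    apply LinearMap.ext
    intro φ
    apply Subtype.ext
    funext P h
    exact congrArg (φ.1 P) (Category.assoc f g h)

/-- The inclusion in the coinduced functor. -/
def envelopeInclusion : envelope M ⟶ coinduced M.obj where
  app Y := ModuleCat.ofHom (envelopeSubmodule M Y).subtype
  naturality _ _ _ := rfl

/-- The unit of the envelope. -/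
def unit : M ⟶ envelope M where
  app Y := ModuleCat.ofHom
    { toFun := fun m => ⟨fun P h => (M.map h).hom m, fun P Q e f => by
        change (M.map (f ≫ e.hom)).hom m = _
        rw [M.map_comp]
        rfl⟩
      map_add' := fun x y => by
        apply Subtype.ext
        funext P h
        exact map_add _ _ _
      map_smul' := fun r x => by
        apply Subtype.ext
        funext P h
        exact map_smul _ _ _ }
  naturality Y Z f := by
    apply ModuleCat.hom_ext
    apply LinearMap.ext
    intro m
    apply Subtype.ext
    funext P h
    change (M.map h).hom ((M.map f).hom m) = (M.map (f ≫ h)).hom m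
    rw [M.map_comp]
    rfl

/-- Evaluation at the identity. -/
def counit (Y : C) : (envelope M).obj Y →ₗ[R] M.obj Y where
  toFun φ := φ.1 Y (𝟙 Y)
  map_add' _ _ := rfl
  map_smul' _ _ := rfl

lemma counit_unit (Y : C) (m : M.obj Y) : counit M Y (((unit M).app Y).hom m) = m := by
  change (M.map (𝟙 Y)).hom m = m
  simp

/-- Equivariance under isomorphisms of the target is exactly what is needed here. It gives no
information on noninvertible morphisms, so the unit splits naturally only over the groupoid of
isomorphisms. -/
lemma counit_map_iso {Y Z : C} (e : Y ⟶ Z) [IsIso e] (φ : (envelope M).obj Y) :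
    counit M Z (((envelope M).map e).hom φ) = (M.map e).hom (counit M Y φ) := by
  have h := φ.2 (asIso e) (𝟙 Y)
  change φ.1 Z (e ≫ 𝟙 Z) = _
  rw [Category.comp_id]
  rw [Category.id_comp] at h
  exact h

variable {M} in
lemma equivariant_comp_inv {Y : C} (φ : envelopeSubmodule M Y) {P Q : C} (e : Q ≅ P) (f : Y ⟶ P) :
    φ.1 Q (f ≫ e.inv) = (M.map e.inv).hom (φ.1 P f) := φ.2 e.symm f

variable [∀ P : C, Fintype (Σ Q : C, Q ≅ P)]

/-- A family of endomorphisms whose relative traces are the identity. -/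
def IsTraceFamily (θ : ∀ P : C, Module.End R (M.obj P)) : Prop :=
  ∀ (P : C) (x : M.obj P),
    ∑ a : Σ Q : C, Q ≅ P, (M.map a.2.hom).hom (θ a.1 ((M.map a.2.inv).hom x)) = x

/-- Higman's criterion for the restriction of `M` to the groupoid of isomorphisms. -/
def IsHigman : Prop := ∃ θ : ∀ P : C, Module.End R (M.obj P), IsTraceFamily M θ

variable {M}

/-- The isomorphisms to an object correspond to those to an isomorphic object. -/
def isoToEquiv {P Q : C} (e : P ≅ Q) : (Σ X : C, X ≅ P) ≃ (Σ X : C, X ≅ Q) where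
  toFun a := ⟨a.1, a.2 ≪≫ e⟩
  invFun a := ⟨a.1, a.2 ≪≫ e.symm⟩
  left_inv a := by simp
  right_inv a := by simp

/-- The projection of families indexed by morphisms to the equivariant ones. -/
def averageLinear (θ : ∀ P : C, Module.End R (M.obj P)) (Y : C) :
    (∀ P : C, (Y ⟶ P) → M.obj P) →ₗ[R] envelopeSubmodule M Y where
  toFun φ := ⟨fun P f => ∑ a : Σ Q : C, Q ≅ P,
      (M.map a.2.hom).hom (θ a.1 (φ a.1 (f ≫ a.2.inv))), fun P Q e f => by
    rw [map_sum]
    refine (Fintype.sum_equiv (isoToEquiv e) _ _ fun a => ?_).symm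
    simp [isoToEquiv]
    rfl⟩
  map_add' φ ψ := by
    apply Subtype.ext
    funext P f
    simp [Finset.sum_add_distrib]
  map_smul' r φ := by
    apply Subtype.ext
    funext P f
    simp [Finset.smul_sum]

/-- The projection of the coinduced functor to the equivariant families. -/
def average (θ : ∀ P : C, Module.End R (M.obj P)) : coinduced M.obj ⟶ envelope M where
  app Y := ModuleCat.ofHom (averageLinear θ Y)
  naturality Y Z g := by
    apply ModuleCat.hom_ext
    apply LinearMap.ext
    intro φ
    apply Subtype.ext
    funext P f
    change ∑ a : Σ Q : C, Q ≅ P, _ = ∑ a : Σ Q : C, Q ≅ P, _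
    refine Finset.sum_congr rfl fun a _ => ?_
    exact congrArg (fun h => (M.map a.2.hom).hom
      (θ a.1 ((show ∀ P : C, (Y ⟶ P) → M.obj P from φ) a.1 h))) (Category.assoc g f a.2.inv).symm

lemma inclusion_average {θ : ∀ P : C, Module.End R (M.obj P)} (hθ : IsTraceFamily M θ) :
    envelopeInclusion M ≫ average θ = 𝟙 _ := by
  apply NatTrans.ext
  funext Y
  apply ModuleCat.hom_ext
  apply LinearMap.ext
  intro φ
  apply Subtype.ext
  funext P f
  refine Eq.trans ?_ (hθ P (φ.1 P f))
  refine Finset.sum_congr rfl fun a _ => ?_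
  exact congrArg (fun x => (M.map a.2.hom).hom (θ a.1 x)) (equivariant_comp_inv φ a.2 f)

/-- Averaging with a trace family makes the envelope a retract of the coinduced functor, which is
injective. -/
lemma injective_envelope (hM : IsHigman M) [∀ P, Injective (M.obj P)] : Injective (envelope M) := by
  obtain ⟨θ, hθ⟩ := hM
  refine ⟨fun {X Y} g f _ => ⟨Injective.factorThru (g ≫ envelopeInclusion M) f ≫ average θ, ?_⟩⟩
  rw [← Category.assoc, Injective.comp_factorThru, Category.assoc, inclusion_average hθ,
    Category.comp_id]

/-- If all morphisms are isomorphisms, then Higman's criterion implies injectivity. -/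
theorem injective_of_isHigman (hC : ∀ {X Y : C} (f : X ⟶ Y), IsIso f) (hM : IsHigman M)
    [∀ P, Injective (M.obj P)] : Injective M := by
  have := injective_envelope hM
  let ρ : envelope M ⟶ M :=
    { app := fun Y => ModuleCat.ofHom (counit M Y)
      naturality := fun Y Z f => by
        have := hC f
        apply ModuleCat.hom_ext
        apply LinearMap.ext
        intro φ
        exact counit_map_iso M f φ }
  have h : unit M ≫ ρ = 𝟙 _ := by
    apply NatTrans.ext
    funext Y
    apply ModuleCat.hom_ext
    apply LinearMap.ext
    intro m
    exact counit_unit M Y m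
  refine ⟨fun {X Y} g f _ => ⟨Injective.factorThru (g ≫ unit M) f ≫ ρ, ?_⟩⟩
  rw [← Category.assoc, Injective.comp_factorThru, Category.assoc, h, Category.comp_id]

end Criterion

/-! ### Finite injective dimension over categories with a rank function -/

section Dimension

/-- A weight function that sums to one over the isomorphisms to the source of a morphism. -/
lemma exists_weight (R : Type) [CommRing R] [∀ P : C, Fintype (Σ Q : C, Q ≅ P)]
    (hmono : ∀ {X Y : C} (f : X ⟶ Y), Mono f) :
    ∃ τ : ∀ {Y P : C}, (Y ⟶ P) → R, ∀ {Y P : C} (f : Y ⟶ P),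
      ∑ b : Σ Q : C, Q ≅ Y, τ (b.2.hom ≫ f) = 1 := by
  classical
  -- The weight is the indicator of one chosen morphism in each class under isomorphisms of the
  -- source. As `f` is a monomorphism, exactly one isomorphism moves it to the chosen morphism of
  -- its class.
  let s (P : C) : Setoid (Σ Y : C, Y ⟶ P) :=
    { r := fun a b => ∃ e : a.1 ≅ b.1, e.hom ≫ b.2 = a.2
      iseqv :=
        { refl := fun a => ⟨Iso.refl _, Category.id_comp _⟩
          symm := by
            rintro a b ⟨e, h⟩
            exact ⟨e.symm, by rw [← h]; simp⟩
          trans := by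
            rintro a b c ⟨e, h⟩ ⟨e', h'⟩
            exact ⟨e ≪≫ e', by rw [← h, ← h']; simp⟩ } }
  let rep {Y P : C} (f : Y ⟶ P) : Σ Y : C, Y ⟶ P := (Quotient.mk (s P) ⟨Y, f⟩).out
  refine ⟨fun {Y P} f => if rep f = ⟨Y, f⟩ then 1 else 0, fun {Y P} f => ?_⟩
  obtain ⟨e, he⟩ : ∃ e : (rep f).1 ≅ Y, e.hom ≫ f = (rep f).2 := Quotient.mk_out (s := s P) ⟨Y, f⟩
  have hrep : ∀ b : Σ Q : C, Q ≅ Y, rep (b.2.hom ≫ f) = rep f := fun b =>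
    congrArg Quotient.out (Quotient.sound (s := s P) ⟨b.2, rfl⟩)
  rw [Finset.sum_eq_single (⟨(rep f).1, e⟩ : Σ Q : C, Q ≅ Y)]
  · refine if_pos ?_
    rw [hrep]
    exact Sigma.ext rfl (heq_of_eq he.symm)
  · rintro ⟨Q, h⟩ - hne
    refine if_neg ?_
    rw [hrep]
    intro heq
    apply hne
    have h₁ : (rep f).1 = Q := congrArg Sigma.fst heq
    generalize rep f = a at *
    obtain ⟨X, u⟩ := a
    obtain rfl : X = Q := h₁
    have h₂ : u = h.hom ≫ f := eq_of_heq (Sigma.mk.inj_iff.1 heq).2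
    have := hmono f
    refine Sigma.ext rfl (heq_of_eq (Iso.ext ?_))
    rw [← cancel_mono f, he, ← h₂]
  · intro h
    exact absurd (Finset.mem_univ _) h

variable (M : C ⥤ ModuleCat.{0} R)

/-- The quotient of the envelope by `M`. -/
def cosyzygy : C ⥤ ModuleCat.{0} R where
  obj Y := ModuleCat.of R ((envelope M).obj Y ⧸ LinearMap.range ((unit M).app Y).hom)
  map {Y Z} f := ModuleCat.ofHom (Submodule.mapQ _ _ ((envelope M).map f).hom (by
    rintro _ ⟨m, rfl⟩
    exact ⟨(M.map f).hom m, congrArg (fun φ => φ.hom m) ((unit M).naturality f)⟩))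
  map_id Y := by
    apply ModuleCat.hom_ext
    apply Submodule.linearMap_qext
    apply LinearMap.ext
    intro φ
    refine congrArg (Submodule.Quotient.mk) ?_
    rw [(envelope M).map_id]
    rfl
  map_comp f g := by
    apply ModuleCat.hom_ext
    apply Submodule.linearMap_qext
    apply LinearMap.ext
    intro φ
    refine congrArg (Submodule.Quotient.mk) ?_
    rw [(envelope M).map_comp]
    rfl

/-- The projection to the quotient of the envelope. -/
def toCosyzygy : envelope M ⟶ cosyzygy M where
  app _ := ModuleCat.ofHom (Submodule.mkQ _)
  naturality _ _ _ := rfl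

lemma unit_toCosyzygy : unit M ≫ toCosyzygy M = 0 := by
  apply NatTrans.ext
  funext Y
  apply ModuleCat.hom_ext
  apply LinearMap.ext
  intro m
  exact (Submodule.Quotient.mk_eq_zero _).2 ⟨m, rfl⟩

lemma shortExact_cosyzygy : (ShortComplex.mk _ _ (unit_toCosyzygy M)).ShortExact where
  exact := exact_of_forall_exists _ fun Y x hx => (Submodule.Quotient.mk_eq_zero _).1 hx
  mono_f := by
    change Mono (unit M)
    rw [NatTrans.mono_iff_mono_app]
    intro Y
    rw [ModuleCat.mono_iff_injective]
    exact Function.LeftInverse.injective (counit_unit M Y)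
  epi_g := by
    change Epi (toCosyzygy M)
    rw [NatTrans.epi_iff_epi_app]
    intro Y
    rw [ModuleCat.epi_iff_surjective]
    exact Submodule.mkQ_surjective _

/-- The section of the projection to the cosyzygy that is natural for isomorphisms. -/
def cosyzygySection (Y : C) : (cosyzygy M).obj Y →ₗ[R] (envelope M).obj Y :=
  Submodule.liftQ _ (LinearMap.id - ((unit M).app Y).hom ∘ₗ counit M Y) (by
    rintro _ ⟨m, rfl⟩
    rw [LinearMap.mem_ker, LinearMap.sub_apply, LinearMap.comp_apply, counit_unit]
    exact sub_self _)

lemma cosyzygySection_mk {Y : C} (φ : (envelope M).obj Y) :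
    cosyzygySection M Y (((toCosyzygy M).app Y).hom φ) =
      φ - ((unit M).app Y).hom (counit M Y φ) := rfl

lemma toCosyzygy_section {Y : C} (x : (cosyzygy M).obj Y) :
    ((toCosyzygy M).app Y).hom (cosyzygySection M Y x) = x := by
  obtain ⟨φ, rfl⟩ : ∃ φ, ((toCosyzygy M).app Y).hom φ = x := Submodule.mkQ_surjective _ x
  rw [cosyzygySection_mk, map_sub, sub_eq_self]
  exact congrArg (fun φ' => (φ'.app Y).hom (counit M Y φ)) (unit_toCosyzygy M)

lemma cosyzygySection_map_iso {Y Z : C} (e : Y ⟶ Z) [IsIso e] (x : (cosyzygy M).obj Y) :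
    cosyzygySection M Z (((cosyzygy M).map e).hom x) =
      ((envelope M).map e).hom (cosyzygySection M Y x) := by
  obtain ⟨φ, rfl⟩ : ∃ φ, ((toCosyzygy M).app Y).hom φ = x := Submodule.mkQ_surjective _ x
  have h : ((cosyzygy M).map e).hom (((toCosyzygy M).app Y).hom φ) =
    ((toCosyzygy M).app Z).hom (((envelope M).map e).hom φ) := rfl
  rw [h, cosyzygySection_mk, cosyzygySection_mk, map_sub, counit_map_iso]
  congr 1
  exact congrArg (fun φ' => φ'.hom (counit M Y φ)) ((unit M).naturality e)

variable {M} [∀ P : C, Fintype (Σ Q : C, Q ≅ P)]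

/-- Two averages are combined: the weight sums to one over the isomorphisms to the source `Y`, and
`θ` has trace one over the isomorphisms to the target `P`. Interchanging the sums separates them. -/
lemma isHigman_envelope (hmono : ∀ {X Y : C} (f : X ⟶ Y), Mono f) (hM : IsHigman M) :
    IsHigman (envelope M) := by
  obtain ⟨θ, hθ⟩ := hM
  obtain ⟨τ, hτ⟩ := exists_weight R hmono
  let weigh (Y : C) : (envelope M).obj Y →ₗ[R] (coinduced M.obj).obj Y :=
    { toFun := fun φ P f => τ f • φ.1 P f
      map_add' := fun φ ψ => by
        funext P f
        exact smul_add _ _ _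
      map_smul' := fun r φ => by
        funext P f
        exact smul_comm _ _ _ }
  refine ⟨fun Y => ((average θ).app Y).hom ∘ₗ weigh Y, fun Y φ => ?_⟩
  apply Subtype.ext
  funext P f
  have e : ∀ s : Finset (Σ Q : C, Q ≅ Y), ∀ F : (Σ Q : C, Q ≅ Y) → envelopeSubmodule M Y,
      (∑ b ∈ s, F b).1 P f = ∑ b ∈ s, (F b).1 P f := by
    intro s F
    rw [AddSubmonoidClass.coe_finsetSum, Finset.sum_apply, Finset.sum_apply]
  refine (e _ _).trans ?_
  have e' : ∀ b : Σ Q : C, Q ≅ Y,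
      (show envelopeSubmodule M Y from ((envelope M).map b.2.hom).hom
        ((((average θ).app b.1).hom ∘ₗ weigh b.1) (((envelope M).map b.2.inv).hom φ))).1 P f =
      ∑ a : Σ Q : C, Q ≅ P, τ (b.2.hom ≫ f ≫ a.2.inv) •
        (M.map a.2.hom).hom (θ a.1 (φ.1 a.1 (f ≫ a.2.inv))) := by
    intro b
    change ∑ a : Σ Q : C, Q ≅ P, (M.map a.2.hom).hom (θ a.1
      (τ ((b.2.hom ≫ f) ≫ a.2.inv) • φ.1 a.1 (b.2.inv ≫ (b.2.hom ≫ f) ≫ a.2.inv))) = _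
    refine Finset.sum_congr rfl fun a _ => ?_
    rw [map_smul, map_smul, Category.assoc, Iso.inv_hom_id_assoc]
  refine (Finset.sum_congr rfl fun b _ => e' b).trans ?_
  rw [Finset.sum_comm]
  refine Eq.trans (Finset.sum_congr rfl fun a _ => ?_) (hθ P (φ.1 P f))
  rw [← Finset.sum_smul, hτ, one_smul, equivariant_comp_inv φ a.2 f]

/-- Over the groupoid of isomorphisms the quotient is a direct summand of the envelope by
`cosyzygySection`, and trace families compress to summands. -/
lemma isHigman_cosyzygy (hM : IsHigman (envelope M)) : IsHigman (cosyzygy M) := by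
  obtain ⟨θ, hθ⟩ := hM
  refine ⟨fun Y => ((toCosyzygy M).app Y).hom ∘ₗ θ Y ∘ₗ cosyzygySection M Y, fun Y x => ?_⟩
  refine Eq.trans ?_ (toCosyzygy_section M x)
  refine Eq.trans ?_ (congrArg ((toCosyzygy M).app Y).hom (hθ Y (cosyzygySection M Y x)))
  rw [map_sum]
  refine Finset.sum_congr rfl fun a _ => ?_
  rw [LinearMap.comp_apply, LinearMap.comp_apply, cosyzygySection_map_iso]
  rfl

/-- A functor that satisfies Higman's criterion on a category with a bounded rank function has
finite injective dimension. -/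
theorem hasInjectiveDimensionLT_of_isHigman (hR : ∀ V : ModuleCat.{0} R, Injective V)
    (hmono : ∀ {X Y : C} (f : X ⟶ Y), Mono f) (r : C → ℕ)
    (hr : ∀ {X Y : C}, (X ⟶ Y) → r X ≤ r Y)
    (hiso : ∀ {X Y : C} (f : X ⟶ Y), r X = r Y → IsIso f) (m : ℕ) (M : C ⥤ ModuleCat.{0} R)
    (hM : IsHigman M) (hs : ∀ Y, m ≤ r Y → Subsingleton (M.obj Y)) :
    HasInjectiveDimensionLT M m := by
  induction m generalizing M with
  | zero =>
    apply IsZero.hasInjectiveDimensionLT_zero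
    refine Functor.isZero _ fun Y => ?_
    have := hs Y (Nat.zero_le _)
    exact ModuleCat.isZero_of_subsingleton _
  | succ m ih =>
    have hinj : Injective (envelope M) := injective_envelope hM
    have h₁ := isHigman_cosyzygy (isHigman_envelope hmono hM)
    refine (shortExact_cosyzygy M).hasInjectiveDimensionLT_X₁ (n := m) ?_
      (hasInjectiveDimensionLT_of_ge (envelope M) 1 (m + 1) (by omega))
    refine ih (cosyzygy M) h₁ fun Y hY => ?_
    -- If `r Y ≥ m`, a morphism `Y ⟶ P` either ends where `M` vanishes or satisfies `r P ≤ m ≤ r Y`,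
    -- hence is an isomorphism. So a family at `Y` is determined by its value at the identity, and
    -- the quotient vanishes one layer further down.
    have key : ∀ φ : (envelope M).obj Y, ((unit M).app Y).hom (counit M Y φ) = φ := by
      intro φ
      apply Subtype.ext
      funext P f
      by_cases hP : m + 1 ≤ r P
      · exact (hs P hP).elim _ _
      · have := hiso f (by have := hr f; omega)
        refine (counit_map_iso M f φ).symm.trans ?_
        change φ.1 P (f ≫ 𝟙 P) = _
        rw [Category.comp_id]
    refine ⟨fun x y => ?_⟩
    have hz : ∀ x : (cosyzygy M).obj Y, x = 0 := by
      intro x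
      rw [← toCosyzygy_section M x]
      obtain ⟨φ, rfl⟩ : ∃ φ, ((toCosyzygy M).app Y).hom φ = x := Submodule.mkQ_surjective _ x
      rw [cosyzygySection_mk, key, sub_self, map_zero]
    rw [hz x, hz y]

end Dimension

end Higman

/-! ### Higman's criterion for representations of finite groups -/

section TraceOne

variable {R : Type} [CommRing R] {V : Type} [AddCommGroup V] [Module R V]

/-- Higman's criterion: some endomorphism has relative trace one. -/
def HasTraceOne {A : Type} [Group A] [Fintype A] (ρ : Representation R A V) : Prop :=
  ∃ θ : Module.End R V, ∀ x, ∑ a : A, ρ a (θ (ρ a⁻¹ x)) = x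

variable {A T : Type} [Group A] [Group T] [Fintype A] [Fintype T] {ρ : Representation R A V}

/-- With A = f(T)·U, the partial trace of `θ` over the transversal `U` is an endomorphism whose
trace over `T` is the full trace. -/
lemma HasTraceOne.comp_injective (h : HasTraceOne ρ) (f : T →* A) (hf : Function.Injective f) :
    HasTraceOne (ρ.comp f) := by
  classical
  obtain ⟨θ, hθ⟩ := h
  obtain ⟨U, hU, -⟩ := Subgroup.exists_isComplement_right f.range 1
  have : Fintype U := Fintype.ofFinite U
  let e : T × U ≃ A := (Equiv.prodCongr (MonoidHom.ofInjective hf).toEquiv (Equiv.refl U)).trans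
    (Equiv.ofBijective _ hU)
  have he : ∀ t u, e (t, u) = f t * u := fun t u => rfl
  refine ⟨∑ u : U, ρ u ∘ₗ θ ∘ₗ ρ (u : A)⁻¹, fun x => ?_⟩
  conv_rhs => rw [← hθ x, ← e.sum_comp, Fintype.sum_prod_type]
  refine Finset.sum_congr rfl fun t _ => ?_
  rw [LinearMap.sum_apply, map_sum]
  refine Finset.sum_congr rfl fun u _ => ?_
  simp only [he, MonoidHom.comp_apply, LinearMap.comp_apply, mul_inv_rev, map_mul, map_inv,
    Module.End.mul_apply]

/-- With A = U·f(T), each of the [A : f(T)] cosets contributes the identity to the trace, and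
division by the index corrects this. -/
lemma HasTraceOne.of_comp (f : T →* A) (hf : Function.Injective f) (h : HasTraceOne (ρ.comp f))
    (hu : IsUnit (f.range.index : R)) : HasTraceOne ρ := by
  classical
  obtain ⟨θ, hθ⟩ := h
  obtain ⟨U, hU, -⟩ := Subgroup.exists_isComplement_left f.range 1
  have : Fintype U := Fintype.ofFinite U
  let e : U × T ≃ A := (Equiv.prodCongr (Equiv.refl U) (MonoidHom.ofInjective hf).toEquiv).trans
    (Equiv.ofBijective _ hU)
  have he : ∀ u t, e (u, t) = u * f t := fun u t => rfl
  obtain ⟨c, hc⟩ := hu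
  have hcard : (Fintype.card U : R) = c := by
    rw [hc, ← hU.card_left, Nat.card_eq_fintype_card]
  refine ⟨(↑c⁻¹ : R) • θ, fun x => ?_⟩
  rw [← e.sum_comp, Fintype.sum_prod_type]
  have key : ∀ u : U, ∑ t : T, ρ (e (u, t)) (((↑c⁻¹ : R) • θ) (ρ (e (u, t))⁻¹ x)) =
      (↑c⁻¹ : R) • x := by
    intro u
    have h₁ := congrArg (ρ u) (hθ (ρ (u : A)⁻¹ x))
    rw [map_sum, ← Module.End.mul_apply, ← map_mul, mul_inv_cancel, map_one,
      Module.End.one_apply] at h₁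
    conv_rhs => rw [← h₁, Finset.smul_sum]
    refine Finset.sum_congr rfl fun t _ => ?_
    simp only [he, MonoidHom.comp_apply, LinearMap.smul_apply, mul_inv_rev, map_mul, map_inv,
      Module.End.mul_apply, map_smul]
  rw [Finset.sum_congr rfl fun u _ => key u, Finset.sum_const, Finset.card_univ, ← Nat.cast_smul_eq_nsmul R,
    hcard, smul_smul, Units.mul_inv, one_smul]

/-- A finite subgroup has a weight function that sums to one over its cosets. -/
lemma exists_coset_weight (R : Type) [CommRing R] {Γ : Type} [Group Γ] (f : T →* Γ)
    (hf : Function.Injective f) : ∃ w : Γ → R, ∀ γ, ∑ t : T, w ((f t)⁻¹ * γ) = 1 := by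
  classical
  obtain ⟨U, hU, -⟩ := Subgroup.exists_isComplement_right f.range 1
  rw [Subgroup.isComplement_iff_existsUnique_inv_mul_mem] at hU
  refine ⟨fun γ => if γ ∈ U then 1 else 0, fun γ => ?_⟩
  obtain ⟨⟨_, t, rfl⟩, ht, huniq⟩ := hU γ
  rw [Finset.sum_eq_single t]
  · exact if_pos ht
  · intro t' _ hne
    refine if_neg fun h => hne ?_
    have := huniq ⟨f t', t', rfl⟩ h
    exact hf (congrArg Subtype.val this)
  · exact fun h => absurd (Finset.mem_univ _) h

end TraceOne

namespace Higman

variable {C : Type} [Category.{0} C] {R : Type} [CommRing R]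

/-- The representation of the automorphism group of an object on the value of a functor. -/
def autRep (M : C ⥤ ModuleCat.{0} R) (P : C) : Representation R (Aut P) (M.obj P) where
  toFun a := (M.map a.hom).hom
  map_one' := by
    change (M.map (𝟙 P)).hom = _
    rw [M.map_id]
    rfl
  map_mul' a b := by
    change (M.map (b.hom ≫ a.hom)).hom = _
    rw [M.map_comp]
    rfl

lemma isHigman_of_hasTraceOne [∀ P : C, Fintype (Σ Q : C, Q ≅ P)] [∀ P : C, Fintype (Aut P)]
    (M : C ⥤ ModuleCat.{0} R)
    (h : ∀ P : C, ∃ Q : C, Nonempty (Q ≅ P) ∧ HasTraceOne (autRep M Q)) : IsHigman M := by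
  classical
  choose rep hiso hrep using h
  choose θ hθ using hrep
  let s : Setoid C := isIsomorphicSetoid C
  let r (P : C) : C := (Quotient.mk s P).out
  have hr : ∀ {P Q : C}, (P ≅ Q) → r P = r Q := fun {P Q} e =>
    congrArg Quotient.out (Quotient.sound (s := s) ⟨e⟩)
  have hr' : ∀ P, Nonempty (r P ≅ P) := fun P => Quotient.mk_out (s := s) P
  let c (P : C) : C := rep (r P)
  have hc : ∀ P, Nonempty (c P ≅ P) := fun P =>
    ⟨(hiso (r P)).some ≪≫ (hr' P).some⟩
  -- The family is concentrated on one object `c P` of each isomorphism class, where it is the given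
  -- endomorphism, and is zero elsewhere. The detour through `r` makes `c P` depend only on the
  -- class of `P`.
  let Θ (P : C) : Module.End R (M.obj P) :=
    if e : c P = P then
      (M.map (eqToHom e)).hom ∘ₗ θ (r P) ∘ₗ (M.map (eqToHom e.symm)).hom
    else 0
  have hΘ : ∀ P, Θ (c P) = θ (r P) := by
    intro P
    have h₁ : r (c P) = r P := hr (hc P).some
    have h₂ : c (c P) = c P := congrArg rep h₁
    have key : ∀ (X : C) (e : rep X = c P), X = r P →
        (M.map (eqToHom e)).hom ∘ₗ θ X ∘ₗ (M.map (eqToHom e.symm)).hom = θ (r P) := by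
      rintro X e rfl
      ext x
      simp [c]
    simp only [Θ]
    rw [dif_pos h₂]
    exact key _ _ h₁
  refine ⟨Θ, fun P x => ?_⟩
  let g : c P ≅ P := (hc P).some
  have hsum := hθ (r P) ((M.map g.inv).hom x)
  have h₁ := congrArg (M.map g.hom).hom hsum
  rw [map_sum] at h₁
  have h₂ : (M.map g.hom).hom ((M.map g.inv).hom x) = x := by
    rw [← LinearMap.comp_apply, ← ModuleCat.hom_comp, ← M.map_comp, g.inv_hom_id, M.map_id]
    rfl
  rw [h₂] at h₁
  conv_rhs => rw [← h₁]
  symm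
  -- Only isomorphisms from `c P` contribute, and composition with `g` identifies them with `Aut (c
  -- P)`.
  refine Fintype.sum_of_injective (fun a : Aut (c P) => (⟨c P, a ≪≫ g⟩ : Σ Q : C, Q ≅ P)) ?_ _ _ ?_ ?_
  · intro a b hab
    have := eq_of_heq (Sigma.mk.inj_iff.1 hab).2
    apply Iso.ext
    rw [← cancel_mono g.hom]
    exact congrArg Iso.hom this
  · rintro ⟨Q, e⟩ hQ
    have hne : c Q ≠ Q := by
      intro hcQ
      apply hQ
      have : c P = Q := by rw [← hcQ]; exact congrArg rep (hr e.symm)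
      subst this
      exact ⟨e ≪≫ g.symm, by simp⟩
    have : Θ Q = 0 := dif_neg hne
    rw [this]
    simp
  · intro a
    change (M.map g.hom).hom ((M.map a.hom).hom (θ (r P) ((M.map a.inv).hom ((M.map g.inv).hom x)))) =
      (M.map (a.hom ≫ g.hom)).hom (Θ (c P) ((M.map (g.inv ≫ a.inv)).hom x))
    rw [hΘ, M.map_comp, M.map_comp]
    rfl

end Higman

/-! ### Vanishing of higher limits -/

section Vanishing

variable {C : Type} [Category.{0} C] {R : Type} [CommRing R]

lemma reducedCohomologyVanishes_of_injective (M : C ⥤ ModuleCat.{0} R) [Injective M] :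
    ReducedCohomologyVanishes M := by
  intro n hn x
  obtain ⟨m, rfl⟩ : ∃ m, n = m + 1 := ⟨n - 1, by omega⟩
  let _ := HasExt.standard (C ⥤ ModuleCat.{0} R)
  exact Abelian.Ext.eq_zero_of_injective (show Abelian.Ext.{1} _ M (m + 1) from x)

lemma functorCohomology_eq_zero_of_dimension (M : C ⥤ ModuleCat.{0} R) (m : ℕ)
    [HasInjectiveDimensionLT M m] (n : ℕ) (hn : m ≤ n) (x : FunctorCohomology M n) : x = 0 := by
  let _ := HasExt.standard (C ⥤ ModuleCat.{0} R)
  exact Abelian.Ext.eq_zero_of_hasInjectiveDimensionLT (show Abelian.Ext.{1} _ M n from x) m hn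

lemma functorCohomology_eq_zero_of_shortExact {S : ShortComplex (C ⥤ ModuleCat.{0} R)}
    (hS : S.ShortExact) (n : ℕ) (h₂ : ∀ x : FunctorCohomology S.X₂ n, x = 0)
    (h₁ : ∀ x : FunctorCohomology S.X₁ (n + 1), x = 0) (x : FunctorCohomology S.X₃ n) : x = 0 := by
  let _ := HasExt.standard (C ⥤ ModuleCat.{0} R)
  obtain ⟨y, hy⟩ := Abelian.Ext.covariant_sequence_exact₃ _ hS
    (show Abelian.Ext.{1} _ S.X₃ n from x) rfl (h₁ _)
  have hy' : y = 0 := h₂ y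
  rw [hy', Abelian.Ext.zero_comp] at hy
  exact hy.symm

namespace BarResolution

lemma map_coboundary {M M' : C ⥤ ModuleCat.{0} R} (φ : M ⟶ M') {n : ℕ} (z : Cochain M n) :
    coboundary M' (fun σ => (φ.app _).hom (z σ)) =
      fun σ => (φ.app _).hom (coboundary M z σ) := by
  funext σ
  simp only [coboundary, map_sum, map_zsmul]
  refine Finset.sum_congr rfl fun i _ => ?_
  exact congrArg (fun ψ => ((-1 : ℤ) ^ (i : ℕ)) • ψ.hom (z (face i σ)))
    (φ.naturality (faceHom i σ)).symm

lemma coboundary_sum (M : C ⥤ ModuleCat.{0} R) {n : ℕ} {ι : Type} (s : Finset ι)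
    (z : ι → Cochain M n) : coboundary M (∑ i ∈ s, z i) = ∑ i ∈ s, coboundary M (z i) := by
  funext σ
  simp only [coboundary, Finset.sum_apply, map_sum, Finset.smul_sum]
  rw [Finset.sum_comm]

/-- A functor whose cochains decompose through another functor inherits the vanishing of
cohomology. -/
lemma CocyclesSplit.of_decomposition {M M' : C ⥤ ModuleCat.{0} R} {n : ℕ}
    (h : CocyclesSplit M' n)
    (hdec : ∀ z : Cochain M (n + 1), ∃ (ι : Type) (s : Finset ι) (c : ι → (M ⟶ M'))
      (e : ι → (M' ⟶ M)), ∀ σ, z σ = ∑ i ∈ s, ((e i).app _).hom (((c i).app _).hom (z σ))) :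
    CocyclesSplit M n := by
  intro z hz
  obtain ⟨ι, s, c, e, hdec⟩ := hdec z
  have h₁ : ∀ i, ∃ w : Cochain M' n, coboundary M' w = fun σ => ((c i).app _).hom (z σ) := by
    intro i
    apply h
    rw [map_coboundary, hz]
    funext σ
    exact map_zero _
  choose w hw using h₁
  refine ⟨∑ i ∈ s, fun σ => ((e i).app _).hom (w i σ), ?_⟩
  rw [coboundary_sum]
  funext σ
  rw [hdec σ, Finset.sum_apply]
  refine Finset.sum_congr rfl fun i _ => ?_
  rw [map_coboundary, hw]

end BarResolution

end Vanishing

/-! ### Representations as functors -/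

section RepresentationFunctor

variable {R : Type} [CommRing R] {Γ : Type} [Group Γ]
variable {V W : Type} [AddCommGroup V] [Module R V] [AddCommGroup W] [Module R W]

/-- A representation as a functor on the one-object category. -/
def Representation.toFunctor (ρ : Representation R Γ V) : SingleObj Γ ⥤ ModuleCat.{0} R where
  obj _ := ModuleCat.of R V
  map g := ModuleCat.ofHom (ρ g)
  map_id _ := by
    rw [SingleObj.id_as_one, map_one]
    rfl
  map_comp g h := by
    rw [SingleObj.comp_as_mul, map_mul]
    rfl

/-- An equivariant map as a natural transformation. -/
def Representation.toFunctorHom {ρ : Representation R Γ V} {τ : Representation R Γ W}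
    (f : V →ₗ[R] W) (hf : ∀ g x, f (ρ g x) = τ g (f x)) : ρ.toFunctor ⟶ τ.toFunctor where
  app _ := ModuleCat.ofHom f
  naturality _ _ g := ModuleCat.hom_ext (LinearMap.ext fun x => hf g x)

variable (R Γ V) in
/-- The free `Γ`-module on the underlying module `V`. -/
def freeRep : Representation R Γ (Γ →₀ V) where
  toFun g := Finsupp.lmapDomain V R (g * ·)
  map_one' := by
    ext γ x
    simp
  map_mul' g h := by
    ext γ x : 2
    simp [mul_assoc]

@[simp]
lemma freeRep_single (g γ : Γ) (x : V) :
    freeRep R Γ V g (Finsupp.single γ x) = Finsupp.single (g * γ) x :=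
  Finsupp.mapDomain_single

variable (R Γ V) in
/-- The module of functions on `Γ`, with `Γ` acting by right translation. -/
def funRep : Representation R Γ (Γ → V) where
  toFun g := LinearMap.funLeft R V (· * g)
  map_one' := by
    ext φ x
    simp [LinearMap.funLeft_apply]
  map_mul' g h := by
    ext φ x
    simp [LinearMap.funLeft_apply, mul_assoc]

@[simp]
lemma funRep_apply (g : Γ) (φ : Γ → V) (x : Γ) : funRep R Γ V g φ x = φ (x * g) := rfl

/-- The augmentation of the free module on `V`. -/
def augmentation (ρ : Representation R Γ V) : (Γ →₀ V) →ₗ[R] V := Finsupp.lsum R fun γ => ρ γ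

@[simp]
lemma augmentation_single (ρ : Representation R Γ V) (γ : Γ) (x : V) :
    augmentation ρ (Finsupp.single γ x) = ρ γ x := by
  simp [augmentation]

lemma augmentation_freeRep (ρ : Representation R Γ V) (g : Γ) (x : Γ →₀ V) :
    augmentation ρ (freeRep R Γ V g x) = ρ g (augmentation ρ x) := by
  have : augmentation ρ ∘ₗ freeRep R Γ V g = ρ g ∘ₗ augmentation ρ := by
    ext γ y
    simp
  exact LinearMap.congr_fun this x

/-- The kernel of the augmentation. -/
def syzygyRep (ρ : Representation R Γ V) : Representation R Γ (LinearMap.ker (augmentation ρ)) where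
  toFun g := (freeRep R Γ V g).restrict fun x hx => by
    rw [LinearMap.mem_ker] at hx ⊢
    rw [augmentation_freeRep, hx, map_zero]
  map_one' := by
    ext x : 2
    simp
  map_mul' g h := by
    ext x : 2
    simp

variable {T : Type} [Group T] [Fintype T]

/-- `T` acts freely on `Γ` by translation, so multiplication by a coset weight has trace one. The
inverse converts right translation into the left translation of the weight. -/
lemma hasTraceOne_funRep (j : T →* Γ) (hj : Function.Injective j) :
    HasTraceOne ((funRep R Γ V).comp j) := by
  obtain ⟨w, hw⟩ := exists_coset_weight R j hj
  refine ⟨{ toFun := fun φ x => w x⁻¹ • φ x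
            map_add' := fun φ ψ => funext fun x => smul_add _ _ _
            map_smul' := fun r φ => funext fun x => smul_comm _ _ _ }, fun φ => ?_⟩
  funext x
  rw [Finset.sum_apply]
  have : ∀ t : T, ((funRep R Γ V).comp j) t (fun y => w y⁻¹ • ((funRep R Γ V).comp j) t⁻¹ φ y) x =
      w ((j t)⁻¹ * x⁻¹) • φ x := by
    intro t
    simp
  exact (Finset.sum_congr rfl fun t _ => this t).trans (by rw [← Finset.sum_smul, hw, one_smul])

lemma hasTraceOne_freeRep (j : T →* Γ) (hj : Function.Injective j) :
    HasTraceOne ((freeRep R Γ V).comp j) := by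
  obtain ⟨w, hw⟩ := exists_coset_weight R j hj
  let θ : Module.End R (Γ →₀ V) := Finsupp.lsum R fun γ => w γ • Finsupp.lsingle γ
  have hθ : ∀ γ x, θ (Finsupp.single γ x) = w γ • Finsupp.single γ x := fun γ x => by simp [θ]
  refine ⟨θ, fun φ => ?_⟩
  have : ∑ t : T, (freeRep R Γ V (j t)) ∘ₗ θ ∘ₗ (freeRep R Γ V (j t⁻¹)) = LinearMap.id := by
    refine Finsupp.lhom_ext fun γ x => ?_
    rw [LinearMap.sum_apply]
    have h₁ : ∀ t : T, (freeRep R Γ V (j t) ∘ₗ θ ∘ₗ freeRep R Γ V (j t⁻¹)) (Finsupp.single γ x) =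
        w ((j t)⁻¹ * γ) • Finsupp.single γ x := by
      intro t
      rw [LinearMap.comp_apply, LinearMap.comp_apply, freeRep_single, hθ, map_smul, freeRep_single,
        map_inv, mul_inv_cancel_left]
    rw [Finset.sum_congr rfl fun t _ => h₁ t, ← Finset.sum_smul, hw, one_smul]
    rfl
  have h₂ := LinearMap.congr_fun this φ
  rw [LinearMap.sum_apply] at h₂
  exact h₂

/-- The endomorphism is twisted on the summand of γ to γ⁻¹θγ. This makes it lift `θ` along the
augmentation, so that it preserves the kernel, while its trace over `T` is still the identity. -/
lemma HasTraceOne.syzygy {ρ : Representation R Γ V} {j : T →* Γ} (h : HasTraceOne (ρ.comp j)) :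
    HasTraceOne ((syzygyRep ρ).comp j) := by
  obtain ⟨θ, hθ⟩ := h
  let Θ : Module.End R (Γ →₀ V) :=
    Finsupp.lsum R fun γ => Finsupp.lsingle γ ∘ₗ ρ γ⁻¹ ∘ₗ θ ∘ₗ ρ γ
  have hΘ : ∀ γ x, Θ (Finsupp.single γ x) = Finsupp.single γ (ρ γ⁻¹ (θ (ρ γ x))) :=
    fun γ x => by simp [Θ]
  have haug : ∀ x, augmentation ρ (Θ x) = θ (augmentation ρ x) := by
    have : augmentation ρ ∘ₗ Θ = θ ∘ₗ augmentation ρ := by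
      refine Finsupp.lhom_ext fun γ x => ?_
      rw [LinearMap.comp_apply, LinearMap.comp_apply, hΘ, augmentation_single, augmentation_single]
      simp
    exact fun x => LinearMap.congr_fun this x
  have hsum : ∑ t : T, (freeRep R Γ V (j t)) ∘ₗ Θ ∘ₗ (freeRep R Γ V (j t⁻¹)) = LinearMap.id := by
    refine Finsupp.lhom_ext fun γ x => ?_
    rw [LinearMap.sum_apply]
    have h₁ : ∀ t : T, (freeRep R Γ V (j t) ∘ₗ Θ ∘ₗ freeRep R Γ V (j t⁻¹)) (Finsupp.single γ x) =
        Finsupp.lsingle (R := R) γ (ρ γ⁻¹ (ρ (j t) (θ (ρ (j t⁻¹) (ρ γ x))))) := by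
      intro t
      rw [LinearMap.comp_apply, LinearMap.comp_apply, freeRep_single, hΘ, freeRep_single,
        map_inv, mul_inv_cancel_left]
      simp
    rw [Finset.sum_congr rfl fun t _ => h₁ t, ← map_sum, ← map_sum]
    have := hθ (ρ γ x)
    simp only [MonoidHom.comp_apply] at this
    rw [this]
    simp
  refine ⟨Θ.restrict fun x hx => ?_, fun x => Subtype.ext ?_⟩
  · rw [LinearMap.mem_ker] at hx ⊢
    rw [haug, hx, map_zero]
  · have h₂ := LinearMap.congr_fun hsum (x : Γ →₀ V)
    rw [LinearMap.sum_apply] at h₂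
    rw [AddSubmonoidClass.coe_finsetSum]
    exact h₂

end RepresentationFunctor

/-! ### Comparison of coefficient systems -/

section Comparison

variable {C : Type} [Category.{0} C] {R : Type} [CommRing R] {Γ : Type} [Group Γ]

/-- The syzygy sequence of a representation, restricted along a functor. -/
def syzygySequence (J : C ⥤ SingleObj Γ) {V : Type} [AddCommGroup V] [Module R V]
    (ρ : Representation R Γ V) : ShortComplex (C ⥤ ModuleCat.{0} R) where
  X₁ := J ⋙ (syzygyRep ρ).toFunctor
  X₂ := J ⋙ (freeRep R Γ V).toFunctor
  X₃ := J ⋙ ρ.toFunctor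
  f := Functor.whiskerLeft J
    (Representation.toFunctorHom (LinearMap.ker (augmentation ρ)).subtype fun g x => rfl)
  g := Functor.whiskerLeft J
    (Representation.toFunctorHom (augmentation ρ) fun g x => augmentation_freeRep ρ g x)
  zero := by
    ext P : 2
    refine ModuleCat.hom_ext (LinearMap.ext fun x => ?_)
    exact x.2

lemma syzygySequence_shortExact (J : C ⥤ SingleObj Γ) {V : Type} [AddCommGroup V] [Module R V]
    (ρ : Representation R Γ V) : (syzygySequence J ρ).ShortExact where
  exact := exact_of_forall_exists _ fun y x hx => ⟨⟨x, hx⟩, rfl⟩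
  mono_f := by
    have : ∀ P, Mono ((syzygySequence J ρ).f.app P) := fun P => by
      rw [ModuleCat.mono_iff_injective]
      exact Subtype.val_injective
    exact NatTrans.mono_of_mono_app _
  epi_g := by
    have : ∀ P, Epi ((syzygySequence J ρ).g.app P) := fun P => by
      rw [ModuleCat.epi_iff_surjective]
      intro x
      refine ⟨Finsupp.single 1 x, (augmentation_single ρ 1 x).trans ?_⟩
      rw [map_one]
      rfl
    exact NatTrans.epi_of_epi_app _

/-- The group ring is the free module of rank one. -/
def groupRingModuleIso (R : Type) [CommRing R] (Γ : Type) [Group Γ] :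
    groupRingModule R Γ ≅ (freeRep R Γ R).toFunctor :=
  NatIso.ofComponents (fun _ => (MonoidAlgebra.coeffLinearEquiv R).toModuleIso) fun g => by
    refine ModuleCat.hom_ext ?_
    change (MonoidAlgebra.coeffLinearEquiv R).toLinearMap ∘ₗ
      LinearMap.mulLeft R (MonoidAlgebra.of R Γ g) =
      freeRep R Γ R g ∘ₗ (MonoidAlgebra.coeffLinearEquiv R).toLinearMap
    refine MonoidAlgebra.lhom_ext' fun γ => LinearMap.ext_ring ?_
    change (MonoidAlgebra.single g 1 * MonoidAlgebra.single γ 1 : MonoidAlgebra R Γ).coeff =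
      freeRep R Γ R g (Finsupp.single γ 1)
    rw [MonoidAlgebra.single_mul_single, mul_one, freeRep_single]
    rfl

/-- Over a field, the cohomology of a finite category with coefficients in a free module vanishes
when it does for the group ring. -/
lemma BarResolution.CocyclesSplit.of_groupRing {k : Type} [Field k] {J : C ⥤ SingleObj Γ} {n : ℕ}
    [Finite (ComposableArrows C (n + 1))]
    (h : CocyclesSplit (J ⋙ groupRingModule k Γ) n) (V : Type) [AddCommGroup V] [Module k V] :
    CocyclesSplit (J ⋙ (freeRep k Γ V).toFunctor) n := by
  classical
  refine h.of_decomposition fun z => ?_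
  let b := Module.Basis.ofVectorSpace k V
  let ζ (σ : ComposableArrows C (n + 1)) : Γ →₀ V := z σ
  have : Fintype (ComposableArrows C (n + 1)) := Fintype.ofFinite _
  let c (i : Module.Basis.ofVectorSpaceIndex k V) :
      (freeRep k Γ V).toFunctor ⟶ (freeRep k Γ k).toFunctor :=
    Representation.toFunctorHom (Finsupp.mapRange.linearMap (b.coord i)) fun g x =>
      (Finsupp.mapDomain_mapRange _ _ _ (map_zero _) (map_add _)).symm
  let e (i : Module.Basis.ofVectorSpaceIndex k V) :
      (freeRep k Γ k).toFunctor ⟶ (freeRep k Γ V).toFunctor :=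
    Representation.toFunctorHom (Finsupp.mapRange.linearMap (LinearMap.toSpanSingleton k V (b i)))
      fun g x => (Finsupp.mapDomain_mapRange _ _ _ (map_zero _) (map_add _)).symm
  -- A cochain has finitely many values because there are finitely many simplices. Each value is
  -- finitely supported and involves finitely many basis vectors of `V`, so finitely many
  -- coordinates recover the cochain even if `V` has infinite dimension.
  refine ⟨_, Finset.univ.biUnion fun σ => (ζ σ).support.biUnion fun γ => (b.repr (ζ σ γ)).support,
    fun i => Functor.whiskerLeft J (c i ≫ (groupRingModuleIso k Γ).inv),
    fun i => Functor.whiskerLeft J ((groupRingModuleIso k Γ).hom ≫ e i), fun σ => ?_⟩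
  have key : ∀ (x : Γ →₀ V) (s : Finset _), (∀ γ, (b.repr (x γ)).support ⊆ s) →
      x = ∑ i ∈ s, Finsupp.mapRange.linearMap (LinearMap.toSpanSingleton k V (b i))
        (Finsupp.mapRange.linearMap (b.coord i) x) := by
    intro x s hs
    ext γ
    conv_lhs => rw [← b.linearCombination_repr (x γ), Finsupp.linearCombination_apply,
      Finsupp.sum_of_support_subset _ (hs γ) _ (by simp)]
    rw [Finsupp.finsetSum_apply]
    rfl
  refine (key (ζ σ) _ fun γ => ?_).trans (Finset.sum_congr rfl fun i _ => ?_)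
  · by_cases hγ : γ ∈ (ζ σ).support
    · exact (Finset.subset_biUnion_of_mem (fun γ => (b.repr (ζ σ γ)).support) hγ).trans
        (Finset.subset_biUnion_of_mem
          (fun σ => (ζ σ).support.biUnion fun γ => (b.repr (ζ σ γ)).support) (Finset.mem_univ σ))
    · rw [Finsupp.notMem_support_iff.1 hγ, map_zero]
      simp
  · change _ = Finsupp.mapRange.linearMap (LinearMap.toSpanSingleton k V (b i))
      (MonoidAlgebra.coeffLinearEquiv k ((MonoidAlgebra.coeffLinearEquiv k).symm
        (Finsupp.mapRange.linearMap (b.coord i) (ζ σ))))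
    rw [LinearEquiv.apply_symm_apply]

/-- If the cohomology with coefficients in the group ring vanishes, then it vanishes for all
modules in a class that is closed under syzygies and has bounded cohomological dimension. -/
theorem reducedCohomologyVanishes_of_groupRing {k : Type} [Field k] (J : C ⥤ SingleObj Γ)
    [∀ n, Finite (ComposableArrows C n)] {T : Type} [Group T] [Fintype T] (j : T →* Γ) (m : ℕ)
    (hdim : ∀ (V : Type) [AddCommGroup V] [Module k V] (ρ : Representation k Γ V),
      HasTraceOne (ρ.comp j) → ∀ n, m ≤ n → ∀ x : FunctorCohomology (J ⋙ ρ.toFunctor) n, x = 0)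
    (h : ReducedCohomologyVanishes (J ⋙ groupRingModule k Γ))
    (V : Type) [AddCommGroup V] [Module k V] (ρ : Representation k Γ V)
    (hρ : HasTraceOne (ρ.comp j)) : ReducedCohomologyVanishes (J ⋙ ρ.toFunctor) := by
  -- Descending induction on the degree, for all representations of the class at once: degree n for
  -- ρ is squeezed between degree n of a free module and degree n + 1 of the syzygy.
  have key : ∀ (d n : ℕ), m ≤ n + d → 0 < n → ∀ (V : Type) [AddCommGroup V] [Module k V]
      (ρ : Representation k Γ V), HasTraceOne (ρ.comp j) →
      ∀ x : FunctorCohomology (J ⋙ ρ.toFunctor) n, x = 0 := by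
    intro d
    induction d with
    | zero => intro n hn _ V _ _ ρ hρ; exact hdim V ρ hρ n hn
    | succ d ih =>
      intro n hn hn' V _ _ ρ hρ
      obtain ⟨n, rfl⟩ : ∃ i, n = i + 1 := ⟨n - 1, by omega⟩
      refine functorCohomology_eq_zero_of_shortExact (syzygySequence_shortExact J ρ) (n + 1) ?_
        (ih (n + 1 + 1) (by omega) (by omega) _ (syzygyRep ρ) hρ.syzygy)
      refine (BarResolution.functorCohomology_eq_zero_iff _ _).2 ?_
      exact BarResolution.CocyclesSplit.of_groupRing
        ((BarResolution.reducedCohomologyVanishes_iff _).1 h n) V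
  intro n hn
  exact key m n (by omega) hn V ρ hρ

lemma finite_composableArrows (C : Type) [Category.{0} C] [Finite C] [∀ X Y : C, Finite (X ⟶ Y)]
    (n : ℕ) : Finite (ComposableArrows C n) := by
  let f (σ : ComposableArrows C n) :
      Σ o : Fin (n + 1) → C, ∀ i j : Fin (n + 1), (i ⟶ j) → (o i ⟶ o j) :=
    ⟨σ.obj, fun _ _ a => σ.map a⟩
  refine Finite.of_injective f fun σ τ h => ?_
  obtain ⟨oσ, mσ, _, _⟩ := σ
  obtain ⟨oτ, mτ, _, _⟩ := τ
  simp only [f, Sigma.mk.injEq] at h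
  obtain ⟨rfl, h⟩ := h
  have h := eq_of_heq h
  have : @mσ = @mτ := by
    funext i j a
    exact congrFun (congrFun (congrFun h i) j) a
  subst this
  rfl

end Comparison

/-! ### Groups -/

/-- In a one-object groupoid every morphism is invertible, so `M` itself is a retract of its
envelope. -/
lemma injective_toFunctor {R : Type} [CommRing R] {T V : Type} [Group T] [Fintype T]
    [AddCommGroup V] [Module R V] (ρ : Representation R T V) (h : HasTraceOne ρ)
    [hV : Injective (ModuleCat.of R V)] : Injective ρ.toFunctor := by
  classical
  let f : Aut (SingleObj.star T) →* T :=
    { toFun := fun a => a.hom, map_one' := rfl, map_mul' := fun _ _ => rfl }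
  have hf : Function.Injective f := fun a b hab => Iso.ext hab
  have : Finite (Aut (SingleObj.star T)) := Finite.of_injective f hf
  have : ∀ P Q : SingleObj T, Finite (P ≅ Q) := fun _ _ => this
  have : Finite (SingleObj T) := inferInstanceAs (Finite Unit)
  have (P : SingleObj T) : Fintype (Σ Q : SingleObj T, Q ≅ P) := Fintype.ofFinite _
  have (P : SingleObj T) : Fintype (Aut P) :=
    have : Finite (Aut P) := ‹∀ P Q : SingleObj T, Finite (P ≅ Q)› P P
    Fintype.ofFinite _
  have (P : SingleObj T) : Injective (ρ.toFunctor.obj P) := hV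
  refine Higman.injective_of_isHigman (fun f => ?_) (Higman.isHigman_of_hasTraceOne _ fun P =>
    ⟨P, ⟨Iso.refl P⟩, h.comp_injective f hf⟩)
  exact (Groupoid.isoEquivHom _ _ |>.symm f).isIso_hom

lemma injective_of_field {k : Type} [Field k] (V : ModuleCat.{0} k) : Injective V :=
  (Module.injective_iff_injective_object k V).1 (Module.injective_of_isSemisimpleRing k V)

namespace PLocalFiniteGroup

variable {p : ℕ} {S : Type} [Group S] (G : PLocalFiniteGroup p S)

/-! ### Morphisms of a linking system -/

variable {G}

/-- The homomorphism that underlies a morphism of the linking system. -/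
def proj {P Q : G.Link} (f : P ⟶ Q) : P.1 →* Q.1 := G.L.π f

lemma proj_mem {P Q : G.Link} (f : P ⟶ Q) : proj f ∈ G.F.Hom P.1 Q.1 := G.L.π_mem f

lemma proj_id (P : G.Link) : proj (𝟙 P) = MonoidHom.id P.1 := G.L.π_id P

lemma proj_comp {P Q R : G.Link} (f : P ⟶ Q) (g : Q ⟶ R) :
    proj (f ≫ g) = (proj g).comp (proj f) := G.L.π_comp f g

lemma proj_injective {P Q : G.Link} (f : P ⟶ Q) : Function.Injective (proj f) :=
  G.F.injective (proj_mem f)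

/-- The distinguished monomorphism of an object. -/
def dist (P : G.Link) : P.1 →* Aut P := G.L.δ P

lemma exists_proj_eq {P Q : G.Link} {φ : P.1 →* Q.1} (h : φ ∈ G.F.Hom P.1 Q.1) :
    ∃ f : P ⟶ Q, proj f = φ := G.L.π_surjective φ h

lemma exists_of_proj_eq {P Q : G.Link} {f g : P ⟶ Q} (h : proj f = proj g) :
    ∃ z ∈ Subgroup.center P.1, g = (dist P z).hom ≫ f := (G.L.π_eq_iff f g).1 h

lemma dist_free {P Q : G.Link} (f : P ⟶ Q) {z : P.1} (hz : z ∈ Subgroup.center P.1)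
    (h : (dist P z).hom ≫ f = f) : z = 1 := G.L.free f z hz h

lemma proj_dist (P : G.Link) (x y : P.1) : proj (dist P x).hom y = x * y * x⁻¹ := G.L.π_δ P x y

lemma dist_comp {P Q : G.Link} (f : P ⟶ Q) (x : P.1) :
    (dist P x).hom ≫ f = f ≫ (dist Q (proj f x)).hom := G.L.δ_comp f x

/-- Two morphisms equalized by `f` have the same underlying homomorphism, hence differ by a central
element, which is trivial by freeness. -/
instance mono_link {P Q : G.Link} (f : P ⟶ Q) : Mono f where
  right_cancellation {Z} g h hgh := by
    have h₁ : proj g = proj h := by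
      have := congrArg proj hgh
      rw [proj_comp, proj_comp] at this
      exact MonoidHom.ext fun x => proj_injective f (DFunLike.congr_fun this x)
    obtain ⟨z, hz, rfl⟩ := exists_of_proj_eq h₁
    rw [Category.assoc] at hgh
    rw [dist_free _ hz hgh.symm, map_one]
    exact (Category.id_comp g).symm

/-- The order of the subgroup. -/
def rank (P : G.Link) : ℕ := Nat.card P.1

lemma rank_le {P Q : G.Link} (f : P ⟶ Q) : rank P ≤ rank Q :=
  have := G.finite
  Nat.card_le_card_of_injective _ (proj_injective f)

/-- By finiteness the underlying homomorphism is an isomorphism of the fusion system; a lift of its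
inverse, corrected by a central element, is a section of `f`. -/
lemma isIso_of_rank_eq {P Q : G.Link} (f : P ⟶ Q) (h : rank P = rank Q) : IsIso f := by
  have := G.finite
  obtain ⟨R, hR, e, he, he', hf⟩ := G.F.factor (proj_mem f)
  have hRQ : R = Q.1 := by
    apply Subgroup.eq_of_le_of_card_ge hR
    rw [← Nat.card_congr e.toEquiv]
    exact h.ge
  subst hRQ
  obtain ⟨g, hg⟩ := exists_proj_eq he'
  have h₁ : proj (g ≫ f) = proj (𝟙 Q) := by
    rw [proj_comp, hg, hf, proj_id]
    ext x
    simp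
  obtain ⟨z, -, hz⟩ := exists_of_proj_eq h₁
  have : IsSplitEpi f := ⟨⟨(dist Q z).hom ≫ g, by rw [Category.assoc, ← hz]⟩⟩
  exact isIso_of_mono_of_isSplitEpi f

lemma exists_iso_of_isConj (P : G.Link) {Q : Subgroup S} (h : G.F.IsConj Q P.1) :
    ∃ Q' : G.Link, Q'.1 = Q ∧ Nonempty (Q' ≅ P) := by
  obtain ⟨e, he⟩ := h
  have hQ : G.F.IsCentric Q := by
    rintro R ⟨e', he'⟩
    exact P.2 R ⟨e.symm.trans e', G.F.comp_mem he.2 he'.1, G.F.comp_mem he'.2 he.1⟩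
  let Q' : G.Link := ⟨Q, hQ⟩
  obtain ⟨f, -⟩ := exists_proj_eq (P := Q') (Q := P) he.1
  have := isIso_of_rank_eq f (Nat.card_congr e.toEquiv)
  exact ⟨Q', rfl, ⟨asIso f⟩⟩

variable (G) in
lemma finite_link : Finite G.Link :=
  have := G.finite
  inferInstanceAs (Finite {P : Subgroup S // G.F.IsCentric P})

lemma finite_hom (P Q : G.Link) : Finite (P ⟶ Q) := by
  have := G.finite
  rw [← Set.finite_univ_iff]
  have : Finite (P.1 →* Q.1) := DFunLike.finite _
  refine Set.Finite.of_finite_fibers proj (Set.toFinite _) ?_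
  rintro _ ⟨f, -, rfl⟩
  refine (Set.finite_range fun z : P.1 => (dist P z).hom ≫ f).subset ?_
  rintro g ⟨-, hg⟩
  obtain ⟨z, -, hz⟩ := exists_of_proj_eq (Eq.symm hg : proj f = proj g)
  exact ⟨z, hz.symm⟩

lemma exists_fullyNormalized (P : G.Link) :
    ∃ Q : G.Link, G.F.FullyNormalized Q.1 ∧ Nonempty (Q ≅ P) := by
  have := G.finite
  obtain ⟨Q, hQ, hmax⟩ := Set.exists_max_image {Q | G.F.IsConj Q P.1}
    (fun Q => Nat.card (Subgroup.normalizer (Q : Set S))) (Set.toFinite _)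
    ⟨P.1, MulEquiv.refl _, G.F.id_mem _, G.F.id_mem _⟩
  obtain ⟨Q', rfl, hiso⟩ := exists_iso_of_isConj P hQ
  obtain ⟨e, he⟩ := hQ
  refine ⟨Q', ?_, hiso⟩
  rintro R ⟨e', he'⟩
  exact hmax R ⟨e'.symm.trans e, G.F.comp_mem he'.2 he.1, G.F.comp_mem he.2 he'.1⟩

/-- The projection `Aut_L(P) → Aut_F(P)`. -/
def projAut (P : G.Link) : Aut P →* G.F.aut P.1 where
  toFun a := ⟨(proj a.hom).toMulEquiv (proj a.inv)
    (by rw [← proj_comp, a.hom_inv_id, proj_id]) (by rw [← proj_comp, a.inv_hom_id, proj_id]),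
    proj_mem a.hom, proj_mem a.inv⟩
  map_one' := Subtype.ext (MulEquiv.ext fun x => DFunLike.congr_fun (proj_id P) x)
  map_mul' a b := Subtype.ext (MulEquiv.ext fun x => DFunLike.congr_fun (proj_comp b.hom a.hom) x)

lemma projAut_apply (P : G.Link) (a : Aut P) (x : P.1) :
    (projAut P a : MulAut P.1) x = proj a.hom x := rfl

lemma projAut_surjective (P : G.Link) : Function.Surjective (projAut P) := by
  rintro ⟨e, he⟩
  obtain ⟨f, hf⟩ := exists_proj_eq (P := P) (Q := P) he.1
  have := isIso_of_rank_eq f rfl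
  exact ⟨asIso f, Subtype.ext (MulEquiv.ext fun x => DFunLike.congr_fun hf x)⟩

lemma exists_dist_of_projAut_eq_one {P : G.Link} {a : Aut P} (h : projAut P a = 1) :
    ∃ z ∈ Subgroup.center P.1, a = dist P z := by
  have h₁ : proj (𝟙 P) = proj a.hom := by
    rw [proj_id]
    ext x : 1
    exact (congrArg (fun e : G.F.aut P.1 => (e : MulAut P.1) x) h).symm
  obtain ⟨z, hz, h₂⟩ := exists_of_proj_eq h₁
  exact ⟨z, hz, Iso.ext (by rw [h₂]; exact Category.comp_id _)⟩

lemma δTop_eq (x : S) : G.δTop x = dist G.top ⟨x, trivial⟩ := rfl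

/-! ### Normalizers in the linking system -/

namespace Inclusions

variable (I : G.Inclusions)

lemma proj_incl {P Q : G.Link} (h : P.1 ≤ Q.1) : proj (I.incl h) = Subgroup.inclusion h :=
  I.π_incl h

/-- The chosen inclusion in `S`. -/
def inclTop (P : G.Link) : P ⟶ G.top := I.incl le_top

lemma proj_inclTop (P : G.Link) (x : P.1) : (proj (I.inclTop P) x : S) = x :=
  congrArg Subtype.val (DFunLike.congr_fun (I.proj_incl (P := P) (Q := G.top) le_top) x)

/-- Any lift of conjugation by `x` makes the square commute up to an element of Z(P), which can be
absorbed into the lift. Since morphisms are monomorphisms, the corrected lift is unique, hence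
multiplicative in `x`. -/
lemma exists_conjugation (P : G.Link) (x : Subgroup.normalizer (P.1 : Set S)) :
    ∃ f : P ⟶ P, f ≫ I.inclTop P = I.inclTop P ≫ (G.δTop x).hom := by
  have hmem : (P.1.normalizerMonoidHom x).toMonoidHom ∈ G.F.Hom P.1 P.1 :=
    G.F.conj_mem _ x fun y => rfl
  obtain ⟨f, hf⟩ := exists_proj_eq (P := P) (Q := P) hmem
  have h : proj (f ≫ I.inclTop P) = proj (I.inclTop P ≫ (G.δTop x).hom) := by
    rw [proj_comp, proj_comp, hf, δTop_eq]
    ext y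
    rw [MonoidHom.comp_apply, MonoidHom.comp_apply, proj_dist, proj_inclTop]
    change (x * y * x⁻¹ : S) = x * (proj (I.inclTop P) y : S) * x⁻¹
    rw [proj_inclTop]
  obtain ⟨z, -, hz⟩ := exists_of_proj_eq h
  exact ⟨(dist P z).hom ≫ f, by rw [hz, Category.assoc]⟩

/-- An element of `N_S(P)` as an automorphism of `P` in the linking system. -/
def conjugation (P : G.Link) (x : Subgroup.normalizer (P.1 : Set S)) : P ⟶ P :=
  (I.exists_conjugation P x).choose

lemma conjugation_comp (P : G.Link) (x : Subgroup.normalizer (P.1 : Set S)) :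
    I.conjugation P x ≫ I.inclTop P = I.inclTop P ≫ (G.δTop x).hom :=
  (I.exists_conjugation P x).choose_spec

instance (P : G.Link) (x : Subgroup.normalizer (P.1 : Set S)) : IsIso (I.conjugation P x) :=
  isIso_of_rank_eq _ rfl

/-- The homomorphism `N_S(P) → Aut_L(P)`. -/
def normalizerHom (P : G.Link) : Subgroup.normalizer (P.1 : Set S) →* Aut P where
  toFun x := asIso (I.conjugation P x)
  map_one' := Iso.ext (by
    rw [← cancel_mono (I.inclTop P)]
    change I.conjugation P 1 ≫ _ = 𝟙 P ≫ _
    rw [conjugation_comp, OneMemClass.coe_one, map_one, Category.id_comp]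
    exact Category.comp_id _)
  map_mul' x y := Iso.ext (by
    rw [← cancel_mono (I.inclTop P)]
    change I.conjugation P (x * y) ≫ _ = (I.conjugation P y ≫ I.conjugation P x) ≫ _
    rw [conjugation_comp, Category.assoc, conjugation_comp, ← Category.assoc, conjugation_comp,
      Category.assoc, Subgroup.coe_mul, map_mul]
    rfl)

lemma normalizerHom_comp (P : G.Link) (x : Subgroup.normalizer (P.1 : Set S)) :
    (I.normalizerHom P x).hom ≫ I.inclTop P = I.inclTop P ≫ (G.δTop x).hom :=
  I.conjugation_comp P x

lemma proj_normalizerHom (P : G.Link) (x : Subgroup.normalizer (P.1 : Set S)) (y : P.1) :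
    (proj (I.normalizerHom P x).hom y : S) = (x : S) * y * (x : S)⁻¹ := by
  have h := congrArg (fun f => (proj f y : S)) (I.normalizerHom_comp P x)
  simp only [proj_comp, MonoidHom.comp_apply, proj_inclTop] at h
  rw [h, δTop_eq, proj_dist]
  change (x : S) * (proj (I.inclTop P) y : S) * (x : S)⁻¹ = _
  rw [proj_inclTop]

lemma normalizerHom_dist (P : G.Link) (z : P.1) :
    I.normalizerHom P ⟨z, Subgroup.le_normalizer z.2⟩ = dist P z := by
  apply Iso.ext
  rw [← cancel_mono (I.inclTop P), normalizerHom_comp, dist_comp, δTop_eq]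
  congr 3
  exact Subtype.ext (I.proj_inclTop P z).symm

/-- An element of the kernel centralizes `P`, so it lies in Z(P) because `P` is centric, and Z(P)
acts freely. -/
lemma normalizerHom_injective (P : G.Link) : Function.Injective (I.normalizerHom P) := by
  rw [injective_iff_map_eq_one]
  intro x hx
  have hconj : ∀ y : P.1, (x : S) * y * (x : S)⁻¹ = y := by
    intro y
    rw [← I.proj_normalizerHom P x y, hx]
    exact congrArg Subtype.val (DFunLike.congr_fun (proj_id P) y)
  have hmem : (x : S) ∈ Subgroup.centralizer (P.1 : Set S) := by
    rw [Subgroup.mem_centralizer_iff]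
    intro y hy
    exact (mul_inv_eq_iff_eq_mul.1 (hconj ⟨y, hy⟩)).symm
  rw [P.2 P.1 ⟨MulEquiv.refl _, G.F.id_mem _, G.F.id_mem _⟩] at hmem
  obtain ⟨z, hz, hzx⟩ := hmem
  have hxz : x = ⟨z, Subgroup.le_normalizer z.2⟩ := Subtype.ext hzx.symm
  rw [hxz, normalizerHom_dist] at hx
  have : z = 1 := dist_free (𝟙 P) hz (by rw [hx]; exact Category.id_comp _)
  rw [hxz, this]
  rfl

/-- The kernel Z(P) of Aut_L(P) → Aut_F(P) lies in the image of N_S(P), so the index can be computed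
in Aut_F(P), where the image contains the Sylow subgroup Aut_S(P) provided by saturation. -/
lemma not_dvd_index_range [Fact p.Prime] {P : G.Link} (hP : G.F.FullyNormalized P.1) :
    ¬ p ∣ (I.normalizerHom P).range.index := by
  have := G.finite
  obtain ⟨-, T, hT⟩ := G.saturated.fullyNormalized P.1 hP
  have hker : (projAut P).ker ≤ (I.normalizerHom P).range := by
    intro a ha
    obtain ⟨z, -, rfl⟩ := exists_dist_of_projAut_eq_one ha
    exact ⟨_, I.normalizerHom_dist P z⟩
  rw [← Subgroup.index_map_eq _ (projAut_surjective P) hker]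
  have : Finite (MulAut P.1) := Finite.of_injective _ (MulEquiv.toEquiv_injective)
  refine fun h => T.not_dvd_index (h.trans (Subgroup.index_dvd_of_le ?_))
  rw [hT]
  rintro e ⟨x, hx⟩
  refine ⟨_, ⟨x, rfl⟩, Subtype.ext ?_⟩
  ext y
  rw [projAut_apply, proj_normalizerHom]
  exact congrArg (fun e : MulAut P.1 => (e y : S)) hx

lemma J_inclTop (P : G.Link) : I.J.map (I.inclTop P) = 𝟙 (SingleObj.star G.Γ) := by
  apply Iso.ext
  change (I.toTop P).inv ≫ (I.toTop P).hom ≫ (FreeGroupoid.of G.Link).map (I.incl (le_refl G.top.1))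
    = 𝟙 _
  rw [I.incl_top, CategoryTheory.Functor.map_id, Category.comp_id, Iso.inv_hom_id]

/-- Since `J` sends the chosen inclusions to the identity, it cannot distinguish `x` acting on `P`
from `x` acting on `S`. -/
lemma J_normalizerHom (P : G.Link) (x : Subgroup.normalizer (P.1 : Set S)) :
    I.J.map (I.normalizerHom P x).hom = I.J.map (G.δTop x).hom := by
  have h := congrArg I.J.map (I.normalizerHom_comp P x)
  rw [I.J.map_comp, I.J.map_comp, J_inclTop] at h
  exact (Category.comp_id (X := SingleObj.star G.Γ) _).symm.trans
    (h.trans (Category.id_comp (Y := SingleObj.star G.Γ) _))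

/-- The homomorphism `S → Γ`. -/
def toΓ : S →* G.Γ where
  toFun s := (G.ι ⋙ I.J).map (X := SingleObj.star S) (Y := SingleObj.star S) s
  map_one' := (G.ι ⋙ I.J).map_id (SingleObj.star S)
  map_mul' s t := (G.ι ⋙ I.J).map_comp (X := SingleObj.star S) (Y := SingleObj.star S)
    (Z := SingleObj.star S) t s

lemma toΓ_injective (h : (G.ι ⋙ I.J).Faithful) : Function.Injective I.toΓ :=
  fun _ _ hst => h.map_injective hst

/-! ### Coefficients pulled back from the fundamental group -/

section Coefficients

variable [Fact p.Prime] [Fintype S] {V : Type} [AddCommGroup V] [Module (ZMod p) V]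

/-- The criterion restricts from `S` to N_S(P) and then ascends to Aut_L(P), whose index over N_S(P)
is invertible in `ZMod p`. -/
lemma hasTraceOne_autRep {ρ : Representation (ZMod p) G.Γ V} (h : HasTraceOne (ρ.comp I.toΓ))
    {P : G.Link} (hP : G.F.FullyNormalized P.1) [Fintype (Aut P)] :
    HasTraceOne (Higman.autRep (I.J ⋙ ρ.toFunctor) P) := by
  classical
  have : Fintype (Subgroup.normalizer (P.1 : Set S)) := Fintype.ofFinite _
  refine HasTraceOne.of_comp (I.normalizerHom P) (I.normalizerHom_injective P) ?_ ?_
  · have h₁ := h.comp_injective (Subgroup.normalizer (P.1 : Set S)).subtype Subtype.val_injective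
    have heq : (ρ.comp I.toΓ).comp (Subgroup.normalizer (P.1 : Set S)).subtype =
        (Higman.autRep (I.J ⋙ ρ.toFunctor) P).comp (I.normalizerHom P) :=
      MonoidHom.ext fun x => congrArg ρ (I.J_normalizerHom P x).symm
    rw [heq] at h₁
    exact h₁
  · rw [isUnit_iff_ne_zero, Ne, ZMod.natCast_eq_zero_iff]
    exact I.not_dvd_index_range hP

/-- The rank is the order of the subgroup, so it never reaches |S| + 1. Every isomorphism class has
a fully normalized member, and the criterion has to be checked only there. -/
theorem hasInjectiveDimensionLT {ρ : Representation (ZMod p) G.Γ V}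
    (h : HasTraceOne (ρ.comp I.toΓ)) :
    HasInjectiveDimensionLT (I.J ⋙ ρ.toFunctor) (Nat.card S + 1) := by
  classical
  have := G.finite_link
  have (P Q : G.Link) := finite_hom P Q
  have (P Q : G.Link) : Finite (P ≅ Q) := Finite.of_injective Iso.hom fun a b hab => Iso.ext hab
  have (P : G.Link) : Fintype (Σ Q : G.Link, Q ≅ P) := Fintype.ofFinite _
  have (P : G.Link) : Fintype (Aut P) :=
    have : Finite (Aut P) := ‹∀ P Q : G.Link, Finite (P ≅ Q)› P P
    Fintype.ofFinite _
  refine Higman.hasInjectiveDimensionLT_of_isHigman injective_of_field (fun f => inferInstance) rank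
    rank_le isIso_of_rank_eq _ _ (Higman.isHigman_of_hasTraceOne _ fun P => ?_) fun P hP => ?_
  · obtain ⟨Q, hQ, hiso⟩ := exists_fullyNormalized P
    exact ⟨Q, hiso, I.hasTraceOne_autRep h hQ⟩
  · exact absurd (Subgroup.card_le_card_group P.1) (by
      have : Nat.card P.1 = rank P := rfl
      omega)

/-- If the cohomology of `L` with coefficients in the group ring vanishes, then so does the
cohomology with coefficients in the functions on `Γ`. -/
theorem reducedCohomologyVanishes_funRep (hf : (G.ι ⋙ I.J).Faithful)
    (h : ReducedCohomologyVanishes (I.J ⋙ groupRingModule (ZMod p) G.Γ)) :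
    ReducedCohomologyVanishes (I.J ⋙ (funRep (ZMod p) G.Γ (ZMod p)).toFunctor) := by
  have := G.finite_link
  have (P Q : G.Link) := finite_hom P Q
  have (n : ℕ) := finite_composableArrows G.Link n
  refine reducedCohomologyVanishes_of_groupRing I.J I.toΓ (Nat.card S + 1) ?_ h _ _
    (hasTraceOne_funRep _ (I.toΓ_injective hf))
  intro W _ _ ρ hρ n hn
  have := I.hasInjectiveDimensionLT hρ
  exact functorCohomology_eq_zero_of_dimension _ (Nat.card S + 1) n hn

theorem reducedCohomologyVanishes_ι_groupRing (hf : (G.ι ⋙ I.J).Faithful) :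
    ReducedCohomologyVanishes (G.ι ⋙ I.J ⋙ groupRingModule (ZMod p) G.Γ) := by
  have : Injective (ModuleCat.of (ZMod p) (G.Γ →₀ ZMod p)) := injective_of_field _
  have : Injective (Representation.toFunctor ((freeRep (ZMod p) G.Γ (ZMod p)).comp I.toΓ)) :=
    injective_toFunctor _ (hasTraceOne_freeRep _ (I.toΓ_injective hf))
  have : Injective (G.ι ⋙ I.J ⋙ (freeRep (ZMod p) G.Γ (ZMod p)).toFunctor) := this
  have : Injective (G.ι ⋙ I.J ⋙ groupRingModule (ZMod p) G.Γ) :=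
    Injective.of_iso (Functor.isoWhiskerLeft G.ι (Functor.isoWhiskerLeft I.J
      (groupRingModuleIso (ZMod p) G.Γ).symm)) this
  exact reducedCohomologyVanishes_of_injective _

end Coefficients

end Inclusions

end PLocalFiniteGroup

/-! ### Homology and cohomology of simplicial sets over a field -/

namespace SSet

variable {k : Type} [Field k] (X : SSet.{0})

/-- The coboundary of a simplicial cochain. -/
def cochainD {A : Type} [AddCommGroup A] {n : ℕ} (f : X.obj (.op (.mk n)) → A)
    (x : X.obj (.op (.mk (n + 1)))) : A :=
  ∑ i : Fin (n + 2), ((-1 : ℤ) ^ (i : ℕ)) • f (X.δ i x)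

/-- The generator of the chains given by a simplex. -/
def chain {n : ℕ} (x : X.obj (.op (.mk n))) : (X.chainComplex (ModuleCat.of k k)).X n :=
  (X.ιChainComplex (R := ModuleCat.of k k) x).hom (1 : k)

lemma chain_hom_ext {n : ℕ} {V : ModuleCat.{0} k}
    {φ ψ : (X.chainComplex (ModuleCat.of k k)).X n ⟶ V}
    (h : ∀ x, φ.hom (X.chain x) = ψ.hom (X.chain x)) : φ = ψ := by
  refine SSet.chainComplex_hom_ext fun x => ModuleCat.hom_ext (LinearMap.ext_ring ?_)
  exact h x

lemma d_chain {n : ℕ} (x : X.obj (.op (.mk (n + 1)))) :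
    ((X.chainComplex (ModuleCat.of k k)).d (n + 1) n).hom (X.chain x) =
      ∑ i : Fin (n + 2), ((-1 : ℤ) ^ (i : ℕ)) • X.chain (k := k) (X.δ i x) := by
  have h := X.ιChainComplex_d (R := ModuleCat.of k k) x
  have h' := congrArg (fun φ => φ.hom (1 : k)) h
  refine Eq.trans h' ?_
  simp only [ModuleCat.hom_sum, LinearMap.sum_apply, ModuleCat.hom_zsmul]
  rfl

/-- Over a field, a cycle that is not a boundary is detected by a functional vanishing on
boundaries. Such a functional is a cocycle, hence a coboundary, and so it kills all cycles. -/
lemma isZero_homology_of_cochains (n : ℕ)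
    (h : ∀ f : X.obj (.op (.mk (n + 1))) → k, X.cochainD f = 0 →
      ∃ g : X.obj (.op (.mk n)) → k, X.cochainD g = f) :
    IsZero (X.homology (ModuleCat.of k k) (n + 1)) := by
  rw [← HomologicalComplex.exactAt_iff_isZero_homology,
    HomologicalComplex.exactAt_iff' _ (n + 1 + 1) (n + 1) n (by simp) (by simp),
    ShortComplex.moduleCat_exact_iff]
  intro (x : (X.chainComplex (ModuleCat.of k k)).X (n + 1)) hx
  by_contra hne
  have hmem : x ∉ LinearMap.range
      ((X.chainComplex (ModuleCat.of k k)).d (n + 1 + 1) (n + 1)).hom := by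
    rintro ⟨y, hy⟩
    exact hne ⟨y, hy⟩
  obtain ⟨φ, hφx, hφ⟩ := Submodule.exists_le_ker_of_notMem hmem
  have hcocycle : X.cochainD (fun y => φ (X.chain y)) = 0 := by
    funext y
    have : φ (((X.chainComplex (ModuleCat.of k k)).d (n + 1 + 1) (n + 1)).hom (X.chain y)) = 0 :=
      hφ ⟨_, rfl⟩
    rw [d_chain, map_sum] at this
    refine Eq.trans ?_ this
    exact Finset.sum_congr rfl fun i _ => (map_zsmul φ _ _).symm
  obtain ⟨g, hg⟩ := h _ hcocycle
  let ψ : (X.chainComplex (ModuleCat.of k k)).X n ⟶ ModuleCat.of k k :=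
    (X.isColimitChainComplexXCofan (ModuleCat.of k k) n).desc
      (Cofan.mk _ fun y => ModuleCat.ofHom (LinearMap.toSpanSingleton k k (g y)))
  have hψ : ∀ y, ψ.hom (X.chain y) = g y := by
    intro y
    have h₁ := (X.isColimitChainComplexXCofan (ModuleCat.of k k) n).fac
      (Cofan.mk _ fun y => ModuleCat.ofHom (LinearMap.toSpanSingleton k k (g y))) ⟨y⟩
    have h₂ := congrArg (fun φ => φ.hom (1 : k)) h₁
    refine Eq.trans h₂ ?_
    exact one_mul (g y)
  have hφψ : ModuleCat.ofHom φ = (X.chainComplex (ModuleCat.of k k)).d (n + 1) n ≫ ψ := by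
    refine X.chain_hom_ext fun y => ?_
    refine (congrFun hg y).symm.trans ?_
    change _ = ψ.hom (((X.chainComplex (ModuleCat.of k k)).d (n + 1) n).hom (X.chain y))
    rw [d_chain, map_sum]
    exact Finset.sum_congr rfl fun i _ => (by rw [map_zsmul, hψ])
  apply hφx
  refine (congrArg (fun χ => χ.hom x) hφψ).trans ?_
  change ψ.hom (((X.chainComplex (ModuleCat.of k k)).d (n + 1) n).hom x) = 0
  have hx' : ((X.chainComplex (ModuleCat.of k k)).d (n + 1) n).hom x = 0 := hx
  rw [hx', map_zero]

instance subsingleton_terminal (n : ℕ) : Subsingleton ((⊤_ SSet.{0}).obj (.op (.mk n))) :=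
  (SSet.yonedaEquiv (n := .mk n) (X := ⊤_ SSet.{0})).symm.subsingleton

instance nonempty_terminal (n : ℕ) : Nonempty ((⊤_ SSet.{0}).obj (.op (.mk n))) :=
  ⟨SSet.yonedaEquiv (n := .mk n) (terminal.from _)⟩

instance isConnected_terminal : (⊤_ SSet.{0}).IsConnected where
  nonempty := ⟨(nonempty_terminal 0).some⟩
  allEq a b := by
    obtain ⟨a, rfl⟩ := a.mk_surjective
    obtain ⟨b, rfl⟩ := b.mk_surjective
    exact congrArg _ (Subsingleton.elim a b)

lemma cochainD_eq [∀ n, Subsingleton (X.obj (.op (.mk n)))] {n : ℕ}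
    (f : X.obj (.op (.mk n)) → k) (x : X.obj (.op (.mk (n + 1)))) (y : X.obj (.op (.mk n))) :
    X.cochainD f x = if Even n then 0 else f y := by
  have h : X.cochainD f x = (∑ i : Fin (n + 2), (-1 : ℤ) ^ (i : ℕ)) • f y := by
    rw [Finset.sum_smul]
    exact Finset.sum_congr rfl fun i _ => by rw [Subsingleton.elim (X.δ i x) y]
  rw [h, Fin.sum_univ_eq_sum_range (fun i => (-1 : ℤ) ^ i), neg_one_geom_sum]
  by_cases hn : Even n
  · have : Even (n + 2) := hn.add (by decide)
    simp [hn, this]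
  · have : ¬ Even (n + 2) := by
      rw [Nat.even_add]
      simp [hn]
    simp [hn, this]

lemma isZero_homology_terminal (n : ℕ) :
    IsZero ((⊤_ SSet.{0}).homology (ModuleCat.of k k) (n + 1)) := by
  apply isZero_homology_of_cochains
  intro f hf
  obtain ⟨a⟩ := nonempty_terminal (n + 1)
  obtain ⟨b⟩ := nonempty_terminal n
  obtain ⟨c⟩ := nonempty_terminal (n + 1 + 1)
  have hfa : ∀ x, f x = f a := fun x => congrArg f (Subsingleton.elim _ _)
  by_cases hn : Even (n + 1)
  · refine ⟨fun _ => f a, funext fun x => ?_⟩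
    rw [cochainD_eq _ _ x b, if_neg (by rwa [Nat.even_add_one] at hn), hfa x]
  · refine ⟨0, funext fun x => ?_⟩
    have := congrFun hf c
    rw [cochainD_eq _ _ c a, if_neg hn] at this
    rw [cochainD_eq _ _ x b, hfa, this]
    simp

/-- A connected simplicial set without cohomology in positive degrees is acyclic. -/
lemma isIso_homologyMap_terminal [X.IsConnected]
    (h : ∀ (n : ℕ) (f : X.obj (.op (.mk (n + 1))) → k), X.cochainD f = 0 →
      ∃ g : X.obj (.op (.mk n)) → k, X.cochainD g = f) (n : ℕ) :
    IsIso (SSet.homologyMap (terminal.from X) (ModuleCat.of k k) n) := by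
  match n with
  | n + 1 =>
    exact (X.isZero_homology_of_cochains n (h n)).isIso (isZero_homology_terminal n) _
  | 0 =>
    -- In degree zero the class of any vertex of a connected simplicial set identifies the homology
    -- with `k`, and these classes are preserved by the map to the point.
    obtain ⟨x⟩ := (inferInstance : X.Nonempty)
    let i (Y : SSet.{0}) (y : Y.obj (.op (.mk 0))) :
        ModuleCat.of k k ⟶ Y.homology (ModuleCat.of k k) 0 :=
      (Y.chainComplex (ModuleCat.of k k)).liftCycles (Y.ιChainComplex y) 0 (by simp) (by simp) ≫
        (Y.chainComplex (ModuleCat.of k k)).homologyπ 0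
    have hi (Y : SSet.{0}) [Y.IsConnected] (y : Y.obj (.op (.mk 0))) : IsIso (i Y y) := by
      have h₁ : i Y y ≫ Y.homology₀ε (ModuleCat.of k k) = 𝟙 _ := by
        rw [Category.assoc]
        exact Y.liftCycles_ιChainComplex_homologyπ_homology₀ε _ y
      have : IsIso (i Y y ≫ Y.homology₀ε (ModuleCat.of k k)) := by rw [h₁]; infer_instance
      exact IsIso.of_isIso_comp_right (i Y y) (Y.homology₀ε (ModuleCat.of k k))
    have hcomp : i X x ≫ SSet.homologyMap (terminal.from X) (ModuleCat.of k k) 0 =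
        i _ ((terminal.from X).app _ x) := by
      simp only [i, Category.assoc, SSet.homologyMap, HomologicalComplex.homologyπ_naturality,
        HomologicalComplex.liftCycles_comp_cyclesMap_assoc]
      congr 2
      simp
    have := hi X x
    have := hi _ ((terminal.from X).app _ x)
    have : IsIso (i X x ≫ SSet.homologyMap (terminal.from X) (ModuleCat.of k k) 0) := by
      rw [hcomp]; infer_instance
    exact IsIso.of_isIso_comp_left (i X x) _

end SSet

/-! ### Cohomology of a covering category -/

namespace Covering

open BarResolution

variable {C : Type} [Category.{0} C] {Γ : Type} [Group Γ] (J : C ⥤ SingleObj Γ)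

/-- The covering category of a functor to a group. -/
abbrev Cover : Type := (J ⋙ actionAsFunctor Γ Γ).Elements

/-- The element of `Γ` assigned to a morphism. -/
abbrev label {X Y : C} (f : X ⟶ Y) : Γ := J.map f

lemma label_comp {X Y Z : C} (f : X ⟶ Y) (g : Y ⟶ Z) :
    label J (f ≫ g) = label J g * label J f := J.map_comp f g

variable {J} in
/-- The sheet of an object of the covering category. -/
abbrev sheet (x : Cover J) : Γ := x.2

variable {J} in
lemma label_mul_sheet {x y : Cover J} (f : x ⟶ y) : label J f.1 * sheet x = sheet y := f.2

/-- The lift of a simplex with given last vertex. -/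
def lift {n : ℕ} (σ : ComposableArrows C n) (a : Γ) : ComposableArrows (Cover J) n where
  obj i := ⟨σ.obj i, ((label J (σ.map (homOfLE (Fin.le_last i))))⁻¹ * a : Γ)⟩
  map {i j} f := ⟨σ.map f, by
    change label J (σ.map f) * ((label J (σ.map (homOfLE (Fin.le_last i))))⁻¹ * a) =
      (label J (σ.map (homOfLE (Fin.le_last j))))⁻¹ * a
    have h : homOfLE (Fin.le_last i) = f ≫ homOfLE (Fin.le_last j) := rfl
    rw [h, σ.map_comp, label_comp]
    group⟩
  map_id i := Subtype.ext (σ.map_id i)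
  map_comp f g := Subtype.ext (σ.map_comp f g)

variable {J}

/-- The image of a simplex of the covering category. -/
abbrev base {n : ℕ} (τ : ComposableArrows (Cover J) n) : ComposableArrows C n :=
  τ ⋙ CategoryOfElements.π _

/-- The labels of the morphisms to the last vertex determine all sheets from the last one, so lifts
with prescribed last sheet are unique. -/
lemma lift_base {n : ℕ} (τ : ComposableArrows (Cover J) n) :
    lift J (base τ) (sheet (τ.obj (Fin.last n))) = τ := by
  have hobj : ∀ i, (lift J (base τ) (sheet (τ.obj (Fin.last n)))).obj i = τ.obj i := fun i => by
    refine Sigma.ext rfl (heq_of_eq ?_)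
    change (label J (τ.map (homOfLE (Fin.le_last i))).1)⁻¹ * sheet (τ.obj (Fin.last n)) =
      sheet (τ.obj i)
    rw [inv_mul_eq_iff_eq_mul]
    exact (label_mul_sheet _).symm
  have hval : ∀ {x y : Cover J} (h : x = y), (eqToHom h).1 = eqToHom (congrArg Sigma.fst h) := by
    rintro x _ rfl
    rfl
  refine CategoryTheory.Functor.ext hobj fun i j f => Subtype.ext ?_
  rw [CategoryOfElements.comp_val, CategoryOfElements.comp_val, hval, hval]
  change (τ.map f).1 = 𝟙 _ ≫ (τ.map f).1 ≫ 𝟙 _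
  rw [Category.comp_id, Category.id_comp]

lemma face_lift {n : ℕ} (i : Fin (n + 2)) (σ : ComposableArrows C (n + 1)) (a : Γ) :
    face i (lift J σ a) = lift J (face i σ) ((label J (faceHom i σ))⁻¹ * a) :=
  (lift_base (face i (lift J σ a))).symm

lemma sheet_face {n : ℕ} (i : Fin (n + 2)) (τ : ComposableArrows (Cover J) (n + 1)) :
    (sheet ((face i τ).obj (Fin.last n)))⁻¹ =
      (sheet (τ.obj (Fin.last (n + 1))))⁻¹ * label J (faceHom i (base τ)) := by
  rw [← label_mul_sheet (faceHom i τ)]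
  change _ = (label J (faceHom i τ).1 * _)⁻¹ * label J (faceHom i τ).1
  group

variable {R : Type} [CommRing R] {V : Type} [AddCommGroup V] [Module R V]

/-- The bar cochain given by a cochain of the covering. -/
def descend {n : ℕ} (f : ComposableArrows (Cover J) n → V) :
    Cochain (J ⋙ (funRep R Γ V).toFunctor) n := fun σ => (fun x => f (lift J σ x⁻¹) : Γ → V)

lemma coboundary_apply {n : ℕ} (z : Cochain (J ⋙ (funRep R Γ V).toFunctor) n)
    (σ : ComposableArrows C (n + 1)) (x : Γ) :
    (coboundary _ z σ : Γ → V) x = ∑ i : Fin (n + 2), ((-1 : ℤ) ^ (i : ℕ)) •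
      (z (face i σ) : Γ → V) (x * label J (faceHom i σ)) := by
  change (∑ i : Fin (n + 2), ((-1 : ℤ) ^ (i : ℕ)) •
    funRep R Γ V (label J (faceHom i σ)) (z (face i σ)) : Γ → V) x = _
  rw [Finset.sum_apply]
  rfl

/-- A simplex of the cover is a simplex of `C` with a sheet over its last vertex, so evaluating
functions at the inverse of that sheet matches both cochains and coboundaries. The inverse is forced
by the action on functions by right translation. -/
lemma cochains_of_cocyclesSplit {n : ℕ} (h : CocyclesSplit (J ⋙ (funRep R Γ V).toFunctor) n)
    (f : ComposableArrows (Cover J) (n + 1) → V)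
    (hf : (nerve (Cover J)).cochainD f = 0) :
    ∃ g : ComposableArrows (Cover J) n → V, (nerve (Cover J)).cochainD g = f := by
  obtain ⟨w, hw⟩ := h (descend f) (by
    funext σ
    change (coboundary _ (descend f) σ : Γ → V) = 0
    funext x
    rw [coboundary_apply]
    refine Eq.trans ?_ (congrFun hf (lift J σ x⁻¹))
    refine Finset.sum_congr rfl fun i _ => ?_
    change _ • f (lift J (face i σ) (x * label J (faceHom i σ))⁻¹) = _ • f (face i (lift J σ x⁻¹))
    rw [face_lift, mul_inv_rev])
  refine ⟨fun τ => (w (base τ) : Γ → V) (sheet (τ.obj (Fin.last n)))⁻¹,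
    funext fun (τ : ComposableArrows (Cover J) (n + 1)) => ?_⟩
  have h₁ := congrFun (congrFun hw (base τ) : (coboundary _ w (base τ) : Γ → V) = _)
    (sheet (τ.obj (Fin.last (n + 1))))⁻¹
  rw [coboundary_apply] at h₁
  refine Eq.trans ?_ (h₁.trans ?_)
  · refine Finset.sum_congr rfl fun i _ => ?_
    change _ • (w (base (face i τ)) : Γ → V) (sheet ((face i τ).obj (Fin.last n)))⁻¹ = _
    rw [sheet_face]
    rfl
  · change f (lift J (base τ) (sheet (τ.obj (Fin.last (n + 1))))⁻¹⁻¹) = f τ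
    rw [inv_inv, lift_base]

end Covering

/-! ### Connectedness and acyclicity of the universal cover -/

namespace PLocalFiniteGroup.Inclusions

variable {p : ℕ} {S : Type} [Group S] {G : PLocalFiniteGroup p S} (I : G.Inclusions)

lemma toTop_top : I.toTop G.top = Iso.refl _ := by
  apply Iso.ext
  change (FreeGroupoid.of G.Link).map (I.incl (le_refl G.top.1)) = 𝟙 _
  rw [I.incl_top, CategoryTheory.Functor.map_id]

/-- The element of `Γ` given by a morphism of the groupoid completion. -/
def conjTop {P Q : G.Link}
    (γ : (FreeGroupoid.of G.Link).obj P ⟶ (FreeGroupoid.of G.Link).obj Q) : G.Γ :=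
  (I.toTop P).symm ≪≫ asIso γ ≪≫ I.toTop Q

lemma conjTop_id (P : G.Link) : I.conjTop (𝟙 ((FreeGroupoid.of G.Link).obj P)) = 1 := by
  apply Iso.ext
  change (I.toTop P).inv ≫ 𝟙 _ ≫ (I.toTop P).hom = 𝟙 _
  simp

lemma conjTop_comp {P Q R : G.Link}
    (f : (FreeGroupoid.of G.Link).obj P ⟶ (FreeGroupoid.of G.Link).obj Q)
    (g : (FreeGroupoid.of G.Link).obj Q ⟶ (FreeGroupoid.of G.Link).obj R) :
    I.conjTop (f ≫ g) = I.conjTop g * I.conjTop f := by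
  apply Iso.ext
  change (I.toTop P).inv ≫ (f ≫ g) ≫ (I.toTop R).hom =
    ((I.toTop P).inv ≫ f ≫ (I.toTop Q).hom) ≫ ((I.toTop Q).inv ≫ g ≫ (I.toTop R).hom)
  simp

lemma conjTop_top (γ : G.Γ) : I.conjTop γ.hom = γ := by
  rw [conjTop, toTop_top]
  apply Iso.ext
  simp

/-- The extension of `J` to the groupoid completion. -/
def extendedJ : FreeGroupoid G.Link ⥤ SingleObj G.Γ where
  obj _ := SingleObj.star _
  map {X Y} γ := I.conjTop (P := X.as.as) (Q := Y.as.as) γ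
  map_id X := I.conjTop_id X.as.as
  map_comp f g := I.conjTop_comp f g

/-- The classes of the morphisms of the linking system generate `Γ`. -/
lemma mem_of_forall_J_mem (H : Subgroup G.Γ)
    (h : ∀ {P Q : G.Link} (f : P ⟶ Q), Covering.label I.J f ∈ H) (γ : G.Γ) : γ ∈ H := by
  let JH : G.Link ⥤ SingleObj H :=
    { obj := fun _ => SingleObj.star _
      map := fun f => (⟨Covering.label I.J f, h f⟩ : H)
      map_id := fun P => Subtype.ext (I.J.map_id P)
      map_comp := fun f g => Subtype.ext (I.J.map_comp f g) }
  -- If all classes lie in `H`, then `J` factors through B(H), and by the universal property so does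
  -- its extension to the groupoid completion. On Γ that extension is the identity.
  have heq : I.extendedJ = FreeGroupoid.lift JH ⋙ SingleObj.mapHom _ _ H.subtype := by
    apply FreeGroupoid.functorEquiv.injective
    refine CategoryTheory.Functor.ext (fun _ => rfl) fun P Q f => ?_
    simp only [eqToHom_refl, Category.comp_id, Category.id_comp]
    change Covering.label I.J f = H.subtype ((FreeGroupoid.lift JH).map (FreeGroupoid.homMk f))
    rw [FreeGroupoid.lift_map_homMk]
    rfl
  have hγ := CategoryTheory.Functor.congr_hom heq γ.hom
  simp only [eqToHom_refl, Category.comp_id, Category.id_comp] at hγ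
  have h₁ : I.conjTop γ.hom = H.subtype ((FreeGroupoid.lift JH).map γ.hom) := hγ
  rw [← I.conjTop_top γ, h₁]
  exact Subtype.property _

/-- The inclusions join (P, a) to (S, a), so the elements of Γ whose translation preserves all
components form a subgroup containing every J(f), which is all of Γ. -/
lemma isConnected_nerve : (nerve I.UniversalCover).IsConnected := by
  let c (P : G.Link) (a : G.Γ) : SSet.π₀ (nerve I.UniversalCover) :=
    SSet.π₀.mk ((nerveEquiv (C := I.UniversalCover)).symm (⟨P, a⟩ : I.UniversalCover))
  have hc : ∀ {P Q : G.Link} (f : P ⟶ Q) (a : G.Γ), c P a = c Q (Covering.label I.J f * a) :=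
    fun {P Q} f a => SSet.π₀.sound (nerve.edgeMk (C := I.UniversalCover) (x := ⟨P, a⟩)
      (y := ⟨Q, (Covering.label I.J f * a : G.Γ)⟩) ⟨f, rfl⟩)
  have htop : ∀ (P : G.Link) (a : G.Γ), c P a = c G.top a := by
    intro P a
    rw [hc (I.inclTop P) a]
    congr 1
    exact (congrArg (· * a) (I.J_inclTop P)).trans (one_mul a)
  let H : Subgroup G.Γ :=
    { carrier := {g | ∀ a, c G.top (g * a) = c G.top a}
      one_mem' := fun a => by rw [one_mul]
      mul_mem' := fun {g h} hg hh a => by rw [mul_assoc, hg, hh]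
      inv_mem' := fun {g} hg a => by rw [← hg (g⁻¹ * a), mul_inv_cancel_left] }
  have hH : ∀ γ, γ ∈ H := I.mem_of_forall_J_mem H fun {P Q} f a => by
    rw [← htop Q, ← hc f, htop]
  have hall : ∀ P a, c P a = c G.top 1 := fun P a => by
    have := hH a 1
    rwa [mul_one, ← htop P] at this
  refine { nonempty := ⟨(nerveEquiv (C := I.UniversalCover)).symm (⟨G.top, (1 : G.Γ)⟩ : I.UniversalCover)⟩, allEq := ?_ }
  intro x y
  obtain ⟨x, rfl⟩ := x.mk_surjective
  obtain ⟨y, rfl⟩ := y.mk_surjective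
  obtain ⟨⟨P, a⟩, rfl⟩ := nerveEquiv.symm.surjective x
  obtain ⟨⟨Q, b⟩, rfl⟩ := nerveEquiv.symm.surjective y
  exact (hall P a).trans (hall Q b).symm

/-- If the cohomology with coefficients in the functions on `Γ` vanishes, then the universal cover
is mod `p` acyclic. -/
theorem isModPAcyclic [Fact p.Prime]
    (h : ReducedCohomologyVanishes (I.J ⋙ (funRep (ZMod p) G.Γ (ZMod p)).toFunctor)) :
    IsModPAcyclic p (nerve I.UniversalCover) := by
  have := I.isConnected_nerve
  refine SSet.isIso_homologyMap_terminal _ fun n f hf => ?_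
  exact Covering.cochains_of_cocyclesSplit
    ((BarResolution.reducedCohomologyVanishes_iff _).1 h n) f hf

theorem groupRing_counterexample [Fact p.Prime] (hf : (G.ι ⋙ I.J).Faithful)
    (h : ¬ IsModPAcyclic p (nerve I.UniversalCover)) :
    ReducedCohomologyVanishes (G.ι ⋙ I.J ⋙ groupRingModule (ZMod p) G.Γ) ∧
      ¬ ReducedCohomologyVanishes (I.J ⋙ groupRingModule (ZMod p) G.Γ) := by
  have := G.finite
  have : Fintype S := Fintype.ofFinite S
  exact ⟨I.reducedCohomologyVanishes_ι_groupRing hf,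
    fun h' => h (I.isModPAcyclic (I.reducedCohomologyVanishes_funRep hf h'))⟩

end PLocalFiniteGroup.Inclusions

/-! ### Sylow subgroups of subgroups -/

section SylowIn

variable {K : Type} [Group K]

/-- The conjugate `g H g⁻¹`. -/
def conjSubgroup (g : K) (H : Subgroup K) : Subgroup K := H.map (MulAut.conj g).toMonoidHom

lemma mem_conjSubgroup {g x : K} {H : Subgroup K} : x ∈ conjSubgroup g H ↔ g⁻¹ * x * g ∈ H := by
  constructor
  · rintro ⟨y, hy, rfl⟩
    simpa [mul_assoc] using hy
  · intro h
    exact ⟨_, h, by simp [mul_assoc]⟩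

lemma conj_mem_conjSubgroup {g x : K} {H : Subgroup K} (h : x ∈ H) :
    g * x * g⁻¹ ∈ conjSubgroup g H := ⟨x, h, rfl⟩

lemma conjSubgroup_conjSubgroup (g h : K) (H : Subgroup K) :
    conjSubgroup g (conjSubgroup h H) = conjSubgroup (g * h) H := by
  ext x
  simp only [mem_conjSubgroup, mul_inv_rev, mul_assoc]

lemma conjSubgroup_one (H : Subgroup K) : conjSubgroup 1 H = H := by
  ext x
  simp [mem_conjSubgroup]

lemma conjSubgroup_inv_conjSubgroup (g : K) (H : Subgroup K) :
    conjSubgroup g⁻¹ (conjSubgroup g H) = H := by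
  rw [conjSubgroup_conjSubgroup, inv_mul_cancel, conjSubgroup_one]

lemma conjSubgroup_mono (g : K) {H H' : Subgroup K} (h : H ≤ H') :
    conjSubgroup g H ≤ conjSubgroup g H' := Subgroup.map_mono h

lemma card_conjSubgroup (g : K) (H : Subgroup K) : Nat.card (conjSubgroup g H) = Nat.card H :=
  (Nat.card_congr (H.equivMapOfInjective _ (MulAut.conj g).injective).toEquiv).symm

lemma isPGroup_conjSubgroup {p : ℕ} (g : K) {H : Subgroup K} (h : IsPGroup p H) :
    IsPGroup p (conjSubgroup g H) := h.map _

lemma conj_mem_normalizer {g x : K} {H : Subgroup K} (h : x ∈ Subgroup.normalizer (H : Set K)) :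
    g * x * g⁻¹ ∈ Subgroup.normalizer (conjSubgroup g H : Set K) := by
  rw [Subgroup.mem_normalizer_iff] at h ⊢
  intro y
  have := h (g⁻¹ * y * g)
  simp only [mem_conjSubgroup] at this ⊢
  rw [this]
  simp only [mul_inv_rev, inv_inv, mul_assoc, inv_mul_cancel_left, inv_mul_cancel, mul_one]

lemma conj_mem_centralizer {g x : K} {H : Subgroup K}
    (h : x ∈ Subgroup.centralizer (H : Set K)) :
    g * x * g⁻¹ ∈ Subgroup.centralizer (conjSubgroup g H : Set K) := by
  rw [Subgroup.mem_centralizer_iff] at h ⊢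
  rintro _ ⟨y, hy, rfl⟩
  have := h y hy
  simp only [MulEquiv.coe_toMonoidHom, MulAut.conj_apply]
  calc g * y * g⁻¹ * (g * x * g⁻¹) = g * (y * x) * g⁻¹ := by group
    _ = _ := by rw [this]; group

/-- `T` is a Sylow `p`-subgroup of the subgroup `H`. -/
structure IsSylowIn (p : ℕ) (T H : Subgroup K) : Prop where
  le : T ≤ H
  isPGroup : IsPGroup p T
  eq_of_le : ∀ Q ≤ H, IsPGroup p Q → T ≤ Q → Q = T

variable {p : ℕ}

lemma isSylowIn_iff_sylow {T H : Subgroup K} :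
    IsSylowIn p T H ↔ ∃ P : Sylow p H, (P : Subgroup H).map H.subtype = T := by
  constructor
  · intro h
    refine ⟨{ toSubgroup := T.subgroupOf H
              isPGroup' := h.isPGroup.comap_of_injective _ Subtype.val_injective
              is_maximal' := fun {Q} hQ hle => ?_ }, ?_⟩
    · have h₁ := h.eq_of_le (Q.map H.subtype) (Subgroup.map_subtype_le Q) (hQ.map _) (by
        rw [← Subgroup.map_subgroupOf_eq_of_le h.le]
        exact Subgroup.map_mono hle)
      rw [← h₁]
      exact (Subgroup.comap_map_eq_self_of_injective Subtype.val_injective Q).symm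
    · exact Subgroup.map_subgroupOf_eq_of_le h.le
  · rintro ⟨P, rfl⟩
    refine ⟨Subgroup.map_subtype_le _, P.isPGroup'.map _, fun Q hQ hp hle => ?_⟩
    have h₁ := P.is_maximal' (Q := Q.subgroupOf H)
      (hp.comap_of_injective _ Subtype.val_injective) (fun x hx => hle ⟨x, hx, rfl⟩)
    rw [← h₁, Subgroup.map_subgroupOf_eq_of_le hQ]

lemma IsPGroup.exists_isSylowIn {Q H : Subgroup K} (hQ : IsPGroup p Q) (hle : Q ≤ H) :
    ∃ T, IsSylowIn p T H ∧ Q ≤ T := by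
  obtain ⟨P, hP⟩ := (hQ.comap_of_injective H.subtype Subtype.val_injective).exists_le_sylow
  exact ⟨_, isSylowIn_iff_sylow.2 ⟨P, rfl⟩, fun x hx => ⟨⟨x, hle hx⟩, hP hx, rfl⟩⟩

variable [Fact p.Prime] [Finite K]

lemma IsSylowIn.exists_conj {T H Q : Subgroup K} (hT : IsSylowIn p T H) (hQ : IsPGroup p Q)
    (hle : Q ≤ H) : ∃ h ∈ H, conjSubgroup h Q ≤ T := by
  obtain ⟨P, rfl⟩ := isSylowIn_iff_sylow.1 hT
  obtain ⟨P', hP'⟩ := (hQ.comap_of_injective H.subtype Subtype.val_injective).exists_le_sylow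
  obtain ⟨h, rfl⟩ := MulAction.exists_smul_eq H P' P
  refine ⟨h, h.2, ?_⟩
  rintro _ ⟨x, hx, rfl⟩
  refine ⟨h * ⟨x, hle hx⟩ * h⁻¹, ?_, rfl⟩
  exact ⟨⟨x, hle hx⟩, hP' hx, rfl⟩

lemma IsSylowIn.card_le {T H Q : Subgroup K} (hT : IsSylowIn p T H) (hQ : IsPGroup p Q)
    (hle : Q ≤ H) : Nat.card Q ≤ Nat.card T := by
  obtain ⟨h, -, hh⟩ := hT.exists_conj hQ hle
  rw [← card_conjSubgroup h Q]
  exact Subgroup.card_le_of_le hh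

lemma IsSylowIn.of_card_le {T T' H : Subgroup K} (hT : IsSylowIn p T H) (hp : IsPGroup p T')
    (hle : T' ≤ H) (h : Nat.card T ≤ Nat.card T') : IsSylowIn p T' H :=
  ⟨hle, hp, fun _ hQ hQp hTQ =>
    (Subgroup.eq_of_le_of_card_ge hTQ ((hT.card_le hQp hQ).trans h)).symm⟩

/-- A Sylow subgroup of `N` can be conjugated into `T` inside `H`; by normality it stays in `N`, so
T ∩ N is large enough. -/
lemma IsSylowIn.inf {T H N : Subgroup K} (hT : IsSylowIn p T H) (hN : N ≤ H)
    (hnorm : ∀ h ∈ H, conjSubgroup h N ≤ N) : IsSylowIn p (T ⊓ N) N := by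
  obtain ⟨T₀, hT₀, -⟩ := (IsPGroup.of_bot (p := p) (G := K)).exists_isSylowIn (bot_le (a := N))
  obtain ⟨h, hh, hle⟩ := hT.exists_conj hT₀.isPGroup (hT₀.le.trans hN)
  refine hT₀.of_card_le (hT.isPGroup.to_le inf_le_left) inf_le_right ?_
  rw [← card_conjSubgroup h T₀]
  exact Subgroup.card_le_of_le (le_inf hle ((conjSubgroup_mono h hT₀.le).trans (hnorm h hh)))

end SylowIn

/-! ### The fusion system of a finite group -/

namespace GroupFusion

variable {K : Type} [Group K] {S : Subgroup K}

/-- A subgroup of `S` as a subgroup of the ambient group. -/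
def amb (P : Subgroup S) : Subgroup K := P.map S.subtype

lemma amb_le (P : Subgroup S) : amb P ≤ S := Subgroup.map_subtype_le P

lemma coe_mem_amb {P : Subgroup S} {x : S} : (x : K) ∈ amb P ↔ x ∈ P :=
  ⟨fun ⟨_, hy, hyx⟩ => Subtype.ext hyx ▸ hy, fun h => ⟨x, h, rfl⟩⟩

lemma exists_amb_eq {H : Subgroup K} (h : H ≤ S) : ∃ P : Subgroup S, amb P = H :=
  ⟨H.subgroupOf S, Subgroup.map_subgroupOf_eq_of_le h⟩

lemma card_amb (P : Subgroup S) : Nat.card (amb P) = Nat.card P :=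
  (Nat.card_congr (P.equivMapOfInjective _ Subtype.val_injective).toEquiv).symm

lemma amb_normalizer (P : Subgroup S) :
    amb (Subgroup.normalizer (P : Set S)) = S ⊓ Subgroup.normalizer (amb P : Set K) := by
  ext x
  constructor
  · rintro ⟨y, hy, rfl⟩
    refine ⟨y.2, ?_⟩
    rw [SetLike.mem_coe, Subgroup.mem_normalizer_iff] at hy
    change (y : K) ∈ Subgroup.normalizer _
    rw [Subgroup.mem_normalizer_iff]
    intro h
    constructor
    · rintro ⟨z, hz, rfl⟩
      exact ⟨y * z * y⁻¹, (hy z).1 hz, rfl⟩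
    · rintro ⟨z, hz, hzh⟩
      refine ⟨y⁻¹ * z * y, (hy _).2 (by simpa [mul_assoc] using hz), ?_⟩
      have : (z : K) = y * h * (y : K)⁻¹ := hzh
      simp [this, mul_assoc]
  · rintro ⟨hxS, hx⟩
    refine ⟨⟨x, hxS⟩, ?_, rfl⟩
    have hx : x ∈ Subgroup.normalizer (amb P : Set K) := hx
    rw [SetLike.mem_coe, Subgroup.mem_normalizer_iff]
    rw [Subgroup.mem_normalizer_iff] at hx
    intro h
    have := hx h
    rw [← coe_mem_amb, ← coe_mem_amb]
    exact this

lemma amb_centralizer (P : Subgroup S) :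
    amb (Subgroup.centralizer (P : Set S)) = S ⊓ Subgroup.centralizer (amb P : Set K) := by
  ext x
  constructor
  · rintro ⟨y, hy, rfl⟩
    refine ⟨y.2, ?_⟩
    rintro _ ⟨z, hz, rfl⟩
    exact congrArg Subtype.val (hy z hz)
  · rintro ⟨hxS, hx⟩
    exact ⟨⟨x, hxS⟩, fun z hz => Subtype.ext (hx z ⟨z, hz, rfl⟩), rfl⟩

/-- The homomorphism given by conjugation by an element of the ambient group. -/
def conjHom {P Q : Subgroup S} (g : K) (h : ∀ x ∈ amb P, g * x * g⁻¹ ∈ amb Q) : P →* Q where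
  toFun x := ⟨⟨g * x * g⁻¹, amb_le Q (h x ⟨x, x.2, rfl⟩)⟩, coe_mem_amb.1 (h x ⟨x, x.2, rfl⟩)⟩
  map_one' := Subtype.ext (Subtype.ext (by simp))
  map_mul' x y := Subtype.ext (Subtype.ext (by simp))

@[simp]
lemma conjHom_coe {P Q : Subgroup S} (g : K) (h : ∀ x ∈ amb P, g * x * g⁻¹ ∈ amb Q) (x : P) :
    ((conjHom g h x : S) : K) = g * x * g⁻¹ := rfl

variable (S) in
/-- The fusion system of the ambient group over `S`. -/
def fusion : FusionSystem S where
  Hom P Q := {φ | ∃ g : K, ∀ x : P, ((φ x : S) : K) = g * x * g⁻¹}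
  id_mem _ := ⟨1, fun x => by simp⟩
  comp_mem {P Q R φ ψ} := by
    rintro ⟨g, hg⟩ ⟨h, hh⟩
    exact ⟨h * g, fun x => by simp [hh, hg, mul_assoc]⟩
  conj_mem φ g h := ⟨g, fun x => by rw [h]; rfl⟩
  injective {P Q φ} := by
    rintro ⟨g, hg⟩ x y hxy
    have : g * (x : K) * g⁻¹ = g * y * g⁻¹ := by rw [← hg, ← hg, hxy]
    exact Subtype.ext (Subtype.ext (mul_left_cancel (mul_right_cancel this)))
  factor {P Q φ} := by
    rintro ⟨g, hg⟩
    have hinj : Function.Injective (Q.subtype.comp φ) := by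
      intro x y hxy
      have : g * (x : K) * g⁻¹ = g * y * g⁻¹ := by
        rw [← hg, ← hg]
        exact congrArg Subtype.val hxy
      exact Subtype.ext (Subtype.ext (mul_left_cancel (mul_right_cancel this)))
    refine ⟨(Q.subtype.comp φ).range, ?_, MonoidHom.ofInjective hinj, ⟨g, hg⟩, ⟨g⁻¹, ?_⟩, ?_⟩
    · rintro _ ⟨x, rfl⟩
      exact (φ x).2
    · intro y
      obtain ⟨x, rfl⟩ := (MonoidHom.ofInjective hinj).surjective y
      have h₁ : (((MonoidHom.ofInjective hinj x : (Q.subtype.comp φ).range) : S) : K) =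
        g * x * g⁻¹ := hg x
      change (((MonoidHom.ofInjective hinj).symm (MonoidHom.ofInjective hinj x) : S) : K) = _
      rw [MulEquiv.symm_apply_apply, h₁]
      group
    · rfl

lemma isConj_iff {P Q : Subgroup S} :
    (fusion S).IsConj P Q ↔ ∃ g : K, amb Q = conjSubgroup g (amb P) := by
  constructor
  · rintro ⟨e, ⟨g, hg⟩, -⟩
    refine ⟨g, ?_⟩
    ext x
    constructor
    · rintro ⟨y, hy, rfl⟩
      refine ⟨(e.symm ⟨y, hy⟩ : S), ⟨_, (e.symm ⟨y, hy⟩).2, rfl⟩, ?_⟩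
      have := hg (e.symm ⟨y, hy⟩)
      simp only [MulEquiv.coe_toMonoidHom, MulEquiv.apply_symm_apply] at this
      exact this.symm
    · rintro ⟨_, ⟨y, hy, rfl⟩, rfl⟩
      exact ⟨(e ⟨y, hy⟩ : S), (e ⟨y, hy⟩).2, hg ⟨y, hy⟩⟩
  · rintro ⟨g, hg⟩
    have h₁ : ∀ x ∈ amb P, g * x * g⁻¹ ∈ amb Q := fun x hx => by
      rw [hg]; exact conj_mem_conjSubgroup hx
    have h₂ : ∀ x ∈ amb Q, g⁻¹ * x * g⁻¹⁻¹ ∈ amb P := fun x hx => by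
      rw [hg, mem_conjSubgroup] at hx
      rwa [inv_inv]
    refine ⟨(conjHom g h₁).toMulEquiv (conjHom g⁻¹ h₂) ?_ ?_, ⟨g, fun _ => rfl⟩,
      ⟨g⁻¹, fun _ => rfl⟩⟩
    · ext x
      simp [mul_assoc]
    · ext x
      simp [mul_assoc]

lemma isPGroup_amb {p : ℕ} (hS : IsSylowIn p S ⊤) (P : Subgroup S) : IsPGroup p (amb P) :=
  hS.isPGroup.to_le (amb_le P)

lemma conj_mem_centralizer_of_mem_normalizer {H : Subgroup K} {g x : K}
    (hg : g ∈ Subgroup.normalizer (H : Set K)) (hx : x ∈ Subgroup.centralizer (H : Set K)) :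
    g * x * g⁻¹ ∈ Subgroup.centralizer (H : Set K) := by
  have h : conjSubgroup g H = H := by
    ext y
    rw [mem_conjSubgroup]
    have := Subgroup.mem_normalizer_iff.1 (inv_mem hg) y
    rw [inv_inv] at this
    exact this.symm
  have := conj_mem_centralizer (g := g) hx
  rwa [h] at this

/-- The action of the normalizer by automorphisms of the fusion system. -/
def autHom (P : Subgroup S) : Subgroup.normalizer (amb P : Set K) →* (fusion S).aut P where
  toFun n := ⟨(conjHom (n : K) fun x hx => (Subgroup.mem_normalizer_iff.1 n.2 x).1 hx).toMulEquiv
    (conjHom (n : K)⁻¹ fun x hx => (Subgroup.mem_normalizer_iff.1 (inv_mem n.2) x).1 hx)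
    (by ext x; simp [mul_assoc]) (by ext x; simp [mul_assoc]),
    ⟨n, fun _ => rfl⟩, ⟨(n : K)⁻¹, fun _ => rfl⟩⟩
  map_one' := Subtype.ext (MulEquiv.ext fun x => Subtype.ext (Subtype.ext (by
    change ((1 : K) * _ * (1 : K)⁻¹) = _
    simp)))
  map_mul' m n := Subtype.ext (MulEquiv.ext fun x => Subtype.ext (Subtype.ext (by
    change ((m : K) * n) * (x : K) * ((m : K) * n)⁻¹ = m * (n * x * (n : K)⁻¹) * (m : K)⁻¹
    group)))

lemma autHom_coe (P : Subgroup S) (n : Subgroup.normalizer (amb P : Set K)) (x : P) :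
    ((((autHom P n : (fusion S).aut P) : MulAut P) x : S) : K) = n * x * (n : K)⁻¹ := rfl

lemma autHom_surjective (P : Subgroup S) : Function.Surjective (autHom P) := by
  rintro ⟨e, ⟨g, hg⟩, he⟩
  have hmem : g ∈ Subgroup.normalizer (amb P : Set K) := by
    rw [Subgroup.mem_normalizer_iff]
    intro x
    constructor
    · rintro ⟨y, hy, rfl⟩
      exact ⟨(e ⟨y, hy⟩ : S), (e ⟨y, hy⟩).2, hg ⟨y, hy⟩⟩
    · rintro ⟨y, hy, hyx⟩
      have h₁ := hg (e.symm ⟨y, hy⟩)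
      simp only [MulEquiv.coe_toMonoidHom, MulEquiv.apply_symm_apply] at h₁
      have h₂ : (y : K) = g * x * g⁻¹ := hyx
      rw [h₂] at h₁
      have h₃ := mul_left_cancel (mul_right_cancel h₁)
      rw [h₃]
      exact ⟨_, (e.symm ⟨y, hy⟩).2, rfl⟩
  exact ⟨⟨g, hmem⟩, Subtype.ext (MulEquiv.ext fun x => Subtype.ext (Subtype.ext (hg x).symm))⟩

/-- `N_S(P) C_K(P)`. -/
def normalizerMulCentralizer (P : Subgroup S) : Subgroup K where
  carrier := {x | ∃ y ∈ S ⊓ Subgroup.normalizer (amb P : Set K),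
    ∃ c ∈ Subgroup.centralizer (amb P : Set K), x = y * c}
  one_mem' := ⟨1, one_mem _, 1, one_mem _, (mul_one 1).symm⟩
  mul_mem' := by
    rintro _ _ ⟨y, hy, c, hc, rfl⟩ ⟨y', hy', c', hc', rfl⟩
    refine ⟨y * y', mul_mem hy hy', y'⁻¹ * c * y' * c', mul_mem ?_ hc', by group⟩
    simpa using conj_mem_centralizer_of_mem_normalizer (inv_mem hy'.2) hc
  inv_mem' := by
    rintro _ ⟨y, hy, c, hc, rfl⟩
    exact ⟨y⁻¹, inv_mem hy, y * c⁻¹ * y⁻¹,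
      conj_mem_centralizer_of_mem_normalizer hy.2 (inv_mem hc), by group⟩

variable {p : ℕ} [Fact p.Prime] [Finite K]

/-- A `p`-subgroup that contains `P` can be conjugated into `S`. -/
lemma exists_isConj_of_le (hS : IsSylowIn p S ⊤) (P : Subgroup S) {T : Subgroup K}
    (hT : IsPGroup p T) (hP : amb P ≤ T) :
    ∃ (g : K) (P' : Subgroup S), (fusion S).IsConj P P' ∧ amb P' = conjSubgroup g (amb P) ∧
      conjSubgroup g T ≤ S := by
  obtain ⟨g, -, hg⟩ := hS.exists_conj hT le_top
  obtain ⟨P', hP'⟩ := exists_amb_eq ((conjSubgroup_mono g hP).trans hg)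
  exact ⟨g, P', isConj_iff.2 ⟨g, hP'⟩, hP', hg⟩

/-- A Sylow subgroup of N_K(P) containing `P`, once conjugated into `S`, normalizes a conjugate P' ≤
S. Its order is therefore at most |N_S(P')| ≤ |N_S(P)|. -/
lemma isSylowIn_normalizer (hS : IsSylowIn p S ⊤) {P : Subgroup S}
    (hP : (fusion S).FullyNormalized P) :
    IsSylowIn p (S ⊓ Subgroup.normalizer (amb P : Set K))
      (Subgroup.normalizer (amb P : Set K)) := by
  obtain ⟨T, hT, hPT⟩ := (isPGroup_amb hS P).exists_isSylowIn Subgroup.le_normalizer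
  obtain ⟨g, P', hconj, hP', hg⟩ := exists_isConj_of_le hS P hT.isPGroup hPT
  refine hT.of_card_le (hS.isPGroup.to_le inf_le_left) inf_le_right ?_
  have h₁ := hP P' hconj
  rw [← card_amb, ← card_amb (Subgroup.normalizer (P : Set S)), amb_normalizer,
    amb_normalizer] at h₁
  refine le_trans ?_ h₁
  rw [← card_conjSubgroup g T]
  refine Subgroup.card_le_of_le (le_inf hg ?_)
  rintro _ ⟨t, ht, rfl⟩
  rw [hP']
  exact conj_mem_normalizer (hT.le ht)

/-- As for normalizers, but a Sylow subgroup `T` of C_K(P) need not contain `P`; the p-group TP is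
conjugated into `S` instead. -/
lemma isSylowIn_centralizer (hS : IsSylowIn p S ⊤) {P : Subgroup S}
    (hP : (fusion S).FullyCentralized P) :
    IsSylowIn p (S ⊓ Subgroup.centralizer (amb P : Set K))
      (Subgroup.centralizer (amb P : Set K)) := by
  obtain ⟨T, hT, -⟩ := (IsPGroup.of_bot (p := p) (G := K)).exists_isSylowIn
    (bot_le (a := Subgroup.centralizer (amb P : Set K)))
  have hsup : IsPGroup p (T ⊔ amb P : Subgroup K) :=
    hT.isPGroup.to_sup_of_normal_right' (isPGroup_amb hS P)
      (hT.le.trans (Subgroup.centralizer_le_normalizer _))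
  obtain ⟨g, P', hconj, hP', hg⟩ := exists_isConj_of_le hS P hsup le_sup_right
  refine hT.of_card_le (hS.isPGroup.to_le inf_le_left) inf_le_right ?_
  have h₁ := hP P' hconj
  rw [← card_amb, ← card_amb (Subgroup.centralizer (P : Set S)), amb_centralizer,
    amb_centralizer] at h₁
  refine le_trans ?_ h₁
  rw [← card_conjSubgroup g T]
  refine Subgroup.card_le_of_le (le_inf ((conjSubgroup_mono g le_sup_left).trans hg) ?_)
  rintro _ ⟨t, ht, rfl⟩
  rw [hP']
  exact conj_mem_centralizer (hT.le ht)

lemma fullyCentralized_of_fullyNormalized (hS : IsSylowIn p S ⊤) {P : Subgroup S}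
    (hP : (fusion S).FullyNormalized P) : (fusion S).FullyCentralized P := by
  have h₁ := (isSylowIn_normalizer hS hP).inf (Subgroup.centralizer_le_normalizer _) (by
    rintro h hh _ ⟨x, hx, rfl⟩
    exact conj_mem_centralizer_of_mem_normalizer hh hx)
  intro P' hconj
  obtain ⟨g, hg⟩ := isConj_iff.1 hconj
  rw [← card_amb, ← card_amb (Subgroup.centralizer (P : Set S)), amb_centralizer, amb_centralizer,
    ← card_conjSubgroup g⁻¹]
  refine (h₁.card_le (isPGroup_conjSubgroup _ (hS.isPGroup.to_le inf_le_left)) ?_).trans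
    (Subgroup.card_le_of_le (inf_le_inf_right _ inf_le_left))
  rintro _ ⟨x, hx, rfl⟩
  have := conj_mem_centralizer (g := g⁻¹) hx.2
  rw [hg, conjSubgroup_inv_conjSubgroup] at this
  exact this

/-- Aut_F(P) is a quotient of N_K(P), and a surjection carries the Sylow subgroup N_S(P) to a Sylow
subgroup. -/
lemma exists_sylow_aut (hS : IsSylowIn p S ⊤) {P : Subgroup S}
    (hP : (fusion S).FullyNormalized P) :
    ∃ T : Sylow p ((fusion S).aut P), (T : Subgroup ((fusion S).aut P)) =
      (autS P).subgroupOf ((fusion S).aut P) := by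
  obtain ⟨Q, hQ⟩ := isSylowIn_iff_sylow.1 (isSylowIn_normalizer hS hP)
  refine ⟨Q.mapSurjective (autHom_surjective P), ?_⟩
  rw [Sylow.coe_mapSurjective]
  have hQ' : ∀ n : Subgroup.normalizer (amb P : Set K), n ∈ (Q : Subgroup _) ↔ (n : K) ∈ S := by
    intro n
    constructor
    · intro hn
      have : (n : K) ∈ S ⊓ Subgroup.normalizer (amb P : Set K) := hQ ▸ ⟨n, hn, rfl⟩
      exact this.1
    · intro hn
      have : (n : K) ∈ S ⊓ Subgroup.normalizer (amb P : Set K) := ⟨hn, n.2⟩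
      rw [← hQ] at this
      obtain ⟨m, hm, hmn⟩ := this
      rwa [← Subtype.ext hmn]
  ext e
  rw [Subgroup.mem_subgroupOf]
  constructor
  · rintro ⟨n, hn, rfl⟩
    have hnS := (hQ' n).1 hn
    have : (n : K) ∈ amb (Subgroup.normalizer (P : Set S)) := by
      rw [amb_normalizer]
      exact ⟨hnS, n.2⟩
    obtain ⟨y, hy, hyn⟩ := this
    refine ⟨⟨y, hy⟩, MulEquiv.ext fun x => Subtype.ext (Subtype.ext ?_)⟩
    rw [autHom_coe, ← hyn]
    rfl
  · rintro ⟨y, hy⟩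
    have : ((y : S) : K) ∈ S ⊓ Subgroup.normalizer (amb P : Set K) := by
      rw [← amb_normalizer]
      exact ⟨y, y.2, rfl⟩
    refine ⟨⟨(y : S), this.2⟩, (hQ' _).2 this.1, Subtype.ext ?_⟩
    rw [← hy]
    rfl

/-- A larger p-subgroup would contain, modulo N_S(P), new elements of C_K(P), although C_S(P) is
already Sylow there. -/
lemma isSylowIn_normalizerMulCentralizer (hS : IsSylowIn p S ⊤) {P : Subgroup S}
    (hP : (fusion S).FullyCentralized P) :
    IsSylowIn p (S ⊓ Subgroup.normalizer (amb P : Set K)) (normalizerMulCentralizer P) := by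
  refine ⟨fun x hx => ⟨x, hx, 1, one_mem _, (mul_one x).symm⟩, hS.isPGroup.to_le inf_le_left,
    fun Q hQ hQp hle => le_antisymm (fun q hq => ?_) hle⟩
  obtain ⟨y, hy, c, hc, rfl⟩ := hQ hq
  have hcQ : c ∈ Q := by
    have := mul_mem (inv_mem (hle hy)) hq
    rwa [inv_mul_cancel_left] at this
  have heq := (isSylowIn_centralizer hS hP).eq_of_le (Q ⊓ Subgroup.centralizer (amb P : Set K))
    inf_le_right (hQp.to_le inf_le_left) (fun x hx =>
      ⟨hle ⟨hx.1, Subgroup.centralizer_le_normalizer _ hx.2⟩, hx.2⟩)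
  have : c ∈ S ⊓ Subgroup.centralizer (amb P : Set K) := heq ▸ ⟨hcQ, hc⟩
  exact mul_mem hy ⟨this.1, Subgroup.centralizer_le_normalizer _ hc⟩

lemma exists_extension (hS : IsSylowIn p S ⊤) (P P' : Subgroup S) (φ : P ≃* P')
    (hφ : (fusion S).IsIsoIn φ) (hP' : (fusion S).FullyCentralized P') :
    ∃ ψ ∈ (fusion S).Hom (FusionSystem.extensionSubgroup φ) ⊤,
      ∀ (x : FusionSystem.extensionSubgroup φ) (hx : (x : S) ∈ P), (ψ x : S) = φ ⟨x, hx⟩ := by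
  obtain ⟨⟨g, hg⟩, -⟩ := hφ
  have hle : conjSubgroup g (amb (FusionSystem.extensionSubgroup φ)) ≤
      normalizerMulCentralizer P' := by
    rintro _ ⟨_, ⟨_, ⟨n, ⟨w, hw⟩, rfl⟩, rfl⟩, rfl⟩
    have hwm : ((w : S) : K) ∈ S ⊓ Subgroup.normalizer (amb P' : Set K) := by
      rw [← amb_normalizer]
      exact ⟨w, w.2, rfl⟩
    refine ⟨(w : S), hwm, ((w : S) : K)⁻¹ * (g * (n : S) * g⁻¹), ?_, by simp⟩
    rw [Subgroup.mem_centralizer_iff]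
    rintro _ ⟨x, hx, rfl⟩
    obtain ⟨⟨y, hy⟩, hyx⟩ := φ.surjective ⟨x, hx⟩
    have h₁ := congrArg (fun e : MulAut P' => ((e (φ ⟨y, hy⟩) : S) : K)) hw
    have h₂ : ((((MulAut.congr φ).toMonoidHom (P.normalizerMonoidHom n)) (φ ⟨y, hy⟩) : S) : K) =
        g * (n * y * (n : K)⁻¹) * g⁻¹ := by
      change ((φ (P.normalizerMonoidHom n (φ.symm (φ ⟨y, hy⟩))) : S) : K) = _
      rw [MulEquiv.symm_apply_apply]
      exact hg _
    have h₃ : ((φ ⟨y, hy⟩ : S) : K) = g * y * g⁻¹ := hg ⟨y, hy⟩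
    have h₄ : (w : K) * ((φ ⟨y, hy⟩ : S) : K) * (w : K)⁻¹ = g * (n * y * (n : K)⁻¹) * g⁻¹ :=
      h₁.trans h₂
    have h₅ : (x : K) = g * y * g⁻¹ := by rw [← h₃, hyx]
    rw [h₃] at h₄
    change (x : K) * _ = _ * (x : K)
    rw [h₅]
    have h₆ : g * y * g⁻¹ = (w : K)⁻¹ * (g * (n * y * (n : K)⁻¹) * g⁻¹) * w := by
      rw [← h₄]; group
    calc g * y * g⁻¹ * ((w : K)⁻¹ * (g * n * g⁻¹))
        = ((w : K)⁻¹ * (g * (n * y * (n : K)⁻¹) * g⁻¹) * w) * ((w : K)⁻¹ * (g * n * g⁻¹)) := by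
          rw [← h₆]
      _ = _ := by group
  -- Sylow's theorem conjugates g N_φ g⁻¹ into N_S(P') by some h = yc. The factor y ∈ S can be
  -- dropped, and c centralizes P', so conjugation by cg maps N_φ into `S` and still extends φ.
  obtain ⟨h, ⟨y, hy, c, hc, rfl⟩, hh⟩ := (isSylowIn_normalizerMulCentralizer hS hP').exists_conj
    (isPGroup_conjSubgroup g (isPGroup_amb hS (FusionSystem.extensionSubgroup φ))) hle
  have hmem : ∀ x ∈ amb (FusionSystem.extensionSubgroup φ),
      (c * g) * x * (c * g)⁻¹ ∈ amb (⊤ : Subgroup S) := by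
    intro x hx
    have h₁ : _ ∈ S := (hh (conj_mem_conjSubgroup (conj_mem_conjSubgroup (g := g) hx))).1
    have h₂ : c * g * x * (c * g)⁻¹ ∈ S := by
      have := mul_mem (mul_mem (S.inv_mem hy.1) h₁) hy.1
      convert this using 1
      group
    exact ⟨⟨_, h₂⟩, trivial, rfl⟩
  refine ⟨conjHom (c * g) hmem, ⟨c * g, fun _ => rfl⟩, fun x hx => Subtype.ext ?_⟩
  have h₁ : ((φ ⟨x, hx⟩ : S) : K) = g * x * g⁻¹ := hg ⟨x, hx⟩
  have h₂ := hc _ ⟨(φ ⟨x, hx⟩ : S), (φ ⟨x, hx⟩).2, rfl⟩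
  change (c * g) * (x : K) * (c * g)⁻¹ = _
  have h₃ : ((φ ⟨x, hx⟩ : S) : K) * c = c * ((φ ⟨x, hx⟩ : S) : K) := h₂
  rw [h₁] at h₃ ⊢
  calc c * g * (x : K) * (c * g)⁻¹ = (c * (g * x * g⁻¹)) * c⁻¹ := by group
    _ = _ := by rw [← h₃]; group

/-- The fusion system of a finite group over a Sylow subgroup is saturated. -/
theorem isSaturated (hS : IsSylowIn p S ⊤) : (fusion S).IsSaturated p where
  fullyNormalized _ hP := ⟨fullyCentralized_of_fullyNormalized hS hP, exists_sylow_aut hS hP⟩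
  extend := exists_extension hS

end GroupFusion

namespace GroupFusion

/-! ### The transporter linking system -/

variable {K : Type} [Group K] {S : Subgroup K}

lemma centralizer_le_of_isCentric
    (hC : ∀ H ≤ S, S ⊓ Subgroup.centralizer (H : Set K) ≤ H → Subgroup.centralizer (H : Set K) ≤ H)
    {P : Subgroup S} (hP : (fusion S).IsCentric P) :
    Subgroup.centralizer (amb P : Set K) ≤ amb P := by
  refine hC _ (amb_le P) ?_
  rw [← amb_centralizer, hP P ⟨MulEquiv.refl _, (fusion S).id_mem _, (fusion S).id_mem _⟩]
  rintro _ ⟨_, ⟨x, -, rfl⟩, rfl⟩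
  exact ⟨x, x.2, rfl⟩

lemma isCentric_of_centralizer_le {P : Subgroup S}
    (hP : Subgroup.centralizer (amb P : Set K) ≤ amb P) : (fusion S).IsCentric P := by
  intro P' hconj
  obtain ⟨g, hg⟩ := isConj_iff.1 hconj
  ext x
  constructor
  · intro hx
    have hx' : (x : K) ∈ Subgroup.centralizer (amb P' : Set K) := by
      have : (x : K) ∈ amb (Subgroup.centralizer (P' : Set S)) := ⟨x, hx, rfl⟩
      rw [amb_centralizer] at this
      exact this.2
    have hxP : x ∈ P' := by
      rw [← coe_mem_amb, hg, mem_conjSubgroup]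
      have := conj_mem_centralizer (g := g⁻¹) hx'
      rw [hg, conjSubgroup_inv_conjSubgroup, inv_inv] at this
      exact hP this
    refine ⟨⟨x, hxP⟩, ?_, rfl⟩
    rw [SetLike.mem_coe, Subgroup.mem_center_iff]
    exact fun y => Subtype.ext (hx y y.2)
  · rintro ⟨z, hz, rfl⟩
    rw [SetLike.mem_coe, Subgroup.mem_center_iff] at hz
    exact fun y hy => congrArg Subtype.val (hz ⟨y, hy⟩)

variable (S) in
/-- The transporter category of the centric subgroups. -/
@[reducible]
def transporterCategory : Category.{0} (fusion S).CentricSubgroup where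
  Hom P Q := {g : K // ∀ x ∈ amb P.1, g * x * g⁻¹ ∈ amb Q.1}
  id P := ⟨1, fun x hx => by simpa using hx⟩
  comp {P Q R} f g := ⟨g.1 * f.1, fun x hx => by
    have := g.2 _ (f.2 x hx)
    convert this using 1
    group⟩
  id_comp f := Subtype.ext (mul_one _)
  comp_id f := Subtype.ext (one_mul _)
  assoc f g h := Subtype.ext (mul_assoc _ _ _).symm

variable (S) in
/-- The transporter category is a centric linking system if the centralizers in the ambient group
of the centric subgroups are as small as possible. -/
def linking
    (hC : ∀ H ≤ S, S ⊓ Subgroup.centralizer (H : Set K) ≤ H → Subgroup.centralizer (H : Set K) ≤ H) :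
    CentricLinkingSystem (fusion S) :=
  letI := transporterCategory S
  { category := transporterCategory S
    π := fun f => conjHom f.1 f.2
    π_mem := fun f => ⟨f.1, fun _ => rfl⟩
    π_id := fun P => MonoidHom.ext fun x => Subtype.ext (Subtype.ext (by
      change (1 : K) * _ * (1 : K)⁻¹ = _
      simp))
    π_comp := fun f g => MonoidHom.ext fun x => Subtype.ext (Subtype.ext (by
      change (g.1 * f.1) * _ * (g.1 * f.1)⁻¹ = g.1 * (f.1 * _ * f.1⁻¹) * g.1⁻¹
      group))
    δ := fun P =>
      { toFun := fun x =>
          { hom := ⟨x, fun y hy => mul_mem (mul_mem ⟨x, x.2, rfl⟩ hy) (inv_mem ⟨x, x.2, rfl⟩)⟩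
            inv := ⟨(x : K)⁻¹, fun y hy => mul_mem (mul_mem (inv_mem ⟨x, x.2, rfl⟩) hy)
              (inv_mem (inv_mem ⟨x, x.2, rfl⟩))⟩
            hom_inv_id := Subtype.ext (inv_mul_cancel (x : K))
            inv_hom_id := Subtype.ext (mul_inv_cancel (x : K)) }
        map_one' := Iso.ext (Subtype.ext rfl)
        map_mul' := fun x y => Iso.ext (Subtype.ext rfl) }
    δ_injective := fun P x y hxy => Subtype.ext (Subtype.ext
      (congrArg (fun e : Aut P => e.hom.1) hxy))
    π_surjective := by
      rintro P Q φ ⟨g, hg⟩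
      refine ⟨⟨g, ?_⟩, MonoidHom.ext fun x => Subtype.ext (Subtype.ext (hg x).symm)⟩
      rintro _ ⟨x, hx, rfl⟩
      exact ⟨(φ ⟨x, hx⟩ : S), (φ ⟨x, hx⟩).2, hg ⟨x, hx⟩⟩
    free := fun {P Q} f z _ h => by
      have h₁ : f.1 * (z : K) = f.1 := congrArg Subtype.val h
      exact Subtype.ext (Subtype.ext (mul_eq_left.1 h₁))
    π_eq_iff := fun {P Q} f g => by
      constructor
      · intro h
        have hmem : f.1⁻¹ * g.1 ∈ Subgroup.centralizer (amb P.1 : Set K) := by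
          rw [Subgroup.mem_centralizer_iff]
          rintro _ ⟨x, hx, rfl⟩
          have h₁ : f.1 * (x : K) * f.1⁻¹ = g.1 * x * g.1⁻¹ :=
            congrArg (fun φ : P.1 →* Q.1 => ((φ ⟨x, hx⟩ : S) : K)) h
          change (x : K) * (f.1⁻¹ * g.1) = f.1⁻¹ * g.1 * x
          calc (x : K) * (f.1⁻¹ * g.1) = f.1⁻¹ * (f.1 * (x : K) * f.1⁻¹) * g.1 := by group
            _ = _ := by rw [h₁]; group
        obtain ⟨z, hz, hzfg⟩ := centralizer_le_of_isCentric hC P.2 hmem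
        refine ⟨⟨z, hz⟩, ?_, Subtype.ext ?_⟩
        · rw [Subgroup.mem_center_iff]
          intro y
          refine Subtype.ext (Subtype.ext ?_)
          have := hmem y ⟨y, y.2, rfl⟩
          rw [← hzfg] at this
          exact this
        · change g.1 = f.1 * (z : K)
          have hzfg : (z : K) = f.1⁻¹ * g.1 := hzfg
          rw [hzfg, mul_inv_cancel_left]
      · rintro ⟨z, hz, rfl⟩
        refine MonoidHom.ext fun x => Subtype.ext (Subtype.ext ?_)
        change f.1 * (x : K) * f.1⁻¹ = (f.1 * (z : K)) * x * (f.1 * z)⁻¹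
        have h₁ : (x : K) * z = z * x := by
          have := Subgroup.mem_center_iff.1 hz x
          exact congrArg (fun y : P.1 => ((y : S) : K)) this
        calc f.1 * (x : K) * f.1⁻¹ = f.1 * ((x : K) * z) * (z : K)⁻¹ * f.1⁻¹ := by group
          _ = _ := by rw [h₁]; group
    π_δ := fun P x y => rfl
    δ_comp := fun {P Q} f x => Subtype.ext (by
      change f.1 * (x : K) = (f.1 * x * f.1⁻¹) * f.1
      group) }

variable {p : ℕ} [Fact p.Prime] [Finite K]

/-- The `p`-local finite group of a finite group in which the centric subgroups of the Sylow
subgroup contain their centralizers. -/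
def pLocal (hS : IsSylowIn p S ⊤)
    (hC : ∀ H ≤ S, S ⊓ Subgroup.centralizer (H : Set K) ≤ H → Subgroup.centralizer (H : Set K) ≤ H) :
    PLocalFiniteGroup p S where
  finite := inferInstance
  isPGroup := hS.isPGroup
  F := fusion S
  saturated := isSaturated hS
  L := linking S hC

section Coefficients

variable (hS : IsSylowIn p S ⊤)
  (hC : ∀ H ≤ S, S ⊓ Subgroup.centralizer (H : Set K) ≤ H → Subgroup.centralizer (H : Set K) ≤ H)

/-- The functor from the linking system to the ambient group. -/
def toGroup : (pLocal hS hC).Link ⥤ SingleObj K where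
  obj _ := SingleObj.star K
  map f := f.1
  map_id _ := rfl
  map_comp _ _ := rfl

variable (R : Type) [CommRing R] (V : Type) [AddCommGroup V] [Module R V]

/-- The functions on the ambient group as a coefficient system on the linking system. -/
def funSystem : (pLocal hS hC).Link ⥤ ModuleCat.{0} R :=
  toGroup hS hC ⋙ (funRep R K V).toFunctor

lemma isLocallyConstantSystem_funSystem : IsLocallyConstantSystem (funSystem hS hC R V) := by
  intro P Q f
  have : IsIso ((toGroup hS hC).map f) :=
    (Groupoid.isoEquivHom (SingleObj.star K) (SingleObj.star K) |>.symm f.1).isIso_hom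
  exact Functor.map_isIso (funRep R K V).toFunctor ((toGroup hS hC).map f)

lemma injective_pi [Injective (ModuleCat.of R V)] (X : Type) :
    Injective (ModuleCat.of R (X → V)) where
  factors {A B} g f _ := by
    let c (x : X) : ModuleCat.of R (X → V) ⟶ ModuleCat.of R V :=
      ModuleCat.ofHom (LinearMap.proj x)
    refine ⟨ModuleCat.ofHom (LinearMap.pi fun x => (Injective.factorThru (g ≫ c x) f).hom), ?_⟩
    refine ModuleCat.hom_ext (LinearMap.ext fun a => funext fun x => ?_)
    have := congrArg (fun φ => φ.hom a) (Injective.comp_factorThru (g ≫ c x) f)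
    exact this

lemma reducedCohomologyVanishes_ι_funSystem [Injective (ModuleCat.of R V)] :
    ReducedCohomologyVanishes ((pLocal hS hC).ι ⋙ funSystem hS hC R V) := by
  have := injective_pi R V K
  have : Fintype S := Fintype.ofFinite S
  have : Injective (Representation.toFunctor ((funRep R K V).comp S.subtype)) :=
    injective_toFunctor _ (hasTraceOne_funRep _ Subtype.val_injective)
  have : Injective ((pLocal hS hC).ι ⋙ funSystem hS hC R V) := this
  exact reducedCohomologyVanishes_of_injective _

end Coefficients

end GroupFusion

namespace GroupFusion

/-! ### A nonzero class of degree one -/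

variable {K : Type} [Group K] {S : Subgroup K} {p : ℕ} [Fact p.Prime] [Finite K]
  (hS : IsSylowIn p S ⊤)
  (hC : ∀ H ≤ S, S ⊓ Subgroup.centralizer (H : Set K) ≤ H → Subgroup.centralizer (H : Set K) ≤ H)

/-- The subgroup of the ambient group given by an object of the covering category. -/
def coverSubgroup (x : Covering.Cover (toGroup hS hC)) : Subgroup K :=
  conjSubgroup (Covering.sheet x)⁻¹ (amb x.1.1)

/-- A morphism (P, a) → (Q, b) is an element f with b = fa and fPf⁻¹ ≤ Q, that is, an inclusion
a⁻¹Pa ≤ b⁻¹Qb. -/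
lemma coverSubgroup_mono {x y : Covering.Cover (toGroup hS hC)} (f : x ⟶ y) :
    coverSubgroup hS hC x ≤ coverSubgroup hS hC y := by
  rintro _ ⟨z, hz, rfl⟩
  rw [coverSubgroup, ← Covering.label_mul_sheet f, mem_conjSubgroup]
  have : f.1.1 * z * f.1.1⁻¹ ∈ amb y.1.1 := f.1.2 z hz
  convert this using 1
  change ((f.1.1 * Covering.sheet x)⁻¹)⁻¹ * ((Covering.sheet x)⁻¹ * z * (Covering.sheet x)⁻¹⁻¹) *
    (f.1.1 * Covering.sheet x)⁻¹ = _
  group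

lemma centralizer_coverSubgroup_le (x : Covering.Cover (toGroup hS hC)) :
    Subgroup.centralizer (coverSubgroup hS hC x : Set K) ≤ coverSubgroup hS hC x := by
  intro z hz
  have h₁ := conj_mem_centralizer (g := Covering.sheet x) hz
  have h₂ : conjSubgroup (Covering.sheet x) (coverSubgroup hS hC x) = amb x.1.1 := by
    rw [coverSubgroup, conjSubgroup_conjSubgroup, mul_inv_cancel, conjSubgroup_one]
  rw [h₂] at h₁
  have h₃ := centralizer_le_of_isCentric hC x.1.2 h₁
  rw [coverSubgroup, mem_conjSubgroup, inv_inv]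
  exact h₃

lemma card_coverSubgroup_le (x : Covering.Cover (toGroup hS hC)) :
    Nat.card (coverSubgroup hS hC x) ≤ Nat.card S := by
  rw [coverSubgroup, card_conjSubgroup]
  exact Subgroup.card_le_of_le (amb_le _)

open Classical in
/-- The indicator of a pair of subgroups. -/
def edgeIndicator {V : Type} [AddCommGroup V] (A S : Subgroup K) (v : V) (X Y : Subgroup K) : V :=
  if X = A ∧ Y = S then v else 0

/-- An object of the covering category that corresponds to the conjugate `w P w⁻¹`. -/
def coverObj {P : Subgroup S} (hP : (fusion S).IsCentric P) (w : K) :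
    Covering.Cover (toGroup hS hC) := ⟨⟨P, hP⟩, (w⁻¹ : K)⟩

lemma coverSubgroup_coverObj {P : Subgroup S} (hP : (fusion S).IsCentric P) (w : K) :
    coverSubgroup hS hC (coverObj hS hC hP w) = conjSubgroup w (amb P) := by
  change conjSubgroup (w⁻¹)⁻¹ (amb P) = _
  rw [inv_inv]

/-- The morphism of the covering category given by an inclusion of subgroups. -/
def coverHom {P Q : Subgroup S} (hP : (fusion S).IsCentric P) (hQ : (fusion S).IsCentric Q)
    (w u : K) (h : ∀ x ∈ amb P, (u⁻¹ * w) * x * (u⁻¹ * w)⁻¹ ∈ amb Q) :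
    coverObj hS hC hP w ⟶ coverObj hS hC hQ u :=
  ⟨⟨u⁻¹ * w, h⟩, by
    change u⁻¹ * w * w⁻¹ = u⁻¹
    group⟩

/-- The hexagon of Sylow subgroups that is spanned by two elements `s` and `t` gives a nonzero
class in degree one. -/
theorem not_reducedCohomologyVanishes_funSystem (R : Type) [CommRing R] (V : Type) [AddCommGroup V]
    [Module R V] [Nontrivial V] {A B : Subgroup K} (hAS : A ≤ S) (hBS : B ≤ S)
    (hA : Subgroup.centralizer (A : Set K) = A) (hB : Subgroup.centralizer (B : Set K) ≤ B)
    (hAB : A ≠ B) (hmax : ∀ Y, A ≤ Y → Y ≤ S → Y = A ∨ Y = S) (hne : A ≠ S)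
    {s t : K} (hs : conjSubgroup s B = B) (ht : conjSubgroup t A = A)
    (hst : s * t * s = t * s * t) (h₁ : conjSubgroup s S ≠ S) (h₂ : conjSubgroup t S ≠ S)
    (h₃ : conjSubgroup (s * t) S ≠ S) (h₄ : conjSubgroup (t * s) S ≠ S)
    (h₅ : conjSubgroup (s * t * s) S ≠ S) :
    ¬ ReducedCohomologyVanishes (funSystem hS hC R V) := by
  classical
  intro hvan
  obtain ⟨v, hv⟩ := exists_ne (0 : V)
  let χ : Subgroup K → Subgroup K → V := edgeIndicator A S v
  have hχ : ∀ X Y, ¬ (X = A ∧ Y = S) → χ X Y = 0 := fun X Y h => if_neg h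
  have hχ' : χ A S = v := if_pos ⟨rfl, rfl⟩
  -- Only chains from A to S matter, and they have no proper middle term. Nothing self-centralizing
  -- lies strictly below A, since A = C(A) ≤ C(X) ≤ X, and nothing above S has order at most |S|.
  have hcocycle : ∀ X Y Z : Subgroup K, X ≤ Y → Y ≤ Z →
      Subgroup.centralizer (X : Set K) ≤ X → Nat.card Z ≤ Nat.card S →
      χ Y Z - χ X Z + χ X Y = 0 := by
    intro X Y Z hXY hYZ hX hZ
    by_cases hXZ : X = A ∧ Z = S
    · obtain ⟨rfl, rfl⟩ := hXZ
      rcases hmax Y hXY hYZ with rfl | rfl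
      · rw [hχ Y Y (fun h => hne h.2), sub_self, zero_add]
      · rw [hχ Y Y (fun h => hne h.1.symm), zero_sub, neg_add_cancel]
    · rw [hχ X Z hXZ, sub_zero]
      rw [hχ Y Z, hχ X Y, add_zero]
      · rintro ⟨rfl, rfl⟩
        exact hXZ ⟨rfl, (Subgroup.eq_of_le_of_card_ge hYZ hZ).symm⟩
      · rintro ⟨rfl, rfl⟩
        refine hXZ ⟨le_antisymm hXY ?_, rfl⟩
        refine le_trans ?_ hX
        rw [← hA]
        exact (Subgroup.centralizer_le hXY)
  have hsplit := (BarResolution.reducedCohomologyVanishes_iff _).1 hvan 0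
  let sub (x : Covering.Cover (toGroup hS hC)) := coverSubgroup hS hC x
  obtain ⟨g, hg⟩ := Covering.cochains_of_cocyclesSplit hsplit
    (fun τ => χ (sub (τ.obj 0)) (sub (τ.obj 1))) (by
      funext (τ : ComposableArrows (Covering.Cover (toGroup hS hC)) 2)
      have := hcocycle (sub (τ.obj 0)) (sub (τ.obj 1)) (sub (τ.obj 2))
        (coverSubgroup_mono hS hC (τ.map' 0 1)) (coverSubgroup_mono hS hC (τ.map' 1 2))
        (centralizer_coverSubgroup_le hS hC _) (card_coverSubgroup_le hS hC _)
      refine (Fin.sum_univ_three _).trans (Eq.trans ?_ this)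
      change ((-1 : ℤ) ^ 0) • χ (sub (τ.obj 1)) (sub (τ.obj 2)) +
        ((-1 : ℤ) ^ 1) • χ (sub (τ.obj 0)) (sub (τ.obj 2)) +
        ((-1 : ℤ) ^ 2) • χ (sub (τ.obj 0)) (sub (τ.obj 1)) = _
      simp [sub_eq_add_neg])
  let h (x : Covering.Cover (toGroup hS hC)) : V := g (ComposableArrows.mk₀ x)
  have hedge : ∀ {x y : Covering.Cover (toGroup hS hC)} (_ : x ⟶ y),
      h y - h x = χ (sub x) (sub y) := by
    intro x y f
    have h₁ := congrFun hg (ComposableArrows.mk₁ f)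
    replace h₁ := (Fin.sum_univ_two _).symm.trans h₁
    simp only [Fin.val_zero, Fin.val_one, pow_zero, pow_one, one_smul, neg_smul] at h₁
    have e₀ : (nerve (Covering.Cover (toGroup hS hC))).δ 0 (ComposableArrows.mk₁ f) =
        ComposableArrows.mk₀ y := ComposableArrows.ext₀ rfl
    have e₁ : (nerve (Covering.Cover (toGroup hS hC))).δ 1 (ComposableArrows.mk₁ f) =
        ComposableArrows.mk₀ x := ComposableArrows.ext₀ rfl
    rw [sub_eq_add_neg]
    refine Eq.trans ?_ h₁
    exact congrArg₂ (fun a b => g a + -g b) e₀.symm e₁.symm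
  have hcentric : ∀ {H : Subgroup K} {P : Subgroup S}, amb P = H →
      Subgroup.centralizer (H : Set K) ≤ H → (fusion S).IsCentric P := by
    rintro _ P rfl hle
    exact isCentric_of_centralizer_le hle
  obtain ⟨PA, hPA⟩ := exists_amb_eq hAS
  obtain ⟨PB, hPB⟩ := exists_amb_eq hBS
  have htop : amb (⊤ : Subgroup S) = S := by
    ext x
    exact ⟨fun hx => amb_le _ hx, fun hx => ⟨⟨x, hx⟩, trivial, rfl⟩⟩
  have cA := hcentric hPA hA.le
  have cB := hcentric hPB hB
  have cS : (fusion S).IsCentric ⊤ := (fusion S).isCentric_top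
  let a (w : K) : V := h (coverObj hS hC cA w)
  let b (w : K) : V := h (coverObj hS hC cB w)
  let c (w : K) : V := h (coverObj hS hC cS w)
  have hac : ∀ w, c w - a w = χ (conjSubgroup w A) (conjSubgroup w S) := by
    intro w
    have := hedge (coverHom hS hC cA cS w w fun x hx => by
      rw [hPA] at hx
      rw [htop]
      simpa using hAS hx)
    simp only [sub, coverSubgroup_coverObj, hPA, htop] at this
    exact this
  have hbc : ∀ w, c w - b w = χ (conjSubgroup w B) (conjSubgroup w S) := by
    intro w
    have := hedge (coverHom hS hC cB cS w w fun x hx => by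
      rw [hPB] at hx
      rw [htop]
      simpa using hBS hx)
    simp only [sub, coverSubgroup_coverObj, hPB, htop] at this
    exact this
  have hconj : ∀ {H : Subgroup K} {u : K}, conjSubgroup u H = H → ∀ (w x : K), x ∈ H →
      ((w * u)⁻¹ * w) * x * ((w * u)⁻¹ * w)⁻¹ ∈ H := by
    intro H u hu w x hx
    rw [← hu, mem_conjSubgroup] at hx
    convert hx using 1
    group
  have haa : ∀ w, a (w * t) = a w := by
    intro w
    have := hedge (coverHom hS hC cA cA w (w * t) fun x hx => by
      rw [hPA] at hx ⊢
      exact hconj ht w x hx)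
    simp only [sub, coverSubgroup_coverObj, hPA] at this
    rw [← conjSubgroup_conjSubgroup, ht, hχ _ _ (fun h => hne (h.1.symm.trans h.2)),
      sub_eq_zero] at this
    exact this
  have hbb : ∀ w, b (w * s) = b w := by
    intro w
    have := hedge (coverHom hS hC cB cB w (w * s) fun x hx => by
      rw [hPB] at hx ⊢
      exact hconj hs w x hx)
    simp only [sub, coverSubgroup_coverObj, hPB] at this
    rw [← conjSubgroup_conjSubgroup, hs, hχ _ _ (fun h => hne (h.1.symm.trans h.2)),
      sub_eq_zero] at this
    exact this
  have hca : ∀ w, conjSubgroup w S ≠ S → c w = a w := fun w hw =>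
    sub_eq_zero.1 ((hac w).trans (hχ _ _ fun h => hw h.2))
  have hcb : ∀ w, conjSubgroup w S ≠ S → c w = b w := fun w hw =>
    sub_eq_zero.1 ((hbc w).trans (hχ _ _ fun h => hw h.2))
  have hc₁ : c 1 = b 1 := by
    refine sub_eq_zero.1 ((hbc 1).trans (hχ _ _ fun h => hAB ?_))
    rw [← h.1, conjSubgroup_one]
  have hc₂ : c 1 - a 1 = v := by
    rw [hac, conjSubgroup_one, conjSubgroup_one, hχ']
  -- The two sides of the hexagon from 1 to sts = tst: neighbouring conjugates of S share a
  -- conjugate of A or B, and the potential is constant along every edge other than the one from A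
  -- to S.
  have hleft : c 1 = c (s * t * s) := by
    rw [hc₁, ← hbb 1, one_mul, ← hcb s h₁, hca s h₁, ← haa s, ← hca _ h₃, hcb _ h₃, ← hbb (s * t),
      ← hcb _ h₅]
  have hright : a 1 = c (s * t * s) := by
    rw [← haa 1, one_mul, ← hca t h₂, hcb t h₂, ← hbb t, ← hcb _ h₄, hca _ h₄, ← haa (t * s),
      ← hst, ← hca _ h₅]
  rw [hleft, hright, sub_self] at hc₂
  exact hv hc₂.symm

end GroupFusion

/-! ### The projective general linear group of degree three -/

/-- The Heisenberg group of unitriangular matrices, in coordinates. -/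
@[ext]
structure Heisenberg (F : Type) where
  a : F
  b : F
  c : F

namespace Heisenberg

lemma card_eq (F : Type) : Nat.card (Heisenberg F) = Nat.card F ^ 3 := by
  let e : Heisenberg F ≃ F × F × F :=
    { toFun := fun x => (x.a, x.b, x.c)
      invFun := fun x => ⟨x.1, x.2.1, x.2.2⟩
      left_inv := fun _ => rfl
      right_inv := fun _ => rfl }
  rw [Nat.card_congr e, Nat.card_prod, Nat.card_prod]
  ring

variable {F : Type} [CommRing F]

instance : Mul (Heisenberg F) := ⟨fun x y => ⟨x.a + y.a, x.b + y.b, x.c + y.c + x.a * y.b⟩⟩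

instance : One (Heisenberg F) := ⟨⟨0, 0, 0⟩⟩

instance : Inv (Heisenberg F) := ⟨fun x => ⟨-x.a, -x.b, -x.c + x.a * x.b⟩⟩

@[simp] lemma mul_a (x y : Heisenberg F) : (x * y).a = x.a + y.a := rfl

@[simp] lemma mul_b (x y : Heisenberg F) : (x * y).b = x.b + y.b := rfl

@[simp] lemma mul_c (x y : Heisenberg F) : (x * y).c = x.c + y.c + x.a * y.b := rfl

@[simp] lemma one_a : (1 : Heisenberg F).a = 0 := rfl

@[simp] lemma one_b : (1 : Heisenberg F).b = 0 := rfl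

@[simp] lemma one_c : (1 : Heisenberg F).c = 0 := rfl

@[simp] lemma inv_a (x : Heisenberg F) : x⁻¹.a = -x.a := rfl

@[simp] lemma inv_b (x : Heisenberg F) : x⁻¹.b = -x.b := rfl

@[simp] lemma inv_c (x : Heisenberg F) : x⁻¹.c = -x.c + x.a * x.b := rfl

instance : Group (Heisenberg F) :=
  Group.ofLeftAxioms
    (fun x y z => by ext <;> simp <;> ring)
    (fun x => by ext <;> simp)
    (fun x => by ext <;> simp)

/-- The first coordinate as a homomorphism. -/
def aHom : Heisenberg F →* Multiplicative F where
  toFun x := Multiplicative.ofAdd x.a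
  map_one' := rfl
  map_mul' _ _ := rfl

/-- The second coordinate as a homomorphism. -/
def bHom : Heisenberg F →* Multiplicative F where
  toFun x := Multiplicative.ofAdd x.b
  map_one' := rfl
  map_mul' _ _ := rfl

lemma mem_ker_aHom {x : Heisenberg F} : x ∈ (aHom (F := F)).ker ↔ x.a = 0 := Iff.rfl

lemma mem_ker_bHom {x : Heisenberg F} : x ∈ (bHom (F := F)).ker ↔ x.b = 0 := Iff.rfl

/-- The unitriangular matrix with given coordinates. -/
def toMatrix (x : Heisenberg F) : Matrix (Fin 3) (Fin 3) F := !![1, x.a, x.c; 0, 1, x.b; 0, 0, 1]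

lemma toMatrix_mul (x y : Heisenberg F) : (x * y).toMatrix = x.toMatrix * y.toMatrix := by
  ext i j
  fin_cases i <;> fin_cases j <;> simp [toMatrix, Matrix.mul_apply, Fin.sum_univ_three] <;> ring

lemma toMatrix_one : (1 : Heisenberg F).toMatrix = 1 := by
  ext i j
  fin_cases i <;> fin_cases j <;> simp [toMatrix]

/-- The Heisenberg group in the general linear group. -/
def toGL : Heisenberg F →* Matrix.GeneralLinearGroup (Fin 3) F :=
  MonoidHom.toHomUnits ⟨⟨toMatrix, toMatrix_one⟩, toMatrix_mul⟩

lemma toGL_coe (x : Heisenberg F) : (toGL x : Matrix (Fin 3) (Fin 3) F) = x.toMatrix := rfl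

end Heisenberg

namespace ProjectiveLinear

open GroupFusion Heisenberg

variable (p : ℕ) [Fact p.Prime]

/-- `PGL₃(𝔽_p)`. -/
abbrev PGL : Type := Matrix.GeneralLinearGroup (Fin 3) (ZMod p) ⧸
  Subgroup.center (Matrix.GeneralLinearGroup (Fin 3) (ZMod p))

/-- The projection from the general linear group. -/
abbrev proj : Matrix.GeneralLinearGroup (Fin 3) (ZMod p) →* PGL p := QuotientGroup.mk' _

/-- The Heisenberg group in the projective general linear group. -/
def heis : Heisenberg (ZMod p) →* PGL p := (proj p).comp toGL

/-- The Sylow subgroup of unitriangular matrices. -/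
def sylow : Subgroup (PGL p) := (heis p).range

variable {p}

lemma exists_scalar {z : Matrix.GeneralLinearGroup (Fin 3) (ZMod p)}
    (hz : z ∈ Subgroup.center (Matrix.GeneralLinearGroup (Fin 3) (ZMod p))) :
    ∃ r : ZMod p, ∀ i j, (z : Matrix (Fin 3) (Fin 3) (ZMod p)) i j = if i = j then r else 0 := by
  obtain ⟨r, hr⟩ := Matrix.GeneralLinearGroup.mem_center_iff_val_mem_range_scalar.1 hz
  refine ⟨r, fun i j => ?_⟩
  rw [← hr]
  simp [Matrix.scalar_apply, Matrix.diagonal_apply]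

lemma mem_center_of_scalar {z : Matrix.GeneralLinearGroup (Fin 3) (ZMod p)} (r : ZMod p)
    (h : ∀ i j, (z : Matrix (Fin 3) (Fin 3) (ZMod p)) i j = if i = j then r else 0) :
    z ∈ Subgroup.center (Matrix.GeneralLinearGroup (Fin 3) (ZMod p)) := by
  refine Matrix.GeneralLinearGroup.mem_center_iff_val_mem_range_scalar.2 ⟨r, ?_⟩
  ext i j
  rw [h]
  simp [Matrix.scalar_apply, Matrix.diagonal_apply]

/-- The Frobenius is the identity on `ZMod p`, so the scalars contain no nontrivial p-elements. -/
lemma eq_one_of_pow_eq_one {z : Matrix.GeneralLinearGroup (Fin 3) (ZMod p)}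
    (hz : z ∈ Subgroup.center (Matrix.GeneralLinearGroup (Fin 3) (ZMod p))) {n : ℕ}
    (h : z ^ p ^ n = 1) : z = 1 := by
  obtain ⟨r, hr⟩ := Matrix.GeneralLinearGroup.mem_center_iff_val_mem_range_scalar.1 hz
  rw [← h]
  apply Units.ext
  rw [Units.val_pow_eq_pow_val, ← hr, ← map_pow, ZMod.pow_card_pow]

lemma heis_injective : Function.Injective (heis p) := by
  rw [injective_iff_map_eq_one]
  intro x hx
  obtain ⟨r, hr⟩ := exists_scalar ((QuotientGroup.eq_one_iff _).1 hx)
  have h₁ := hr 0 1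
  have h₂ := hr 1 2
  have h₃ := hr 0 2
  simp only [toGL_coe, toMatrix] at h₁ h₂ h₃
  ext
  · simpa using h₁
  · simpa using h₂
  · simpa using h₃

/-- Elements that commute with a unipotent element in the projective group commute with it in the
linear group. -/
lemma commute_of_commute {g : Matrix.GeneralLinearGroup (Fin 3) (ZMod p)} {x : Heisenberg (ZMod p)}
    (h : heis p x * proj p g = proj p g * heis p x) : toGL x * g = g * toGL x := by
  have hz : (g * toGL x)⁻¹ * (toGL x * g) ∈
      Subgroup.center (Matrix.GeneralLinearGroup (Fin 3) (ZMod p)) := by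
    rw [← QuotientGroup.eq]
    exact h.symm
  -- The commutator z of x and g is central and xz is conjugate to x, so z is killed by the same
  -- p-power as x and must be trivial.
  have hpow : x ^ p ^ 3 = 1 := by
    have := pow_card_eq_one' (x := x)
    rwa [Heisenberg.card_eq, Nat.card_zmod] at this
  have h₁ : toGL x * ((g * toGL x)⁻¹ * (toGL x * g)) = g⁻¹ * toGL x * g := by group
  have h₂ := (Subgroup.mem_center_iff.1 hz (toGL x))
  have h₃ : ((g * toGL x)⁻¹ * (toGL x * g)) ^ p ^ 3 = 1 := by
    have h₄ : (toGL x * ((g * toGL x)⁻¹ * (toGL x * g))) ^ p ^ 3 = (g⁻¹ * toGL x * g) ^ p ^ 3 := by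
      rw [h₁]
    rw [Commute.mul_pow h₂, ← map_pow, hpow, map_one, one_mul] at h₄
    rw [h₄]
    have : (g⁻¹ * toGL x * g) ^ p ^ 3 = g⁻¹ * toGL x ^ p ^ 3 * g := by
      have := conj_pow (i := p ^ 3) (a := g⁻¹) (b := toGL x)
      rwa [inv_inv] at this
    rw [this, ← map_pow, hpow, map_one, mul_one, inv_mul_cancel]
  exact (inv_mul_eq_one.1 (eq_one_of_pow_eq_one hz h₃)).symm

lemma mem_sylow_of_upper {g : Matrix.GeneralLinearGroup (Fin 3) (ZMod p)} {r : ZMod p}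
    (h₀ : g.1 0 0 = r) (h₁ : g.1 1 1 = r) (h₂ : g.1 2 2 = r) (h₁₀ : g.1 1 0 = 0)
    (h₂₀ : g.1 2 0 = 0) (h₂₁ : g.1 2 1 = 0) : proj p g ∈ sylow p := by
  have hr : r ≠ 0 := by
    rintro rfl
    have hdet : g.1.det ≠ 0 := (Matrix.GeneralLinearGroup.det g).ne_zero
    apply hdet
    rw [Matrix.det_fin_three, h₀, h₁, h₂, h₁₀, h₂₀, h₂₁]
    ring
  obtain ⟨x, key⟩ : ∃ x : Heisenberg (ZMod p), g.1 = (toGL x).1 * Matrix.scalar (Fin 3) r := by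
    refine ⟨⟨r⁻¹ * g.1 0 1, r⁻¹ * g.1 1 2, r⁻¹ * g.1 0 2⟩, ?_⟩
    rw [toGL_coe]
    ext i j
    fin_cases i <;> fin_cases j <;>
      simp [toMatrix, Matrix.scalar_apply, Matrix.mul_diagonal, h₀, h₁, h₂, h₁₀, h₂₀, h₂₁, hr,
        mul_comm]
  refine ⟨x, QuotientGroup.eq.2 (mem_center_of_scalar r fun i j => ?_)⟩
  rw [Units.val_mul, key, ← mul_assoc, Units.inv_mul, one_mul]
  simp [Matrix.scalar_apply, Matrix.diagonal_apply]

lemma lower_eq_zero_of_mem_sylow {g : Matrix.GeneralLinearGroup (Fin 3) (ZMod p)}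
    (h : proj p g ∈ sylow p) : g.1 1 0 = 0 ∧ g.1 2 0 = 0 ∧ g.1 2 1 = 0 := by
  obtain ⟨x, hx⟩ := h
  have hz := QuotientGroup.eq.1 hx
  obtain ⟨r, hr⟩ := exists_scalar hz
  have hg : g.1 = x.toMatrix * ((toGL x)⁻¹ * g).1 := by
    rw [← toGL_coe, ← Units.val_mul, mul_inv_cancel_left]
  generalize ((toGL x)⁻¹ * g).1 = z at hr hg
  rw [hg]
  simp [Matrix.mul_apply, hr, toMatrix]

lemma card_sylow : Nat.card (sylow p) = p ^ 3 := by
  rw [sylow, ← Nat.card_congr (MonoidHom.ofInjective heis_injective).toEquiv, Heisenberg.card_eq,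
    Nat.card_zmod]

lemma isPGroup_sylow : IsPGroup p (sylow p) := IsPGroup.of_card card_sylow

/-- |GL₃(F_p)| = p³(p³ − 1)(p² − 1)(p − 1), and the last three factors are prime to p. -/
lemma not_pow_dvd_card : ¬ p ^ 4 ∣ Nat.card (PGL p) := by
  intro h
  have hp : p.Prime := Fact.out
  have h₁ : p ^ 4 ∣ Nat.card (Matrix.GeneralLinearGroup (Fin 3) (ZMod p)) :=
    h.trans (Subgroup.card_quotient_dvd_card _)
  rw [Matrix.card_GL_field, ZMod.card, Fin.prod_univ_three] at h₁
  have hp1 : 1 ≤ p := hp.one_le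
  have h₂ : (p ^ 3 - p ^ ((0 : Fin 3) : ℕ)) * (p ^ 3 - p ^ ((1 : Fin 3) : ℕ)) *
      (p ^ 3 - p ^ ((2 : Fin 3) : ℕ)) = p ^ 3 * ((p ^ 3 - 1) * (p ^ 2 - 1) * (p - 1)) := by
    have e₁ : p ^ 3 - p ^ ((1 : Fin 3) : ℕ) = p * (p ^ 2 - 1) := by
      rw [Nat.mul_sub, Fin.val_one]
      ring_nf
    have e₂ : p ^ 3 - p ^ ((2 : Fin 3) : ℕ) = p ^ 2 * (p - 1) := by
      rw [Nat.mul_sub, Fin.val_two]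
      ring_nf
    rw [e₁, e₂, Fin.val_zero, pow_zero]
    ring
  rw [h₂, pow_succ p 3, Nat.mul_dvd_mul_iff_left (pow_pos hp.pos 3)] at h₁
  have hne : ∀ n, n ≠ 0 → ¬ p ∣ p ^ n - 1 := by
    intro n hn hd
    have h₃ : p ∣ 1 := (Nat.dvd_sub_iff_right (Nat.one_le_pow _ _ hp.pos) (dvd_pow_self p hn)).1 hd
    exact hp.one_lt.ne' (Nat.dvd_one.1 h₃)
  rcases hp.dvd_mul.1 h₁ with h₁ | h₁
  · rcases hp.dvd_mul.1 h₁ with h₁ | h₁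
    · exact hne 3 (by norm_num) h₁
    · exact hne 2 (by norm_num) h₁
  · exact hne 1 one_ne_zero (by rwa [pow_one])

lemma isSylowIn_sylow : IsSylowIn p (sylow p) ⊤ := by
  refine ⟨le_top, isPGroup_sylow, fun Q _ hQ hle => ?_⟩
  obtain ⟨k, hk⟩ := IsPGroup.iff_card.1 hQ
  have hk3 : k ≤ 3 := by
    by_contra hlt
    exact not_pow_dvd_card ((pow_dvd_pow p (by omega : 4 ≤ k)).trans
      (hk ▸ Subgroup.card_subgroup_dvd_card Q))
  refine (Subgroup.eq_of_le_of_card_ge hle ?_).symm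
  rw [hk, card_sylow]
  exact Nat.pow_le_pow_right (Fact.out : p.Prime).pos hk3

/-- A centric subgroup contains the centre of S and, since S is not abelian, also a noncentral
element. Commuting with the centre makes a matrix upper triangular with equal outer diagonal
entries; commuting with the noncentral element makes the middle entry equal to them. -/
lemma centralizer_le (H : Subgroup (PGL p)) (hH : H ≤ sylow p)
    (hc : sylow p ⊓ Subgroup.centralizer (H : Set (PGL p)) ≤ H) :
    Subgroup.centralizer (H : Set (PGL p)) ≤ H := by
  have hz : heis p ⟨0, 0, 1⟩ ∈ H := by
    refine hc ⟨⟨_, rfl⟩, fun h hh => ?_⟩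
    obtain ⟨x, rfl⟩ := hH hh
    rw [← map_mul, ← map_mul]
    congr 1
    ext <;> simp [add_comm]
  have hu : ∃ x : Heisenberg (ZMod p), heis p x ∈ H ∧ (x.a ≠ 0 ∨ x.b ≠ 0) := by
    by_contra hcon
    push Not at hcon
    have hall : sylow p ≤ H := by
      refine le_trans (le_inf le_rfl ?_) hc
      rintro _ ⟨y, rfl⟩ h hh
      obtain ⟨x, rfl⟩ := hH hh
      obtain ⟨ha, hb⟩ := hcon x hh
      rw [← map_mul, ← map_mul]
      congr 1
      ext <;> simp [add_comm, ha, hb]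
    exact one_ne_zero (hcon ⟨1, 0, 0⟩ (hall ⟨_, rfl⟩)).1
  obtain ⟨x, hxH, hx⟩ := hu
  intro g hg
  refine hc ⟨?_, hg⟩
  obtain ⟨g, rfl⟩ := QuotientGroup.mk'_surjective _ g
  have h₁ := congrArg Units.val (commute_of_commute (hg _ hz))
  have h₂ := congrArg Units.val (commute_of_commute (hg _ hxH))
  rw [Units.val_mul, Units.val_mul, toGL_coe] at h₁ h₂
  have e₁ (i j : Fin 3) := congrFun (congrFun h₁ i) j
  have e₂ (i j : Fin 3) := congrFun (congrFun h₂ i) j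
  simp only [Matrix.mul_apply, Fin.sum_univ_three, toMatrix] at e₁ e₂
  have e₀₀ := e₁ 0 0
  have e₀₁ := e₁ 0 1
  have e₁₂ := e₁ 1 2
  have e₀₂ := e₁ 0 2
  have f₀₁ := e₂ 0 1
  have f₁₂ := e₂ 1 2
  simp at e₀₀ e₀₁ e₁₂ e₀₂ f₀₁ f₁₂
  have h₂₂ : g.1 2 2 = g.1 0 0 := by linear_combination e₀₂
  refine mem_sylow_of_upper rfl ?_ h₂₂ e₁₂ e₀₀ e₀₁
  rcases hx with hx | hx
  · refine mul_left_cancel₀ hx ?_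
    rw [e₀₁] at f₀₁
    linear_combination f₀₁
  · refine mul_left_cancel₀ hx ?_
    rw [e₁₂, h₂₂] at f₁₂
    linear_combination -f₁₂

/-! ### The two unipotent radicals -/

variable (p) in
/-- The unipotent radical of the matrices with vanishing second coordinate. -/
def radicalA : Subgroup (PGL p) := (bHom (F := ZMod p)).ker.map (heis p)

variable (p) in
/-- The unipotent radical of the matrices with vanishing first coordinate. -/
def radicalB : Subgroup (PGL p) := (aHom (F := ZMod p)).ker.map (heis p)

lemma heis_mem_radicalA {x : Heisenberg (ZMod p)} : heis p x ∈ radicalA p ↔ x.b = 0 :=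
  (Subgroup.mem_map_iff_mem heis_injective).trans mem_ker_bHom

lemma heis_mem_radicalB {x : Heisenberg (ZMod p)} : heis p x ∈ radicalB p ↔ x.a = 0 :=
  (Subgroup.mem_map_iff_mem heis_injective).trans mem_ker_aHom

lemma radicalA_le : radicalA p ≤ sylow p := by
  rintro _ ⟨x, _, rfl⟩
  exact ⟨x, rfl⟩

lemma radicalB_le : radicalB p ≤ sylow p := by
  rintro _ ⟨x, _, rfl⟩
  exact ⟨x, rfl⟩

lemma centralizer_radicalA :
    Subgroup.centralizer (radicalA p : Set (PGL p)) = radicalA p := by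
  refine le_antisymm (centralizer_le _ radicalA_le ?_) ?_
  · rintro _ ⟨⟨x, rfl⟩, hx⟩
    have h := hx (heis p ⟨1, 0, 0⟩) (heis_mem_radicalA.2 rfl)
    rw [← map_mul, ← map_mul] at h
    have hc := congrArg Heisenberg.c (heis_injective h)
    refine heis_mem_radicalA.2 ?_
    simpa using hc
  · rintro _ ⟨x, hx, rfl⟩ _ ⟨y, hy, rfl⟩
    rw [← map_mul, ← map_mul]
    congr 1
    ext
    · exact add_comm _ _
    · exact add_comm _ _
    · rw [mul_c, mul_c, mem_ker_bHom.1 hx, mem_ker_bHom.1 hy, mul_zero, mul_zero, add_comm y.c]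

lemma centralizer_radicalB_le :
    Subgroup.centralizer (radicalB p : Set (PGL p)) ≤ radicalB p := by
  refine centralizer_le _ radicalB_le ?_
  rintro _ ⟨⟨x, rfl⟩, hx⟩
  have h := hx (heis p ⟨0, 1, 0⟩) (heis_mem_radicalB.2 rfl)
  rw [← map_mul, ← map_mul] at h
  have hc := congrArg Heisenberg.c (heis_injective h)
  refine heis_mem_radicalB.2 ?_
  simpa using hc

lemma radicalA_ne_radicalB : radicalA p ≠ radicalB p := by
  intro h
  have h₁ : heis p ⟨1, 0, 0⟩ ∈ radicalA p := heis_mem_radicalA.2 rfl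
  rw [h, heis_mem_radicalB] at h₁
  exact one_ne_zero h₁

lemma radicalA_ne_sylow : radicalA p ≠ sylow p := by
  intro h
  have h₁ : heis p ⟨0, 1, 0⟩ ∈ sylow p := ⟨_, rfl⟩
  rw [← h, heis_mem_radicalA] at h₁
  exact one_ne_zero h₁

lemma relIndex_radicalA : (radicalA p).relIndex (sylow p) = p := by
  rw [radicalA, sylow, MonoidHom.range_eq_map,
    Subgroup.relIndex_map_map_of_injective _ _ heis_injective, Subgroup.relIndex_top_right,
    Subgroup.index_ker, MonoidHom.range_eq_top.2 fun b => ⟨⟨0, b.toAdd, 0⟩, rfl⟩,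
    Subgroup.card_top]
  exact Nat.card_zmod p

lemma eq_radicalA_or_eq_sylow (Y : Subgroup (PGL p)) (hA : radicalA p ≤ Y) (hS : Y ≤ sylow p) :
    Y = radicalA p ∨ Y = sylow p := by
  have h := Subgroup.relIndex_mul_relIndex _ _ _ hA hS
  rw [relIndex_radicalA] at h
  rcases (Nat.prime_mul_iff.1 (h ▸ (Fact.out : p.Prime))) with ⟨_, h₁⟩ | ⟨_, h₁⟩
  · exact Or.inr (le_antisymm hS (Subgroup.relIndex_eq_one.1 h₁))
  · exact Or.inl (le_antisymm (Subgroup.relIndex_eq_one.1 h₁) hA)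

/-! ### Weyl group elements and the apartment -/

/-- The permutation matrix of the first simple reflection. -/
def reflS (p : ℕ) [Fact p.Prime] : Matrix.GeneralLinearGroup (Fin 3) (ZMod p) where
  val := !![0, 1, 0; 1, 0, 0; 0, 0, 1]
  inv := !![0, 1, 0; 1, 0, 0; 0, 0, 1]
  val_inv := by ext i j; fin_cases i <;> fin_cases j <;> simp
  inv_val := by ext i j; fin_cases i <;> fin_cases j <;> simp

/-- The permutation matrix of the second simple reflection. -/
def reflT (p : ℕ) [Fact p.Prime] : Matrix.GeneralLinearGroup (Fin 3) (ZMod p) where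
  val := !![1, 0, 0; 0, 0, 1; 0, 1, 0]
  inv := !![1, 0, 0; 0, 0, 1; 0, 1, 0]
  val_inv := by ext i j; fin_cases i <;> fin_cases j <;> simp
  inv_val := by ext i j; fin_cases i <;> fin_cases j <;> simp

lemma reflS_coe : (reflS p).1 = !![0, 1, 0; 1, 0, 0; 0, 0, 1] := rfl

lemma reflT_coe : (reflT p).1 = !![1, 0, 0; 0, 0, 1; 0, 1, 0] := rfl

lemma reflS_inv : (reflS p)⁻¹ = reflS p := Units.ext rfl

lemma reflT_inv : (reflT p)⁻¹ = reflT p := Units.ext rfl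

lemma reflS_braid : reflS p * reflT p * reflS p = reflT p * reflS p * reflT p := by
  apply Units.ext
  simp only [Units.val_mul, reflS_coe, reflT_coe]
  ext i j
  fin_cases i <;> fin_cases j <;> simp

lemma conjSubgroup_reflS : conjSubgroup (proj p (reflS p)) (radicalB p) = radicalB p := by
  refine Subgroup.eq_of_le_of_card_ge ?_ (card_conjSubgroup _ _).ge
  rintro _ ⟨_, ⟨x, hx, rfl⟩, rfl⟩
  have ha := mem_ker_aHom.1 hx
  refine ⟨⟨0, x.c, x.b⟩, mem_ker_aHom.2 rfl, ?_⟩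
  refine congrArg (proj p) (?_ : _ = reflS p * toGL x * (reflS p)⁻¹)
  rw [eq_mul_inv_iff_mul_eq]
  apply Units.ext
  simp only [Units.val_mul, reflS_coe, toGL_coe, toMatrix, ha]
  ext i j
  fin_cases i <;> fin_cases j <;> simp

lemma conjSubgroup_reflT : conjSubgroup (proj p (reflT p)) (radicalA p) = radicalA p := by
  refine Subgroup.eq_of_le_of_card_ge ?_ (card_conjSubgroup _ _).ge
  rintro _ ⟨_, ⟨x, hx, rfl⟩, rfl⟩
  have hb := mem_ker_bHom.1 hx
  refine ⟨⟨x.c, 0, x.a⟩, mem_ker_bHom.2 rfl, ?_⟩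
  refine congrArg (proj p) (?_ : _ = reflT p * toGL x * (reflT p)⁻¹)
  rw [eq_mul_inv_iff_mul_eq]
  apply Units.ext
  simp only [Units.val_mul, reflT_coe, toGL_coe, toMatrix, hb]
  ext i j
  fin_cases i <;> fin_cases j <;> simp

lemma conjSubgroup_sylow_ne {g : Matrix.GeneralLinearGroup (Fin 3) (ZMod p)}
    (x : Heisenberg (ZMod p)) (h : (g * toGL x * g⁻¹).1 1 0 ≠ 0 ∨ (g * toGL x * g⁻¹).1 2 0 ≠ 0 ∨
      (g * toGL x * g⁻¹).1 2 1 ≠ 0) : conjSubgroup (proj p g) (sylow p) ≠ sylow p := by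
  intro he
  have hmem : proj p (g * toGL x * g⁻¹) ∈ conjSubgroup (proj p g) (sylow p) :=
    conj_mem_conjSubgroup (g := proj p g) (x := heis p x) ⟨x, rfl⟩
  rw [he] at hmem
  obtain ⟨h₁, h₂, h₃⟩ := lower_eq_zero_of_mem_sylow hmem
  rcases h with h | h | h
  · exact h h₁
  · exact h h₂
  · exact h h₃

/-- For each of the five nontrivial Weyl group elements, the witness is a simple root element whose
conjugate has a nonzero entry below the diagonal. -/
lemma not_reducedCohomologyVanishes (R V : Type) [CommRing R] [AddCommGroup V] [Module R V]
    [Nontrivial V] :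
    ¬ ReducedCohomologyVanishes (funSystem (isSylowIn_sylow (p := p)) centralizer_le R V) := by
  refine not_reducedCohomologyVanishes_funSystem _ _ R V (s := proj p (reflS p))
    (t := proj p (reflT p)) radicalA_le radicalB_le centralizer_radicalA centralizer_radicalB_le
    radicalA_ne_radicalB eq_radicalA_or_eq_sylow radicalA_ne_sylow conjSubgroup_reflS
    conjSubgroup_reflT (congrArg (proj p) reflS_braid) ?_ ?_ ?_ ?_ ?_
  · refine conjSubgroup_sylow_ne ⟨1, 0, 0⟩ (Or.inl ?_)
    simp [reflS_inv, reflS_coe, toGL_coe, toMatrix]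
  · refine conjSubgroup_sylow_ne ⟨0, 1, 0⟩ (Or.inr (Or.inr ?_))
    simp [reflT_inv, reflT_coe, toGL_coe, toMatrix]
  · refine conjSubgroup_sylow_ne (g := reflS p * reflT p) ⟨0, 1, 0⟩ ?_
    simp [reflS_inv, reflS_coe, reflT_inv, reflT_coe, toGL_coe, toMatrix]
  · refine conjSubgroup_sylow_ne (g := reflT p * reflS p) ⟨1, 0, 0⟩ ?_
    simp [reflS_inv, reflS_coe, reflT_inv, reflT_coe, toGL_coe, toMatrix]
  · refine conjSubgroup_sylow_ne (g := reflS p * reflT p * reflS p) ⟨1, 0, 0⟩ ?_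
    simp [reflS_inv, reflS_coe, reflT_inv, reflT_coe, toGL_coe, toMatrix]

end ProjectiveLinear

/-- Locally constant coefficients on a centric linking system of `PGL₃(𝔽_p)` with cohomology that
is not detected on the Sylow subgroup. -/
theorem exists_locallyConstant_not_detected (p : ℕ) [Fact p.Prime] :
    ∃ (S : Type) (_ : Group S) (G : PLocalFiniteGroup p S) (M : G.Link ⥤ ModuleCat.{0} (ZLocal p)),
      IsLocallyConstantSystem M ∧ ¬ ReducedCohomologyVanishes M ∧
        ReducedCohomologyVanishes (G.ι ⋙ M) := by
  -- Since ℤ_(p) is not a field, the values have to be taken in an injective module; one that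
  -- contains ℤ_(p) is nonzero.
  let V : ModuleCat.{0} (ZLocal p) := Injective.under (ModuleCat.of (ZLocal p) (ZLocal p))
  have hmono : Function.Injective (Injective.ι (ModuleCat.of (ZLocal p) (ZLocal p))).hom :=
    (ModuleCat.mono_iff_injective _).1 inferInstance
  have : Nontrivial V := hmono.nontrivial
  have : Injective (ModuleCat.of (ZLocal p) V) :=
    inferInstanceAs (Injective (Injective.under (ModuleCat.of (ZLocal p) (ZLocal p))))
  exact ⟨ProjectiveLinear.sylow p, inferInstance,
    GroupFusion.pLocal ProjectiveLinear.isSylowIn_sylow ProjectiveLinear.centralizer_le,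
    GroupFusion.funSystem ProjectiveLinear.isSylowIn_sylow ProjectiveLinear.centralizer_le _ V,
    GroupFusion.isLocallyConstantSystem_funSystem _ _ _ V,
    ProjectiveLinear.not_reducedCohomologyVanishes _ V,
    GroupFusion.reducedCohomologyVanishes_ι_funSystem _ _ _ V⟩

end

theorem mainTheorem1 (p : ℕ) [Fact p.Prime] :
    (∃ (S : Type) (_ : Group S) (G : PLocalFiniteGroup p S) (M : G.Link ⥤ ModuleCat.{0} (ZLocal p)),
      IsLocallyConstantSystem M ∧ ¬ ReducedCohomologyVanishes M ∧ ReducedCohomologyVanishes (G.ι ⋙ M)) ∧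
    (∀ (S : Type) [Group S] [Nontrivial S] (G : PLocalFiniteGroup p S) (I : G.Inclusions),
      (G.ι ⋙ I.J).Faithful →
      ¬ IsModPAcyclic p (nerve I.UniversalCover) →
      ReducedCohomologyVanishes (G.ι ⋙ I.J ⋙ groupRingModule (ZMod p) G.Γ) ∧
      ¬ ReducedCohomologyVanishes (I.J ⋙ groupRingModule (ZMod p) G.Γ)) := by
  exact ⟨exists_locallyConstant_not_detected p,
    fun S _ _ G I hf h => I.groupRing_counterexample hf h⟩
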